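/- Let $G$ be a finite, simple, connected graph. A set $X\subseteq V(G)$ is dominating if every vertex outside $X$ has a neighbour in $X$; the domination number $\gamma(G)$ is the minimum size of a dominating set. A packing is a set of vertices whose closed neighbourhoods $N[v]=N(v)\cup\{v\}$ are pairwise disjoint; the packing number $\rho(G)$ is the maximum size of a packing. An embedding of $G$ in the plane represents the vertices by distinct points of $\mathbb{R}^2$ and each edge by a polygonal arc (a simple curve made of finitely many straight segments) between its two ends, such that an edge contains no vertex other than its ends and distinct edges meet at most in common ends. The graph $G$ is outerplanar if it has an embedding in the plane in which every vertex lies on the boundary of the unbounded face. It is maximal outerplanar if it is outerplanar and, for any two distinct non-adjacent vertices $u,v$, the graph $G+uv$ is not outerplanar. Theorem. For every maximal outerplanar graph $G$, $$\gamma(G)\le \min\left\{3\rho(G),\ \tfrac94\rho(G)+\tfrac t4\right\},$$ where $t$ is the number of vertices of degree at most $3$ in $G$. -/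

import Mathlib

namespace SimpleGraph

/-! ### Domination and packing -/

section DominationPacking

variable {V : Type*} (G : SimpleGraph V)

/-- The closed neighbourhood `N[v] = N(v) ∪ {v}`. -/
def closedNeighborSet (v : V) : Set V := insert v (G.neighborSet v)

/-- `X` is a dominating set: every vertex outside `X` is adjacent to a vertex of `X`. -/
def IsDominatingSet (X : Finset V) : Prop := ∀ v, v ∉ X → ∃ x ∈ X, G.Adj v x

/-- `Y` is a packing: distinct vertices of `Y` have disjoint closed neighbourhoods. -/
def IsPacking (Y : Finset V) : Prop :=
  ∀ u ∈ Y, ∀ v ∈ Y, u ≠ v → Disjoint (G.closedNeighborSet u) (G.closedNeighborSet v)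

/-- The domination number: the minimum size of a dominating set (of a finite graph). -/
noncomputable def dominationNumber [Fintype V] : ℕ :=
  sInf {k | ∃ X : Finset V, G.IsDominatingSet X ∧ X.card = k}

/-- The packing number: the maximum size of a packing (of a finite graph). -/
noncomputable def packingNumber [Fintype V] : ℕ :=
  sSup {k | ∃ Y : Finset V, G.IsPacking Y ∧ Y.card = k}

end DominationPacking

/-! ### Plane embeddings and outerplanarity -/

/-- `A` is a polygonal arc from `a` to `b`: the union of the consecutive segments of a polygonal
line `a = q 0, q 1, …, q (n + 1) = b` that does not touch or cross itself. -/
def IsPolygonalArc (A : Set (EuclideanSpace ℝ (Fin 2))) (a b : EuclideanSpace ℝ (Fin 2)) : Prop :=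
  ∃ (n : ℕ) (q : ℕ → EuclideanSpace ℝ (Fin 2)),
    q 0 = a ∧ q (n + 1) = b ∧
    (∀ i ≤ n, q i ≠ q (i + 1)) ∧
    (∀ i < n, segment ℝ (q i) (q (i + 1)) ∩ segment ℝ (q (i + 1)) (q (i + 2)) = {q (i + 1)}) ∧
    (∀ i j, i + 1 < j → j ≤ n →
      Disjoint (segment ℝ (q i) (q (i + 1))) (segment ℝ (q j) (q (j + 1)))) ∧
    A = ⋃ i ≤ n, segment ℝ (q i) (q (i + 1))

/-- An embedding of `G` in the Euclidean plane: vertices are distinct points, an edge is a polygonal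
arc between its two ends, an edge passes through no vertex other than its ends, and two distinct
edges meet at most in common ends.  (The value of `arc` at a non-edge is irrelevant.) -/
structure PlaneEmbedding {V : Type*} (G : SimpleGraph V) where
  vert : V → EuclideanSpace ℝ (Fin 2)
  arc : Sym2 V → Set (EuclideanSpace ℝ (Fin 2))
  vert_injective : Function.Injective vert
  isPolygonalArc : ∀ u v, G.Adj u v → IsPolygonalArc (arc s(u, v)) (vert u) (vert v)
  mem_of_vert_mem_arc : ∀ e ∈ G.edgeSet, ∀ w, vert w ∈ arc e → w ∈ e
  arc_inter_subset : ∀ e ∈ G.edgeSet, ∀ f ∈ G.edgeSet, e ≠ f →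
    arc e ∩ arc f ⊆ vert '' {w | w ∈ e ∧ w ∈ f}

namespace PlaneEmbedding

variable {V : Type*} {G : SimpleGraph V} (E : G.PlaneEmbedding)

/-- The subset of the plane that is occupied by the vertices and edges. -/
def support : Set (EuclideanSpace ℝ (Fin 2)) := Set.range E.vert ∪ ⋃ e ∈ G.edgeSet, E.arc e

/-- A face: a connected component of the complement of the embedded graph. -/
def IsFace (F : Set (EuclideanSpace ℝ (Fin 2))) : Prop :=
  ∃ x ∈ E.supportᶜ, F = connectedComponentIn E.supportᶜ x

end PlaneEmbedding

/-- `G` has an embedding in the plane such that all of its vertices belong to the boundary of the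
unbounded face. -/
def IsOuterplanar {V : Type*} (G : SimpleGraph V) : Prop :=
  ∃ (E : G.PlaneEmbedding) (F : Set (EuclideanSpace ℝ (Fin 2))),
    E.IsFace F ∧ ¬ Bornology.IsBounded F ∧ ∀ v, E.vert v ∈ frontier F

/-- `G` is outerplanar, and the addition of any new edge breaks its outerplanarity. -/
def IsMaximalOuterplanar {V : Type*} (G : SimpleGraph V) : Prop :=
  G.IsOuterplanar ∧ ∀ u v, u ≠ v → ¬ G.Adj u v → ¬ (G ⊔ SimpleGraph.edge u v).IsOuterplanar

end SimpleGraph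

namespace SimpleGraph

/-! Write `n` for the number of vertices, `γ` and `ρ` for the domination and packing numbers. The
vertices of an outerplanar graph can be ordered so that no two edges cross
(`IsOuterplanar.exists_isNoncrossing`). Conversely, every graph with such an order is outerplanar
(`IsNoncrossing.isOuterplanar`). By maximality each missing chord is therefore crossed by an edge,
which makes the graph a triangulated polygon (`IsNoncrossing.isPolygonTriangulation`). Everything
else is combinatorics of triangulated polygons, by induction over the edges: the apex of the
triangle below an edge splits the polygon behind it into two smaller ones.

The bound `γ ≤ 3ρ` is greedy: a shortest edge that encloses a closed neighbourhood lets one packing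
vertex pay for the three corners of the triangle below it (`exists_packing_hitting`).

For the second bound, a 4-colouring in which every closed neighbourhood misses at most one colour,
and none if the degree is at least 3, gives `4γ ≤ n + #{deg ≤ 2}` by averaging over the colours
(`four_mul_dominationNumber_le`). The right side equals `#{deg ≠ 3} + t`. A dynamic programme over a
finite table of boundary profiles gives `#{deg ≠ 3} ≤ 9ρ` (`card_degree_ne_three_le`), hence `4γ ≤
9ρ + t`.

The noncrossing order rests on the absence of two configurations: three internally disjoint paths,
each with an inner vertex, between two vertices (`not_theta`), and four pairwise adjacent vertices
(`not_isOuterplanar_of_fourClique`). In either case some vertex of degree 3 in a subgraph would have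
all three edges on the boundary of the unbounded face. Two of the three sectors around it would then
lie in that face, so one edge would have the face on both sides. This edge lies on a cycle, and the
winding number of the cycle, which is 0 on the unbounded face, changes across the edge. A vertex
order is then assembled along cut vertices from Hamiltonian cycles. -/

theorem mem_closedNeighborSet {V : Type*} {G : SimpleGraph V} {u v : V} :
    v ∈ G.closedNeighborSet u ↔ v = u ∨ G.Adj u v :=
  Iff.rfl

section Numbers

variable {V : Type*} [Fintype V] {G : SimpleGraph V}

theorem dominationNumber_le_card {X : Finset V} (hX : G.IsDominatingSet X) :
    G.dominationNumber ≤ X.card :=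
  Nat.sInf_le ⟨X, hX, rfl⟩

theorem card_le_packingNumber {Y : Finset V} (hY : G.IsPacking Y) :
    Y.card ≤ G.packingNumber := by
  refine le_csSup ⟨Fintype.card V, ?_⟩ ⟨Y, hY, rfl⟩
  rintro k ⟨Z, -, rfl⟩
  exact Z.card_le_univ

end Numbers

/-! ### Triangulated polygons and the bound by three times the packing number. -/

/-- No two edges cross when the vertices are placed on a line in increasing order and the edges are
drawn in a half-plane bounded by that line. -/
def IsNoncrossing {V : Type*} [LinearOrder V] (G : SimpleGraph V) : Prop :=
  ∀ ⦃a b c d : V⦄, a < b → b < c → c < d → G.Adj a c → ¬ G.Adj b d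

/-- The vertices, in increasing order, are the corners of a convex polygon, and the edges form a
triangulation of this polygon. -/
structure IsPolygonTriangulation {V : Type*} [LinearOrder V] (G : SimpleGraph V) : Prop where
  noncrossing : G.IsNoncrossing
  apex : ∀ ⦃i j : V⦄, G.Adj i j → i < j → (∃ w, i < w ∧ w < j) →
    ∃ k, i < k ∧ k < j ∧ G.Adj i k ∧ G.Adj k j
  root : ∀ ⦃i j : V⦄, (∀ v, i ≤ v ∧ v ≤ j) → i ≠ j → G.Adj i j

section Ordered

variable {V : Type*} [LinearOrder V] {G : SimpleGraph V}

/-- An edge leaving the interval from an inner vertex would cross `i j`. All inductions over edges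
use this to confine closed neighbourhoods of inner vertices. -/
theorem IsNoncrossing.mem_Icc (h : G.IsNoncrossing) {i j w v : V} (hij : G.Adj i j) (hi : i < w)
    (hj : w < j) (hwv : G.Adj w v) : i ≤ v ∧ v ≤ j := by
  constructor
  · by_contra! hv
    exact h hv hi hj hwv.symm hij
  · by_contra! hv
    exact h hi hj hv hij hwv

theorem exists_bot_top [Fintype V] [Nonempty V] : ∃ i j : V, ∀ v, i ≤ v ∧ v ≤ j := by
  obtain ⟨i, hi⟩ := Finite.exists_min (id : V → V)
  obtain ⟨j, hj⟩ := Finite.exists_max (id : V → V)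
  exact ⟨i, j, fun v => ⟨hi v, hj v⟩⟩

-- `U` consists of the vertices still to be hit. One of them with its closed neighbourhood behind a
-- shortest possible edge `i j` joins the packing, and `i`, `j` and the apex join the hitting set.
-- Vertices of `U` not hit by these three lie on the far side of `i j`, and their closed
-- neighbourhoods avoid both `i` and `j`, so they cannot conflict with the new packing vertex.
open Finset in
theorem IsPolygonTriangulation.exists_packing_hitting [Fintype V] [Nontrivial V]
    (h : G.IsPolygonTriangulation) (U : Finset V) :
    ∃ P ⊆ U, G.IsPacking P ∧ ∃ X : Finset V, X.card ≤ 3 * P.card ∧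
      ∀ u ∈ U, ∃ x ∈ X, x ∈ G.closedNeighborSet u := by
  classical
  induction U using Finset.strongInduction with
  | H U ih =>
  rcases U.eq_empty_or_nonempty with rfl | ⟨u₀, hu₀⟩
  · exact ⟨∅, subset_rfl, by simp [IsPacking], ∅, by simp, by simp⟩
  -- Edges behind which some closed neighbourhood of a vertex of `U` is completely contained; the
  -- outermost edge is one.
  let good : Finset (V × V) := univ.filter fun p =>
    p.1 < p.2 ∧ G.Adj p.1 p.2 ∧ ∃ u ∈ U, ∀ v ∈ G.closedNeighborSet u, p.1 ≤ v ∧ v ≤ p.2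
  have hgood : good.Nonempty := by
    obtain ⟨i, j, hij⟩ := exists_bot_top (V := V)
    have hne : i ≠ j := by
      rintro rfl
      obtain ⟨x, hx⟩ := exists_ne i
      exact hx (le_antisymm (hij x).2 (hij x).1)
    refine ⟨(i, j), ?_⟩
    simp only [good, mem_filter, mem_univ, true_and]
    exact ⟨lt_of_le_of_ne (hij j).1 hne, h.root hij hne, u₀, hu₀, fun v _ => hij v⟩
  obtain ⟨⟨i, j⟩, hmem, hmin⟩ := good.exists_min_image
    (fun p => (univ.filter fun v => p.1 ≤ v ∧ v ≤ p.2).card) hgood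
  simp only [good, mem_filter, mem_univ, true_and] at hmem
  obtain ⟨hlt, hadj, u, huU, hu⟩ := hmem
  have hshrink : ∀ a b, i ≤ a → b ≤ j → a < b → G.Adj a b → (a ≠ i ∨ b ≠ j) →
      ∀ w ∈ U, ¬ ∀ v ∈ G.closedNeighborSet w, a ≤ v ∧ v ≤ b := by
    intro a b ha hb hab hadj' hne w hw hall
    have h1 := hmin (a, b) (by
      simp only [good, mem_filter, mem_univ, true_and]
      exact ⟨hab, hadj', w, hw, hall⟩)
    refine absurd h1 (not_le.2 (card_lt_card ?_))
    rw [Finset.ssubset_iff_of_subset]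
    · rcases hne with hne | hne
      · exact ⟨i, by simp [hlt.le], by simp [lt_of_le_of_ne ha hne.symm]⟩
      · exact ⟨j, by simp [hlt.le], by simp [lt_of_le_of_ne hb hne]⟩
    · intro v
      simp only [mem_filter, mem_univ, true_and]
      exact fun hv => ⟨ha.trans hv.1, hv.2.trans hb⟩
  obtain ⟨X₀, hX₀, hiX, hjX, hapart⟩ : ∃ X₀ : Finset V, X₀.card ≤ 3 ∧ i ∈ X₀ ∧ j ∈ X₀ ∧
      ∀ w ∈ U, (∀ x ∈ X₀, x ∉ G.closedNeighborSet w) → w < i ∨ j < w := by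
    by_cases hw : ∃ w, i < w ∧ w < j
    · obtain ⟨k, hik, hkj, haik, hakj⟩ := h.apex hadj hlt hw
      refine ⟨{i, k, j}, card_le_three, by simp, by simp, fun w hwU hav => ?_⟩
      simp only [mem_insert, mem_singleton, forall_eq_or_imp, forall_eq,
        mem_closedNeighborSet, not_or] at hav
      by_contra! hw'
      have h1 : i < w := lt_of_le_of_ne hw'.1 hav.1.1
      have h2 : w < j := lt_of_le_of_ne hw'.2 (Ne.symm hav.2.2.1)
      rcases lt_or_gt_of_ne hav.2.1.1 with hk | hk
      -- An unhit vertex between `k` and `j` has its closed neighbourhood behind the shorter edge `k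
      -- j`, against minimality.
      · refine hshrink k j hik.le le_rfl hkj hakj (Or.inl hik.ne') w hwU ?_
        rintro v (rfl | hv)
        · exact ⟨hk.le, h2.le⟩
        · exact h.noncrossing.mem_Icc hakj hk h2 hv
      · refine hshrink i k le_rfl hkj.le hik haik (Or.inr hkj.ne) w hwU ?_
        rintro v (rfl | hv)
        · exact ⟨h1.le, hk.le⟩
        · exact h.noncrossing.mem_Icc haik h1 hk hv
    · refine ⟨{i, j}, card_le_two.trans (by norm_num), by simp, by simp, fun w _ hav => ?_⟩
      simp only [mem_insert, mem_singleton, forall_eq_or_imp, forall_eq,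
        mem_closedNeighborSet, not_or] at hav
      by_contra! hw'
      exact hw ⟨w, lt_of_le_of_ne hw'.1 hav.1.1, lt_of_le_of_ne hw'.2 (Ne.symm hav.2.1)⟩
  let U' := U.filter fun w => ∀ x ∈ X₀, x ∉ G.closedNeighborSet w
  have huX : u ∉ U' := by
    intro hu'
    obtain ⟨-, hu'⟩ := mem_filter.1 hu'
    have := hu u (Or.inl rfl)
    rcases hapart u huU hu' with h1 | h1
    · exact absurd this.1 (not_le.2 h1)
    · exact absurd this.2 (not_le.2 h1)
  obtain ⟨P, hPU, hP, X, hXP, hX⟩ := ih U'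
    ((filter_subset _ _).ssubset_of_mem_notMem huU huX)
  have hdisj : ∀ w ∈ U', Disjoint (G.closedNeighborSet u) (G.closedNeighborSet w) := by
    intro w hw
    obtain ⟨hwU, hw'⟩ := mem_filter.1 hw
    rw [Set.disjoint_left]
    intro v hvu hvw
    have hv := hu v hvu
    have hvi : v ≠ i := by rintro rfl; exact hw' _ hiX hvw
    have hvj : v ≠ j := by rintro rfl; exact hw' _ hjX hvw
    have h1 := lt_of_le_of_ne hv.1 hvi.symm
    have h2 := lt_of_le_of_ne hv.2 hvj
    rcases hvw with rfl | hvw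
    · rcases hapart _ hwU hw' with h3 | h3
      · exact absurd h1 h3.asymm
      · exact absurd h2 h3.asymm
    -- A common neighbour `v` would lie strictly inside the interval, so its neighbour `w` could not
    -- lie outside.
    · have h4 := h.noncrossing.mem_Icc hadj h1 h2 hvw.symm
      rcases hapart _ hwU hw' with h3 | h3
      · exact absurd h4.1 (not_le.2 h3)
      · exact absurd h4.2 (not_le.2 h3)
  have huP : u ∉ P := fun hu' => huX (hPU hu')
  refine ⟨insert u P, insert_subset huU (hPU.trans (filter_subset _ _)), ?_, X₀ ∪ X, ?_, ?_⟩
  · intro a ha b hb hab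
    rcases mem_insert.1 ha with ha' | ha' <;> rcases mem_insert.1 hb with hb' | hb'
    · exact absurd (ha'.trans hb'.symm) hab
    · exact ha' ▸ hdisj b (hPU hb')
    · exact hb' ▸ (hdisj a (hPU ha')).symm
    · exact hP a ha' b hb' hab
  · rw [card_insert_of_notMem huP]
    have := card_union_le X₀ X
    omega
  · intro w hw
    by_cases hw' : w ∈ U'
    · obtain ⟨x, hx, hx'⟩ := hX w hw'
      exact ⟨x, mem_union_right _ hx, hx'⟩
    · simp only [U', mem_filter, hw, true_and, not_forall, not_not] at hw'
      obtain ⟨x, hx, hx'⟩ := hw'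
      exact ⟨x, mem_union_left _ hx, hx'⟩

theorem IsPolygonTriangulation.dominationNumber_le [Fintype V] [Nontrivial V]
    (h : G.IsPolygonTriangulation) : G.dominationNumber ≤ 3 * G.packingNumber := by
  obtain ⟨P, -, hP, X, hXP, hX⟩ := h.exists_packing_hitting Finset.univ
  have hdom : G.IsDominatingSet X := by
    intro v hv
    obtain ⟨x, hx, rfl | hx'⟩ := hX v (Finset.mem_univ v)
    · exact absurd hx hv
    · exact ⟨x, hx, hx'⟩
  have := dominationNumber_le_card hdom
  have := card_le_packingNumber hP
  omega

end Ordered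

end SimpleGraph

/-! ### Four-colourings and domination in terms of the number of vertices. -/

namespace SimpleGraph

section Colouring

variable {V : Type*} [LinearOrder V] {G : SimpleGraph V}

/-- Induction on the number of vertices strictly between the ends: the apex over `i j` lies behind
neither `i k` nor `k j`. -/
theorem IsPolygonTriangulation.edge_induction [Finite V] (h : G.IsPolygonTriangulation)
    {C : V → V → Prop}
    (side : ∀ i j, i < j → G.Adj i j → (∀ w, i < w → ¬ w < j) → C i j)
    (glue : ∀ i k j, i < k → k < j → G.Adj i k → G.Adj k j → G.Adj i j → C i k → C k j → C i j) :
    ∀ i j, i < j → G.Adj i j → C i j := by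
  have key : ∀ (N : ℕ) (i j : V), {w | i < w ∧ w < j}.ncard < N → i < j → G.Adj i j → C i j := by
    intro N
    induction N with
    | zero => intro i j hN; omega
    | succ N ih =>
      intro i j hN hlt hadj
      by_cases hw : ∃ w, i < w ∧ w < j
      · obtain ⟨k, hik, hkj, haik, hakj⟩ := h.apex hadj hlt hw
        have h1 : {w | i < w ∧ w < k}.ncard < {w | i < w ∧ w < j}.ncard := by
          refine Set.ncard_lt_ncard ⟨fun w hw => ⟨hw.1, hw.2.trans hkj⟩, fun hs => ?_⟩
          exact lt_irrefl k (hs (show k ∈ {w | i < w ∧ w < j} from ⟨hik, hkj⟩)).2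
        have h2 : {w | k < w ∧ w < j}.ncard < {w | i < w ∧ w < j}.ncard := by
          refine Set.ncard_lt_ncard ⟨fun w hw => ⟨hik.trans hw.1, hw.2⟩, fun hs => ?_⟩
          exact lt_irrefl k (hs (show k ∈ {w | i < w ∧ w < j} from ⟨hik, hkj⟩)).1
        exact glue i k j hik hkj haik hakj hadj (ih i k (by omega) hik haik)
          (ih k j (by omega) hkj hakj)
      · push Not at hw
        exact side i j hlt hadj fun w h1 h2 => absurd h2 (not_lt.2 (hw w h1))
  exact fun i j => key _ i j (Nat.lt_succ_self _)

/-- The vertex `v` or one of its neighbours has colour `x`. -/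
def SeesColour (G : SimpleGraph V) (col : V → Fin 4) (v : V) (x : Fin 4) : Prop :=
  ∃ u ∈ G.closedNeighborSet v, col u = x

theorem exists_fourth_colour : ∀ a b c : Fin 4, a ≠ b → a ≠ c → b ≠ c →
    ∃ d, a ≠ d ∧ b ≠ d ∧ c ≠ d ∧ ∀ x, x = a ∨ x = b ∨ x = c ∨ x = d := by
  decide

theorem exists_adj_of_three_le_degree [Fintype V] [DecidableRel G.Adj] {w : V} (a b : V)
    (h : 3 ≤ G.degree w) : ∃ v, G.Adj w v ∧ v ≠ a ∧ v ≠ b := by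
  by_contra! hcon
  have hsub : G.neighborFinset w ⊆ {a, b} := by
    intro v hv
    rw [mem_neighborFinset] at hv
    by_cases hva : v = a
    · simp [hva]
    · simp [hcon v hv hva]
  have := (Finset.card_le_card hsub).trans Finset.card_le_two
  rw [card_neighborFinset_eq_degree] at this
  omega

/-- The triangle on `i j` receives the colours `a`, `b`, `c`, and both triangles behind its other
two sides receive the fourth colour `d` at their apexes. Thus two triangles sharing a side show all
four colours, and a vertex of degree at least 3 lies in two such triangles. The clauses on the ends
`i` and `j` are not needed in the induction; they serve the ends of the outermost edge. -/
theorem IsPolygonTriangulation.exists_colouring_edge [Fintype V] [DecidableRel G.Adj]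
    (h : G.IsPolygonTriangulation) : ∀ i j, i < j → G.Adj i j →
    ∀ a b c : Fin 4, a ≠ b → a ≠ c → b ≠ c → ∃ col : V → Fin 4, col i = a ∧ col j = b ∧
      ((∃ w, i < w ∧ w < j) → ∃ k, i < k ∧ k < j ∧ G.Adj i k ∧ G.Adj k j ∧ col k = c) ∧
      (∀ w w', i < w → w < j → i < w' → w' < j → G.Adj i w → G.Adj i w' → w ≠ w' →
        ∀ x, G.SeesColour col i x) ∧
      (∀ w w', i < w → w < j → i < w' → w' < j → G.Adj j w → G.Adj j w' → w ≠ w' →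
        ∀ x, G.SeesColour col j x) ∧
      ∀ w, i < w → w < j → (∀ x y, x ≠ y → G.SeesColour col w x ∨ G.SeesColour col w y) ∧
        (3 ≤ G.degree w → ∀ x, G.SeesColour col w x) := by
  refine h.edge_induction ?_ ?_
  · intro i j hij hadj hno a b c hab hac hbc
    refine ⟨fun v => if v = i then a else b, by simp, by simp [hij.ne'], ?_, ?_, ?_, ?_⟩
    · rintro ⟨w, h1, h2⟩
      exact absurd h2 (hno w h1)
    · intro w _ h1 h2
      exact absurd h2 (hno w h1)
    · intro w _ h1 h2
      exact absurd h2 (hno w h1)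
    · intro w h1 h2
      exact absurd h2 (hno w h1)
  · intro i k j hik hkj haik hakj haij ih1 ih2 a b c hab hac hbc
    obtain ⟨d, had, hbd, hcd, hall⟩ := exists_fourth_colour a b c hab hac hbc
    obtain ⟨col1, h1i, h1k, h1apex, -, -, h1in⟩ := ih1 a c d hac had hcd
    obtain ⟨col2, h2k, h2j, h2apex, -, -, h2in⟩ := ih2 c b d hbc.symm hcd hbd
    set col : V → Fin 4 := fun v => if v ≤ k then col1 v else col2 v with hcol
    have e1 : ∀ v, v ≤ k → col v = col1 v := fun v hv => by simp [hcol, hv]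
    -- The two colourings agree at `k`, where both were asked to use `c`.
    have e2 : ∀ v, k ≤ v → col v = col2 v := by
      intro v hv
      rcases hv.eq_or_lt with rfl | hv
      · rw [e1 _ le_rfl, h1k, h2k]
      · simp [hcol, not_le.2 hv]
    have ci : col i = a := (e1 i hik.le).trans h1i
    have ck : col k = c := (e1 k le_rfl).trans h1k
    have cj : col j = b := (e2 j hkj.le).trans h2j
    have left : ∀ w, i < w → w < k → ∃ u, G.Adj i u ∧ G.Adj k u ∧ col u = d := by
      intro w hw1 hw2
      obtain ⟨u, hu1, hu2, hu3, hu4, hu5⟩ := h1apex ⟨w, hw1, hw2⟩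
      exact ⟨u, hu3, hu4.symm, (e1 u hu2.le).trans hu5⟩
    have right : ∀ w, k < w → w < j → ∃ u, G.Adj k u ∧ G.Adj j u ∧ col u = d := by
      intro w hw1 hw2
      obtain ⟨u, hu1, hu2, hu3, hu4, hu5⟩ := h2apex ⟨w, hw1, hw2⟩
      exact ⟨u, hu3, hu4.symm, (e2 u hu1.le).trans hu5⟩
    have si : G.SeesColour col i a ∧ G.SeesColour col i b ∧ G.SeesColour col i c :=
      ⟨⟨i, Or.inl rfl, ci⟩, ⟨j, Or.inr haij, cj⟩, ⟨k, Or.inr haik, ck⟩⟩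
    have sj : G.SeesColour col j a ∧ G.SeesColour col j b ∧ G.SeesColour col j c :=
      ⟨⟨i, Or.inr haij.symm, ci⟩, ⟨j, Or.inl rfl, cj⟩, ⟨k, Or.inr hakj.symm, ck⟩⟩
    have sk : G.SeesColour col k a ∧ G.SeesColour col k b ∧ G.SeesColour col k c :=
      ⟨⟨i, Or.inr haik.symm, ci⟩, ⟨j, Or.inr hakj, cj⟩, ⟨k, Or.inl rfl, ck⟩⟩
    have full : ∀ v u, G.SeesColour col v a ∧ G.SeesColour col v b ∧ G.SeesColour col v c →
        G.Adj v u → col u = d → ∀ x, G.SeesColour col v x := by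
      rintro v u ⟨ha, hb, hc⟩ hvu hu x
      rcases hall x with rfl | rfl | rfl | rfl
      exacts [ha, hb, hc, ⟨u, Or.inr hvu, hu⟩]
    refine ⟨col, ci, cj, fun _ => ⟨k, hik, hkj, haik, hakj, ck⟩, ?_, ?_, ?_⟩
    · intro w w' h1 h2 h3 h4 h5 h6 h7
      obtain ⟨v, hv, hv1, hv2, hv3⟩ : ∃ v, G.Adj i v ∧ i < v ∧ v < j ∧ v ≠ k := by
        by_cases hwk : w = k
        · exact ⟨w', h6, h3, h4, fun hk => h7 (hwk.trans hk.symm)⟩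
        · exact ⟨w, h5, h1, h2, hwk⟩
      -- Beyond `k` the edge from `i` would cross `k j`. So something lies between `i` and `k`, and
      -- the apex over `i k` supplies the colour `d`.
      have hvk : v < k := by
        refine lt_of_le_of_ne (not_lt.1 fun hkv => ?_) hv3
        exact absurd (h.noncrossing.mem_Icc hakj hkv hv2 hv.symm).1 (not_le.2 hik)
      obtain ⟨u, hu1, hu2, hu3⟩ := left v hv1 hvk
      exact full i u si hu1 hu3
    · intro w w' h1 h2 h3 h4 h5 h6 h7
      obtain ⟨v, hv, hv1, hv2, hv3⟩ : ∃ v, G.Adj j v ∧ i < v ∧ v < j ∧ v ≠ k := by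
        by_cases hwk : w = k
        · exact ⟨w', h6, h3, h4, fun hk => h7 (hwk.trans hk.symm)⟩
        · exact ⟨w, h5, h1, h2, hwk⟩
      have hvk : k < v := by
        refine lt_of_le_of_ne (not_lt.1 fun hkv => ?_) hv3.symm
        exact absurd (h.noncrossing.mem_Icc haik hv1 hkv hv.symm).2 (not_le.2 hkj)
      obtain ⟨u, hu1, hu2, hu3⟩ := right v hvk hv2
      exact full j u sj hu2 hu3
    · intro w hiw hwj
      rcases lt_trichotomy w k with hwk | rfl | hwk
      · have tr : ∀ x, G.SeesColour col1 w x → G.SeesColour col w x := by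
          rintro x ⟨u, hu, hux⟩
          refine ⟨u, hu, (e1 u ?_).trans hux⟩
          rcases hu with rfl | hu
          · exact hwk.le
          · exact (h.noncrossing.mem_Icc haik hiw hwk hu).2
        exact ⟨fun x y hxy => ((h1in w hiw hwk).1 x y hxy).imp (tr x) (tr y),
          fun hd x => tr x ((h1in w hiw hwk).2 hd x)⟩
      · constructor
        · intro x y hxy
          obtain ⟨ha, hb, hc⟩ := sk
          rcases hall x with rfl | rfl | rfl | rfl
          · exact Or.inl ha
          · exact Or.inl hb
          · exact Or.inl hc
          · rcases hall y with rfl | rfl | rfl | rfl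
            · exact Or.inr ha
            · exact Or.inr hb
            · exact Or.inr hc
            · exact absurd rfl hxy
        · intro hd
          obtain ⟨v, hv, hvi, hvj⟩ := exists_adj_of_three_le_degree i j hd
          obtain ⟨hv1, hv2⟩ := h.noncrossing.mem_Icc haij hiw hwj hv
          rcases lt_or_gt_of_ne hv.ne with hvw | hvw
          · obtain ⟨u, hu1, hu2, hu3⟩ := right v hvw (lt_of_le_of_ne hv2 hvj)
            exact full w u sk hu1 hu3
          · obtain ⟨u, hu1, hu2, hu3⟩ := left v (lt_of_le_of_ne hv1 hvi.symm) hvw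
            exact full w u sk hu2 hu3
      · have tr : ∀ x, G.SeesColour col2 w x → G.SeesColour col w x := by
          rintro x ⟨u, hu, hux⟩
          refine ⟨u, hu, (e2 u ?_).trans hux⟩
          rcases hu with rfl | hu
          · exact hwk.le
          · exact (h.noncrossing.mem_Icc hakj hwk hwj hu).1
        exact ⟨fun x y hxy => ((h2in w hwk hwj).1 x y hxy).imp (tr x) (tr y),
          fun hd x => tr x ((h2in w hwk hwj).2 hd x)⟩

theorem IsPolygonTriangulation.exists_colouring [Fintype V] [DecidableRel G.Adj]
    (h : G.IsPolygonTriangulation) (hV : 3 ≤ Fintype.card V) : ∃ col : V → Fin 4, ∀ w,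
      (∀ x y, x ≠ y → G.SeesColour col w x ∨ G.SeesColour col w y) ∧
        (3 ≤ G.degree w → ∀ x, G.SeesColour col w x) := by
  have : Nonempty V := Fintype.card_pos_iff.1 (by omega)
  obtain ⟨i, j, hij⟩ := exists_bot_top (V := V)
  obtain ⟨w₀, hw₀i, hw₀j⟩ : ∃ w₀, w₀ ≠ i ∧ w₀ ≠ j := by
    by_contra! hcon
    have hsub : (Finset.univ : Finset V) ⊆ {i, j} := by
      intro v _
      by_cases hv : v = i
      · simp [hv]
      · simp [hcon v hv]
    have := (Finset.card_le_card hsub).trans Finset.card_le_two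
    rw [Finset.card_univ] at this
    omega
  have hlt : i < j := (lt_of_le_of_ne (hij w₀).1 hw₀i.symm).trans_le (hij w₀).2
  have hadj := h.root hij hlt.ne
  obtain ⟨col, ci, cj, hapex, hi, hj, hin⟩ :=
    h.exists_colouring_edge i j hlt hadj 0 1 2 (by decide) (by decide) (by decide)
  obtain ⟨k, hik, hkj, haik, hakj, ck⟩ := hapex
    ⟨w₀, lt_of_le_of_ne (hij w₀).1 hw₀i.symm, lt_of_le_of_ne (hij w₀).2 hw₀j⟩
  have h3 : ∀ v, G.SeesColour col v 0 → G.SeesColour col v 1 → G.SeesColour col v 2 →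
      ∀ x y, x ≠ y → G.SeesColour col v x ∨ G.SeesColour col v y := by
    intro v h0 h1 h2 x y hxy
    fin_cases x <;> first | exact Or.inl h0 | exact Or.inl h1 | exact Or.inl h2 | skip
    fin_cases y <;> first | exact Or.inr h0 | exact Or.inr h1 | exact Or.inr h2 | skip
    exact absurd rfl hxy
  refine ⟨col, fun w => ?_⟩
  rcases (hij w).1.eq_or_lt with rfl | hiw
  · refine ⟨h3 _ ⟨i, Or.inl rfl, ci⟩ ⟨j, Or.inr hadj, cj⟩ ⟨k, Or.inr haik, ck⟩, fun hd => ?_⟩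
    obtain ⟨v, hv, hvk, hvj⟩ := exists_adj_of_three_le_degree k j hd
    exact hi v k (lt_of_le_of_ne (hij v).1 hv.ne) (lt_of_le_of_ne (hij v).2 hvj) hik hkj hv haik hvk
  rcases (hij w).2.eq_or_lt with rfl | hwj
  · refine ⟨h3 _ ⟨i, Or.inr hadj.symm, ci⟩ ⟨w, Or.inl rfl, cj⟩ ⟨k, Or.inr hakj.symm, ck⟩,
      fun hd => ?_⟩
    obtain ⟨v, hv, hvk, hvi⟩ := exists_adj_of_three_le_degree k i hd
    exact hj v k (lt_of_le_of_ne (hij v).1 hvi.symm) (lt_of_le_of_ne (hij v).2 hv.ne') hik hkj hv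
      hakj.symm hvk
  · exact hin w hiw hwj

-- Each colour class becomes dominating after adding the vertices that miss the colour. Only
-- vertices of degree at most 2 are ever added, each for at most one colour, so the four dominating
-- sets have total size at most `n + #{deg ≤ 2}`.
open Finset in
theorem IsPolygonTriangulation.four_mul_dominationNumber_le [Fintype V] [DecidableRel G.Adj]
    (h : G.IsPolygonTriangulation) (hV : 3 ≤ Fintype.card V) :
    4 * G.dominationNumber ≤ Fintype.card V + (univ.filter fun v => G.degree v ≤ 2).card := by
  classical
  obtain ⟨col, hcol⟩ := h.exists_colouring hV
  let D : Fin 4 → Finset V := fun x =>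
    univ.filter (fun v => col v = x) ∪
      (univ.filter fun v => G.degree v ≤ 2).filter fun v => ¬ G.SeesColour col v x
  have hD : ∀ x, G.dominationNumber ≤ (D x).card := by
    intro x
    refine dominationNumber_le_card fun v hv => ?_
    simp only [D, mem_union, mem_filter, mem_univ, true_and, not_or, not_and, not_not] at hv
    have hs : G.SeesColour col v x := by
      by_cases hd : G.degree v ≤ 2
      · exact hv.2 hd
      · exact (hcol v).2 (by omega) x
    obtain ⟨u, rfl | hu, hux⟩ := hs
    · exact absurd hux hv.1
    · exact ⟨u, by simp [D, hux], hu⟩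
  have h1 : ∑ x, (univ.filter (fun v => col v = x)).card = Fintype.card V := by
    rw [← card_eq_sum_card_fiberwise (fun v _ => mem_coe.2 (mem_univ (col v)))]
    rfl
  have h2 : ∑ x, ((univ.filter fun v => G.degree v ≤ 2).filter
      fun v => ¬ G.SeesColour col v x).card ≤ (univ.filter fun v => G.degree v ≤ 2).card := by
    simp_rw [card_filter _ (univ.filter fun v => G.degree v ≤ 2)]
    rw [sum_comm, card_eq_sum_ones]
    refine sum_le_sum fun v _ => ?_
    rw [← card_filter]
    refine card_le_one.2 fun x hx y hy => ?_
    simp only [mem_filter, mem_univ, true_and] at hx hy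
    by_contra hxy
    exact ((hcol v).1 x y hxy).elim hx hy
  have h3 : ∑ x : Fin 4, G.dominationNumber ≤ ∑ x, (D x).card := sum_le_sum fun x _ => hD x
  have h4 : ∑ x, (D x).card ≤ _ := sum_le_sum fun x _ => card_union_le _ _
  rw [sum_add_distrib, h1] at h4
  simp only [sum_const, card_univ, Fintype.card_fin, smul_eq_mul] at h3
  omega

end Colouring

end SimpleGraph

/-! ### At most nine vertices of degree other than 3 per packing vertex. -/

namespace SimpleGraph

/-! A finite set of *profiles* describes what a triangulated polygon can look like from one of its
sides `i j`.  A boundary state is a pair of numbers: `0` and `1` bound the number of selected inner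
neighbours of an end, and `2` says that the end itself is selected. -/

/-- The capped degrees of the two ends of a side, and for each boundary state (if available) a bound
for the number of inner vertices of degree different from `3`, minus nine times the number of inner
vertices in a suitable packing. -/
structure Profile where
  left : ℕ
  right : ℕ
  bounds : List (Option ℤ)

namespace Profile

/-- The bound of a profile for a boundary state. -/
def bound (f : Profile) (σ τ : Fin 3) : Option ℤ :=
  -- A selected end is a neighbour of the other end and exhausts the latter's capacity. Hence the
  -- state 2 is combined only with 0, at positions 4 and 5; the first four positions hold the pairs
  -- of states 0 and 1.
  if σ = 2 then (if τ = 0 then f.bounds.getD 4 none else none)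
  else if τ = 2 then (if σ = 0 then f.bounds.getD 5 none else none)
  else f.bounds.getD (2 * σ.val + τ.val) none

/-- The profiles that suffice. -/
def table : List Profile :=
  -- The first profile is that of a side with nothing behind it: empty packing, no inner vertices.
  [⟨1, 1, [some 0, some 0, some 0, some 0, some 0, some 0]⟩,
   ⟨2, 2, [some 1, some 1, some 1, some (-8), some 1, some 1]⟩,
   ⟨2, 3, [some (-4), some (-4), some (-4), some (-4), none, none]⟩,
   ⟨2, 3, [some (-3), some (-3), some (-3), some (-3), some (-3), none]⟩,
   ⟨2, 3, [some (-2), some (-2), some (-2), some (-2), some (-2), some (-2)]⟩,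
   ⟨2, 3, [some (-1), some (-1), some (-1), some (-10), some (-1), some (-1)]⟩,
   ⟨2, 3, [some 1, some (-8), some 1, some (-8), some 1, some 1]⟩,
   ⟨3, 2, [some (-4), some (-4), some (-4), some (-4), none, none]⟩,
   ⟨3, 2, [some (-3), some (-3), some (-3), some (-3), none, some (-3)]⟩,
   ⟨3, 2, [some (-2), some (-2), some (-2), some (-2), some (-2), some (-2)]⟩,
   ⟨3, 2, [some (-1), some (-1), some (-1), some (-10), some (-1), some (-1)]⟩,
   ⟨3, 2, [some 1, some 1, some (-8), some (-8), some 1, some 1]⟩,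
   ⟨3, 3, [some (-4), some (-4), some (-4), some (-4), none, none]⟩,
   ⟨3, 3, [some (-3), some (-3), some (-3), some (-12), some (-3), some (-3)]⟩,
   ⟨3, 3, [some (-2), some (-11), some (-11), some (-11), none, none]⟩,
   ⟨3, 3, [some (-1), some (-10), some (-1), some (-10), none, some (-1)]⟩,
   ⟨3, 3, [some (-1), some (-1), some (-10), some (-10), some (-1), none]⟩,
   ⟨3, 3, [some 0, some (-9), some 0, some (-9), some 0, some 0]⟩,
   ⟨3, 3, [some 0, some 0, some (-9), some (-9), some 0, some 0]⟩,
   ⟨3, 3, [some 3, some (-6), some (-6), some (-6), some 3, some 3]⟩]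

/-- The number of inner neighbours that may be selected. -/
def cap (σ : Fin 3) : ℕ := if σ = 1 then 1 else 0

/-- Whether the end itself is selected, as a number. -/
def sel (σ : Fin 3) : ℕ := if σ = 2 then 1 else 0

/-- `a + b + w ≤ m`, for bounds `a` and `b` that are available. -/
def AddLe (a b : Option ℤ) (w m : ℤ) : Prop := ∃ x ∈ a, ∃ y ∈ b, x + y + w ≤ m

instance (a b : Option ℤ) (w m : ℤ) : Decidable (AddLe a b w m) :=
  match a, b with
  | none, _ => isFalse fun h => by simp [AddLe] at h
  | some _, none => isFalse fun h => by simp [AddLe] at h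
  | some x, some y => decidable_of_iff (x + y + w ≤ m) (by simp [AddLe])

/-- The weight of the common end of two glued polygons. -/
def weight (f g : Profile) : ℤ := if f.right + g.left = 3 then 0 else 1

/-- The bound `m` for the state `σ τ` results from gluing polygons with the profiles `f`, `g`. -/
def Yields (f g : Profile) (σ τ : Fin 3) (m : ℤ) : Prop :=
  -- The common end stays out of the choice. Its closed neighbourhood meets at most `cap x + cap y`
  -- chosen inner vertices and the selected ends among `i` and `j`, which are both adjacent to it.
  (∃ x y : Fin 3, cap x + cap y + sel σ + sel τ ≤ 1 ∧
    AddLe (f.bound σ x) (g.bound y τ) (weight f g) m) ∨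
  -- The common end is selected. As a neighbour of `i` and of `j` it uses up the capacity 1 of both,
  -- so the halves must have state 0 there, and it contributes a credit of 9.
  (σ = 1 ∧ τ = 1 ∧ AddLe (f.bound 0 2) (g.bound 2 0) (weight f g - 9) m)

instance (f g : Profile) (σ τ : Fin 3) (m : ℤ) : Decidable (Yields f g σ τ m) := by
  unfold Yields; infer_instance

-- The heart of the constant 9: a finite check over all pairs of profiles that the table is closed
-- under gluing two polygons along a triangle.
set_option maxRecDepth 100000 in
set_option maxHeartbeats 4000000 in
theorem table_closed : ∀ f ∈ table, ∀ g ∈ table, ∃ h ∈ table, h.left = min 3 (f.left + 1) ∧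
    h.right = min 3 (g.right + 1) ∧ ∀ σ τ : Fin 3, ∀ m ∈ h.bound σ τ, Yields f g σ τ m := by
  decide +kernel

/-- The surplus of 2 pays for the two ends of the outermost edge, which are not inner vertices. A
first entry other than 1 excludes the side with nothing behind it. -/
theorem bound_table : ∀ f ∈ table, f.left ≠ 1 → ∃ m ∈ f.bound 1 1, m ≤ -2 := by
  decide

end Profile

end SimpleGraph

namespace SimpleGraph

section Packing

set_option linter.unusedSectionVars false

open Finset Profile

variable {V : Type*} [LinearOrder V] {G : SimpleGraph V}

/-- The number of elements of `X` in the closed neighbourhood of `w`. -/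
noncomputable def load (G : SimpleGraph V) (X : Finset V) (w : V) : ℕ :=
  ((X : Set V) ∩ G.closedNeighborSet w).ncard

theorem load_le_of_forall {X Y : Finset V} {w : V}
    (h : ∀ v ∈ X, v ∈ G.closedNeighborSet w → v ∈ Y) : G.load X w ≤ G.load Y w :=
  Set.ncard_le_ncard (fun v hv => ⟨h v hv.1 hv.2, hv.2⟩) (Y.finite_toSet.inter_of_left _)

theorem load_union_le (X Y : Finset V) (w : V) : G.load (X ∪ Y) w ≤ G.load X w + G.load Y w := by
  unfold load
  rw [coe_union, Set.union_inter_distrib_right]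
  exact Set.ncard_union_le _ _

theorem load_le_card (X : Finset V) (w : V) : G.load X w ≤ X.card := by
  rw [← Set.ncard_coe_finset]
  exact Set.ncard_le_ncard Set.inter_subset_left X.finite_toSet

/-- A vertex in two closed neighbourhoods has both centres in its own closed neighbourhood. -/
theorem isPacking_of_load_le_one {X : Finset V} (h : ∀ w, G.load X w ≤ 1) : G.IsPacking X := by
  intro u hu v hv huv
  rw [Set.disjoint_left]
  intro w hwu hwv
  have key : ∀ x, w ∈ G.closedNeighborSet x → x ∈ G.closedNeighborSet w := by
    rintro x (rfl | hx)
    · exact Or.inl rfl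
    · exact Or.inr hx.symm
  exact huv ((Set.ncard_le_one (X.finite_toSet.inter_of_left _)).1 (h w) u ⟨hu, key u hwu⟩ v
    ⟨hv, key v hwv⟩)

/-- The selected ends of the side `i j`. -/
def selectedEnds (i j : V) (σ τ : Fin 3) : Finset V :=
  (if σ = 2 then {i} else ∅) ∪ (if τ = 2 then {j} else ∅)

theorem card_selectedEnds_le (i j : V) (σ τ : Fin 3) :
    (selectedEnds i j σ τ).card ≤ sel σ + sel τ := by
  refine (card_union_le _ _).trans (add_le_add ?_ ?_) <;> unfold sel <;> split_ifs <;> simp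

variable [Fintype V] [DecidableRel G.Adj]

variable (G) in
/-- The number of vertices of degree different from `3` strictly between `i` and `j`. -/
def innerWeight (i j : V) : ℕ := (univ.filter fun v => (i < v ∧ v < j) ∧ G.degree v ≠ 3).card

variable (G) in
/-- Some choice of inner vertices is compatible with the boundary state `σ τ` and witnesses the
bound `m`. -/
def Realizes (i j : V) (σ τ : Fin 3) (m : ℤ) : Prop :=
  ∃ P : Finset V, (∀ v ∈ P, i < v ∧ v < j) ∧
    (∀ w, i < w → w < j → G.load (P ∪ selectedEnds i j σ τ) w ≤ 1) ∧
    G.load P i ≤ cap σ ∧ G.load P j ≤ cap τ ∧ (G.innerWeight i j : ℤ) ≤ m + 9 * P.card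

theorem Realizes.mono {i j : V} {σ τ : Fin 3} {m m' : ℤ} (h : G.Realizes i j σ τ m) (hm : m ≤ m') :
    G.Realizes i j σ τ m' := by
  obtain ⟨P, h1, h2, h3, h4, h5⟩ := h
  exact ⟨P, h1, h2, h3, h4, by linarith⟩

theorem innerWeight_add {i k j : V} (hik : i < k) (hkj : k < j) :
    G.innerWeight i j = G.innerWeight i k + (if G.degree k = 3 then 0 else 1) +
      G.innerWeight k j := by
  have e : (univ.filter fun v => (i < v ∧ v < j) ∧ G.degree v ≠ 3) =
      ((univ.filter fun v => (i < v ∧ v < k) ∧ G.degree v ≠ 3) ∪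
        (if G.degree k = 3 then ∅ else {k})) ∪
      (univ.filter fun v => (k < v ∧ v < j) ∧ G.degree v ≠ 3) := by
    ext v
    simp only [mem_union, mem_filter, mem_univ, true_and]
    rcases lt_trichotomy v k with hv | rfl | hv
    · split_ifs <;> simp [hv, hv.trans hkj, hv.ne, hv.not_gt]
    · split_ifs with h3 <;> simp [h3, hik, hkj]
    · split_ifs <;> simp [hv, hik.trans hv, hv.ne', hv.not_gt]
  unfold innerWeight
  rw [e, card_union_of_disjoint, card_union_of_disjoint]
  · split_ifs <;> simp
  · rw [Finset.disjoint_left]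
    intro v hv hv'
    split_ifs at hv' with h3
    · simp at hv'
    · rw [mem_singleton] at hv'
      simp [hv'] at hv
  · rw [Finset.disjoint_left]
    intro v hv hv'
    have h1 := (mem_filter.1 hv').2.1.1
    rcases mem_union.1 hv with hv | hv
    · exact absurd h1 (mem_filter.1 hv).2.1.2.not_gt
    · split_ifs at hv with h3
      · simp at hv
      · rw [mem_singleton] at hv
        exact absurd h1 (by simp [hv])

theorem not_mem_closedNeighborSet_left (hG : G.IsNoncrossing) {i k j v : V}
    (hkj : G.Adj k j) (hik : i < k) (h1 : k < v) (h2 : v < j) : v ∉ G.closedNeighborSet i := by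
  rintro (rfl | hv)
  · exact absurd h1 hik.not_gt
  · exact absurd (hG.mem_Icc hkj h1 h2 hv.symm).1 (not_le.2 hik)

theorem not_mem_closedNeighborSet_right (hG : G.IsNoncrossing) {i k j v : V}
    (hik : G.Adj i k) (hkj : k < j) (h1 : i < v) (h2 : v < k) : v ∉ G.closedNeighborSet j := by
  rintro (rfl | hv)
  · exact absurd h2 hkj.not_gt
  · exact absurd (hG.mem_Icc hik h1 h2 hv.symm).2 (not_le.2 hkj)

theorem mem_Icc_of_mem_closedNeighborSet (hG : G.IsNoncrossing) {i j w v : V}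
    (hij : G.Adj i j) (h1 : i < w) (h2 : w < j) (hv : v ∈ G.closedNeighborSet w) :
    i ≤ v ∧ v ≤ j := by
  rcases hv with rfl | hv
  · exact ⟨h1.le, h2.le⟩
  · exact hG.mem_Icc hij h1 h2 hv

theorem mem_selectedEnds {i j v : V} {σ τ : Fin 3} :
    v ∈ selectedEnds i j σ τ ↔ (σ = 2 ∧ v = i) ∨ (τ = 2 ∧ v = j) := by
  unfold selectedEnds
  split_ifs <;> simp_all

/-- The two choices are united and the common end is left unselected. A vertex strictly between the
ends of one half sees only that half, so just the load at `k` is new; it is controlled by `hxy`. -/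
theorem Realizes.glue (hG : G.IsNoncrossing) {i k j : V} (hik : i < k) (hkj : k < j)
    (haik : G.Adj i k) (hakj : G.Adj k j) {σ τ x y : Fin 3} {m₁ m₂ : ℤ}
    (h₁ : G.Realizes i k σ x m₁) (h₂ : G.Realizes k j y τ m₂)
    (hxy : cap x + cap y + sel σ + sel τ ≤ 1) :
    G.Realizes i j σ τ (m₁ + m₂ + (if G.degree k = 3 then 0 else 1)) := by
  obtain ⟨P₁, hP₁, hw₁, hi₁, hk₁, hm₁⟩ := h₁
  obtain ⟨P₂, hP₂, hw₂, hk₂, hj₂, hm₂⟩ := h₂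
  have hdisj : Disjoint P₁ P₂ := by
    rw [Finset.disjoint_left]
    exact fun v h1 h2 => absurd (hP₁ v h1).2 (hP₂ v h2).1.not_gt
  refine ⟨P₁ ∪ P₂, ?_, ?_, ?_, ?_, ?_⟩
  · intro v hv
    rcases mem_union.1 hv with hv | hv
    · exact ⟨(hP₁ v hv).1, (hP₁ v hv).2.trans hkj⟩
    · exact ⟨hik.trans (hP₂ v hv).1, (hP₂ v hv).2⟩
  · intro w hiw hwj
    rcases lt_trichotomy w k with hwk | rfl | hwk
    · refine (load_le_of_forall fun v hv hvw => ?_).trans (hw₁ w hiw hwk)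
      have hvk := (mem_Icc_of_mem_closedNeighborSet hG haik hiw hwk hvw).2
      simp only [mem_union, mem_selectedEnds] at hv ⊢
      rcases hv with (hv | hv) | hv | ⟨-, rfl⟩
      · exact Or.inl hv
      · exact absurd (hP₂ v hv).1 (not_lt.2 hvk)
      · exact Or.inr (Or.inl hv)
      · exact absurd hkj (not_lt.2 hvk)
    · have h1 := load_union_le (G := G) (P₁ ∪ P₂) (selectedEnds i j σ τ) w
      have h2 := load_union_le (G := G) P₁ P₂ w
      have h3 := (load_le_card (G := G) (selectedEnds i j σ τ) w).trans
        (card_selectedEnds_le i j σ τ)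
      omega
    · refine (load_le_of_forall fun v hv hvw => ?_).trans (hw₂ w hwk hwj)
      have hvk := (mem_Icc_of_mem_closedNeighborSet hG hakj hwk hwj hvw).1
      simp only [mem_union, mem_selectedEnds] at hv ⊢
      rcases hv with (hv | hv) | ⟨-, rfl⟩ | hv
      · exact absurd (hP₁ v hv).2 (not_lt.2 hvk)
      · exact Or.inl hv
      · exact absurd hik (not_lt.2 hvk)
      · exact Or.inr (Or.inr hv)
  · refine (load_le_of_forall fun v hv hvi => ?_).trans hi₁
    rcases mem_union.1 hv with hv | hv
    · exact hv
    · exact absurd hvi (not_mem_closedNeighborSet_left hG hakj hik (hP₂ v hv).1 (hP₂ v hv).2)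
  · refine (load_le_of_forall fun v hv hvj => ?_).trans hj₂
    rcases mem_union.1 hv with hv | hv
    · exact absurd hvj (not_mem_closedNeighborSet_right hG haik hkj (hP₁ v hv).1 (hP₁ v hv).2)
    · exact hv
  · rw [innerWeight_add hik hkj, card_union_of_disjoint hdisj]
    push_cast
    linarith

/-- The common end itself is added to the union. Inside each half it is already accounted for by the
state 2 at that end. -/
theorem Realizes.glue_selected (hG : G.IsNoncrossing) {i k j : V} (hik : i < k) (hkj : k < j)
    (haik : G.Adj i k) (hakj : G.Adj k j) {m₁ m₂ : ℤ}
    (h₁ : G.Realizes i k 0 2 m₁) (h₂ : G.Realizes k j 2 0 m₂) :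
    G.Realizes i j 1 1 (m₁ + m₂ + (if G.degree k = 3 then 0 else 1) - 9) := by
  obtain ⟨P₁, hP₁, hw₁, hi₁, hk₁, hm₁⟩ := h₁
  obtain ⟨P₂, hP₂, hw₂, hk₂, hj₂, hm₂⟩ := h₂
  have hsing : ∀ w, G.load {k} w ≤ 1 := fun w => load_le_card _ _
  have hkP₁ : k ∉ P₁ := fun h => lt_irrefl k (hP₁ k h).2
  have hdisj : Disjoint (P₁ ∪ {k}) P₂ := by
    rw [Finset.disjoint_left]
    intro v h1 h2
    rcases mem_union.1 h1 with h1 | h1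
    · exact absurd (hP₁ v h1).2 (hP₂ v h2).1.not_gt
    · exact absurd (hP₂ v h2).1 (by simp [mem_singleton.1 h1])
  simp only [cap] at hi₁ hk₁ hk₂ hj₂
  -- No vertex strictly between `k` and `j` is near `i`, and state 0 leaves none from the first
  -- half, so only `k` counts.
  have hi : G.load (P₁ ∪ {k} ∪ P₂) i ≤ 1 := by
    refine (load_le_of_forall (Y := P₁ ∪ {k}) fun v hv hvi => ?_).trans
      ((load_union_le _ _ _).trans ?_)
    · rcases mem_union.1 hv with hv | hv
      · exact hv
      · exact absurd hvi (not_mem_closedNeighborSet_left hG hakj hik (hP₂ v hv).1 (hP₂ v hv).2)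
    · have := hsing i
      simp at hi₁
      omega
  have hj : G.load (P₁ ∪ {k} ∪ P₂) j ≤ 1 := by
    refine (load_le_of_forall (Y := {k} ∪ P₂) fun v hv hvj => ?_).trans
      ((load_union_le _ _ _).trans ?_)
    · simp only [mem_union] at hv ⊢
      rcases hv with (hv | hv) | hv
      · exact absurd hvj (not_mem_closedNeighborSet_right hG haik hkj (hP₁ v hv).1 (hP₁ v hv).2)
      · exact Or.inl hv
      · exact Or.inr hv
    · have := hsing j
      simp at hj₂
      omega
  refine ⟨P₁ ∪ {k} ∪ P₂, ?_, ?_, by simpa [cap] using hi, by simpa [cap] using hj, ?_⟩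
  · intro v hv
    simp only [mem_union, mem_singleton] at hv
    rcases hv with (hv | rfl) | hv
    · exact ⟨(hP₁ v hv).1, (hP₁ v hv).2.trans hkj⟩
    · exact ⟨hik, hkj⟩
    · exact ⟨hik.trans (hP₂ v hv).1, (hP₂ v hv).2⟩
  · intro w hiw hwj
    have e : selectedEnds i j 1 1 = ∅ := by ext v; simp [mem_selectedEnds]
    rw [e, union_empty]
    rcases lt_trichotomy w k with hwk | rfl | hwk
    · refine (load_le_of_forall fun v hv hvw => ?_).trans (hw₁ w hiw hwk)
      have hvk := (mem_Icc_of_mem_closedNeighborSet hG haik hiw hwk hvw).2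
      simp only [mem_union, mem_singleton, mem_selectedEnds] at hv ⊢
      rcases hv with (hv | rfl) | hv
      · exact Or.inl hv
      · exact Or.inr (Or.inr ⟨trivial, rfl⟩)
      · exact absurd (hP₂ v hv).1 (not_lt.2 hvk)
    · have h1 := load_union_le (G := G) (P₁ ∪ {w}) P₂ w
      have h2 := load_union_le (G := G) P₁ {w} w
      have := hsing w
      simp at hk₁ hk₂
      omega
    · refine (load_le_of_forall fun v hv hvw => ?_).trans (hw₂ w hwk hwj)
      have hvk := (mem_Icc_of_mem_closedNeighborSet hG hakj hwk hwj hvw).1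
      simp only [mem_union, mem_singleton, mem_selectedEnds] at hv ⊢
      rcases hv with (hv | rfl) | hv
      · exact absurd (hP₁ v hv).2 (not_lt.2 hvk)
      · exact Or.inr (Or.inl ⟨trivial, rfl⟩)
      · exact Or.inl hv
  · rw [innerWeight_add hik hkj, card_union_of_disjoint hdisj,
      card_union_of_disjoint (disjoint_singleton_right.2 hkP₁), card_singleton]
    push_cast
    linarith

variable (G) in
/-- The number of neighbours of `i` in the interval from `i` to `j`. -/
def degreeRight (i j : V) : ℕ := (univ.filter fun v => i < v ∧ v ≤ j ∧ G.Adj i v).card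

variable (G) in
/-- The number of neighbours of `j` in the interval from `i` to `j`. -/
def degreeLeft (i j : V) : ℕ := (univ.filter fun v => i ≤ v ∧ v < j ∧ G.Adj j v).card

/-- From `i` no edge enters the interior of `k j`, so passing from `k` to `j` adds only the
neighbour `j`. -/
theorem degreeRight_glue (hG : G.IsNoncrossing) {i k j : V} (hik : i < k) (hkj : k < j)
    (hakj : G.Adj k j) (haij : G.Adj i j) :
    G.degreeRight i j = G.degreeRight i k + 1 := by
  have e : (univ.filter fun v => i < v ∧ v ≤ j ∧ G.Adj i v) =
      insert j (univ.filter fun v => i < v ∧ v ≤ k ∧ G.Adj i v) := by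
    ext v
    simp only [mem_insert, mem_filter, mem_univ, true_and]
    constructor
    · rintro ⟨h1, h2, h3⟩
      rcases h2.eq_or_lt with rfl | h2
      · exact Or.inl rfl
      · refine Or.inr ⟨h1, not_lt.1 fun h => ?_, h3⟩
        exact not_mem_closedNeighborSet_left hG hakj hik h h2 (Or.inr h3)
    · rintro (rfl | ⟨h1, h2, h3⟩)
      · exact ⟨hik.trans hkj, le_rfl, haij⟩
      · exact ⟨h1, h2.trans hkj.le, h3⟩
  unfold degreeRight
  rw [e, card_insert_of_notMem]
  simp [hkj]

theorem degreeLeft_glue (hG : G.IsNoncrossing) {i k j : V} (hik : i < k) (hkj : k < j)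
    (haik : G.Adj i k) (haij : G.Adj i j) :
    G.degreeLeft i j = G.degreeLeft k j + 1 := by
  have e : (univ.filter fun v => i ≤ v ∧ v < j ∧ G.Adj j v) =
      insert i (univ.filter fun v => k ≤ v ∧ v < j ∧ G.Adj j v) := by
    ext v
    simp only [mem_insert, mem_filter, mem_univ, true_and]
    constructor
    · rintro ⟨h1, h2, h3⟩
      rcases h1.eq_or_lt with rfl | h1
      · exact Or.inl rfl
      · refine Or.inr ⟨not_lt.1 fun h => ?_, h2, h3⟩
        exact not_mem_closedNeighborSet_right hG haik hkj h1 h (Or.inr h3)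
    · rintro (rfl | ⟨h1, h2, h3⟩)
      · exact ⟨le_rfl, hik.trans hkj, haij.symm⟩
      · exact ⟨hik.le.trans h1, h2, h3⟩
  unfold degreeLeft
  rw [e, card_insert_of_notMem]
  simp [hik]

/-- The edge `i j` shields `k`: its full degree in `G` is visible inside the interval. Thus the
weight of `k` is determined by the two profiles being glued. -/
theorem degree_eq_degreeLeft_add (hG : G.IsNoncrossing) {i k j : V} (hik : i < k) (hkj : k < j)
    (haij : G.Adj i j) : G.degree k = G.degreeLeft i k + G.degreeRight k j := by
  unfold degreeLeft degreeRight
  rw [← card_neighborFinset_eq_degree, ← card_union_of_disjoint]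
  · congr 1
    ext v
    simp only [mem_neighborFinset, mem_union, mem_filter, mem_univ, true_and]
    constructor
    · intro hv
      have := hG.mem_Icc haij hik hkj hv
      rcases lt_or_gt_of_ne hv.ne with h | h
      · exact Or.inr ⟨h, this.2, hv⟩
      · exact Or.inl ⟨this.1, h, hv⟩
    · rintro (h | h) <;> exact h.2.2
  · rw [Finset.disjoint_left]
    intro v h1 h2
    simp only [mem_filter, mem_univ, true_and] at h1 h2
    exact absurd h1.2.1 h2.1.not_gt

theorem one_le_degreeRight {i j : V} (hij : i < j) (h : G.Adj i j) : 1 ≤ G.degreeRight i j :=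
  card_pos.2 ⟨j, by simp [hij, h]⟩

theorem one_le_degreeLeft {i j : V} (hij : i < j) (h : G.Adj i j) : 1 ≤ G.degreeLeft i j :=
  card_pos.2 ⟨i, by simp [hij, h.symm]⟩

theorem IsPolygonTriangulation.exists_profile (h : G.IsPolygonTriangulation) :
    ∀ i j, i < j → G.Adj i j → ∃ f ∈ table, f.left = min 3 (G.degreeRight i j) ∧
      f.right = min 3 (G.degreeLeft i j) ∧ ∀ σ τ, ∀ m ∈ f.bound σ τ, G.Realizes i j σ τ m := by
  refine h.edge_induction ?_ ?_
  · intro i j hij hadj hno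
    refine ⟨_, List.mem_cons_self, ?_, ?_, ?_⟩
    · have : G.degreeRight i j = 1 := by
        refine card_eq_one.2 ⟨j, ?_⟩
        ext v
        simp only [mem_filter, mem_univ, true_and, mem_singleton]
        constructor
        · rintro ⟨h1, h2, -⟩
          exact h2.eq_or_lt.resolve_right (hno v h1)
        · rintro rfl
          exact ⟨hij, le_rfl, hadj⟩
      rw [this]; rfl
    · have : G.degreeLeft i j = 1 := by
        refine card_eq_one.2 ⟨i, ?_⟩
        ext v
        simp only [mem_filter, mem_univ, true_and, mem_singleton]
        constructor
        · rintro ⟨h1, h2, -⟩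
          exact (h1.eq_or_lt.resolve_right fun h3 => hno v h3 h2).symm
        · rintro rfl
          exact ⟨le_rfl, hij, hadj.symm⟩
      rw [this]; rfl
    · intro σ τ m hm
      have hm0 : m = 0 := by
        revert σ τ m
        intro σ τ m
        fin_cases σ <;> fin_cases τ <;> simp [bound] <;> omega
      have hW : G.innerWeight i j = 0 := by
        refine card_eq_zero.2 (filter_eq_empty_iff.2 ?_)
        rintro v - ⟨⟨h1, h2⟩, -⟩
        exact hno v h1 h2
      refine ⟨∅, by simp, fun w h1 h2 => absurd h2 (hno w h1), ?_, ?_, ?_⟩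
      · simp [load]
      · simp [load]
      · simp [hm0, hW]
  · rintro i k j hik hkj haik hakj haij ⟨f, hf, hfl, hfr, hfb⟩ ⟨g, hg, hgl, hgr, hgb⟩
    obtain ⟨p, hp, hpl, hpr, hpb⟩ := table_closed f hf g hg
    -- Capping at 3 is harmless: both summands are at least 1, so a sum of 3 involves only the
    -- uncapped values 1 and 2.
    have hwt : weight f g = if G.degree k = 3 then 0 else 1 := by
      have h1 := one_le_degreeLeft hik haik
      have h2 := one_le_degreeRight hkj hakj
      have h3 := degree_eq_degreeLeft_add h.noncrossing hik hkj haij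
      unfold weight
      congr 1
      rw [hfr, hgl, h3, eq_iff_iff]
      omega
    refine ⟨p, hp, ?_, ?_, ?_⟩
    · rw [hpl, hfl, degreeRight_glue h.noncrossing hik hkj hakj haij]
      omega
    · rw [hpr, hgr, degreeLeft_glue h.noncrossing hik hkj haik haij]
      omega
    · intro σ τ m hm
      rcases hpb σ τ m hm with ⟨x, y, hxy, a, ha, b, hb, hle⟩ | ⟨rfl, rfl, a, ha, b, hb, hle⟩
      · refine ((hfb σ x a ha).glue h.noncrossing hik hkj haik hakj (hgb y τ b hb) hxy).mono ?_
        rwa [← hwt]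
      · refine ((hfb 0 2 a ha).glue_selected h.noncrossing hik hkj haik hakj
          (hgb 2 0 b hb)).mono ?_
        rw [← hwt]
        linarith

theorem IsPolygonTriangulation.card_degree_ne_three_le (h : G.IsPolygonTriangulation)
    (hV : 3 ≤ Fintype.card V) :
    (univ.filter fun v => G.degree v ≠ 3).card ≤ 9 * G.packingNumber := by
  have : Nonempty V := Fintype.card_pos_iff.1 (by omega)
  obtain ⟨i, j, hij⟩ := exists_bot_top (V := V)
  obtain ⟨w₀, hw₀i, hw₀j⟩ : ∃ w₀, w₀ ≠ i ∧ w₀ ≠ j := by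
    by_contra! hcon
    have hsub : (univ : Finset V) ⊆ {i, j} := by
      intro v _
      by_cases hv : v = i
      · simp [hv]
      · simp [hcon v hv]
    have := (card_le_card hsub).trans card_le_two
    rw [card_univ] at this
    omega
  have hiw := lt_of_le_of_ne (hij w₀).1 hw₀i.symm
  have hwj := lt_of_le_of_ne (hij w₀).2 hw₀j
  have hlt : i < j := hiw.trans hwj
  have hadj := h.root hij hlt.ne
  obtain ⟨k, hik, hkj, haik, hakj⟩ := h.apex hadj hlt ⟨w₀, hiw, hwj⟩
  obtain ⟨f, hf, hfl, -, hfb⟩ := h.exists_profile i j hlt hadj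
  have h2 : 2 ≤ G.degreeRight i j := by
    rw [degreeRight_glue h.noncrossing hik hkj hakj hadj]
    have := one_le_degreeRight hik haik
    omega
  -- State 1 at both outermost ends allows load 1 there, which is exactly the packing condition.
  obtain ⟨m, hm, hm2⟩ := bound_table f hf (by omega)
  obtain ⟨P, hP, hw, hi, hj, hle⟩ := hfb 1 1 m hm
  have e : selectedEnds i j 1 1 = ∅ := by ext v; simp [mem_selectedEnds]
  rw [e, union_empty] at hw
  have hpack : G.IsPacking P := by
    refine isPacking_of_load_le_one fun w => ?_
    rcases (hij w).1.eq_or_lt with rfl | h1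
    · exact hi
    rcases (hij w).2.eq_or_lt with rfl | h3
    · exact hj
    exact hw w h1 h3
  have h4 := card_le_packingNumber hpack
  have h5 : (univ.filter fun v => G.degree v ≠ 3).card ≤ G.innerWeight i j + 2 := by
    refine (card_le_card (t := (univ.filter fun v => (i < v ∧ v < j) ∧ G.degree v ≠ 3) ∪ {i, j})
      fun v hv => ?_).trans ((card_union_le _ _).trans (add_le_add le_rfl card_le_two))
    simp only [mem_union, mem_filter, mem_univ, true_and, mem_insert, mem_singleton] at hv ⊢
    rcases (hij v).1.eq_or_lt with h1 | h1
    · exact Or.inr (Or.inl h1.symm)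
    rcases (hij v).2.eq_or_lt with h3 | h3
    · exact Or.inr (Or.inr h3)
    exact Or.inl ⟨⟨h1, h3⟩, hv⟩
  omega

end Packing

/-! ### Combination of the colouring and packing estimates. -/

section Bounds

variable {V : Type*} [LinearOrder V] [Fintype V] {G : SimpleGraph V} [DecidableRel G.Adj]

open Finset in
theorem IsPolygonTriangulation.four_mul_dominationNumber_le_packingNumber
    (h : G.IsPolygonTriangulation) (hV : 3 ≤ Fintype.card V) :
    4 * G.dominationNumber ≤ 9 * G.packingNumber + (univ.filter fun v => G.degree v ≤ 3).card := by
  have h1 := h.four_mul_dominationNumber_le hV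
  have h2 := h.card_degree_ne_three_le hV
  -- Compared vertex by vertex: degree at most 2 gives `2 = 1 + 1`, degree 3 gives `1 = 0 + 1`,
  -- larger degree gives `1 = 1 + 0`.
  have h3 : Fintype.card V + (univ.filter fun v => G.degree v ≤ 2).card =
      (univ.filter fun v => G.degree v ≠ 3).card + (univ.filter fun v => G.degree v ≤ 3).card := by
    rw [← card_univ, card_eq_sum_ones, card_filter, card_filter, card_filter, ← sum_add_distrib,
      ← sum_add_distrib]
    refine sum_congr rfl fun v _ => ?_
    split_ifs <;> omega
  omega

end Bounds

end SimpleGraph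

/-! ### Drawings on a parabola, and what maximality forces. -/

namespace SimpleGraph

section Parabola

/-- The point of the standard parabola with the given abscissa. -/
noncomputable def parabolaPoint (x : ℝ) : EuclideanSpace ℝ (Fin 2) := !₂[x, x ^ 2]

theorem parabolaPoint_injective : Function.Injective parabolaPoint := by
  intro x y h
  simpa [parabolaPoint] using congrArg (fun z : EuclideanSpace ℝ (Fin 2) => z 0) h

theorem eq_parabolaPoint {z : EuclideanSpace ℝ (Fin 2)} (h : z 1 = z 0 ^ 2) :
    z = parabolaPoint (z 0) := by
  ext i
  fin_cases i
  · simp [parabolaPoint]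
  · simpa [parabolaPoint] using h

/-- The height of a chord above the parabola is `(x - a) * (b - x)`, so intersections of chords
become a one-variable problem. -/
theorem mem_segment_parabolaPoint {a b : ℝ} (hab : a ≤ b) {z : EuclideanSpace ℝ (Fin 2)}
    (hz : z ∈ segment ℝ (parabolaPoint a) (parabolaPoint b)) :
    a ≤ z 0 ∧ z 0 ≤ b ∧ z 1 - z 0 ^ 2 = (z 0 - a) * (b - z 0) := by
  obtain ⟨s, t, hs, ht, hst, rfl⟩ := hz
  obtain rfl : s = 1 - t := by linarith
  simp only [parabolaPoint, PiLp.add_apply, PiLp.smul_apply, Fin.isValue, Matrix.cons_val_zero, Matrix.cons_val_one, smul_eq_mul, Matrix.cons_val_fin_one]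
  refine ⟨by nlinarith, by nlinarith, by ring⟩

/-- Intervals that do not interleave are nested or meet at most in an end. For nested ones the
difference of the heights is `(c - a) * (b - t) + (t - c) * (b - d)`, a sum of nonnegative terms, so
equality forces an end. -/
theorem eq_end_of_mem_chords {a b c d t : ℝ} (hat : a ≤ t) (htb : t ≤ b)
    (hct : c ≤ t) (htd : t ≤ d) (h : (t - a) * (b - t) = (t - c) * (d - t))
    (h1 : ¬ (a < c ∧ c < b ∧ b < d)) (h2 : ¬ (c < a ∧ a < d ∧ d < b)) (h3 : ¬ (a = c ∧ b = d)) :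
    (t = a ∨ t = b) ∧ (t = c ∨ t = d) := by
  have key : (t - a) * (b - t) = 0 := by
    rcases le_or_gt b c with hbc | hbc
    · have : t = b := le_antisymm htb (hbc.trans hct)
      simp [this]
    rcases le_or_gt d a with hda | hda
    · have : t = a := le_antisymm (htd.trans hda) hat
      simp [this]
    have nested : ∀ a b c d : ℝ, a ≤ c → d ≤ b → a ≤ t → t ≤ b → c ≤ t → t ≤ d →
        (t - a) * (b - t) = (t - c) * (d - t) → ¬ (a = c ∧ b = d) → (t - c) * (d - t) = 0 := by
      intro a b c d hac hdb hat htb hct htd h hne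
      rcases hac.eq_or_lt with rfl | hac
      · have hdb' : d < b := lt_of_le_of_ne hdb fun hdb' => hne ⟨rfl, hdb'.symm⟩
        have : (t - a) * (b - d) = 0 := by linarith
        rcases mul_eq_zero.1 this with h' | h'
        · simp [h']
        · linarith
      · have h5 : 0 ≤ (t - c) * (b - d) := mul_nonneg (by linarith) (by linarith)
        have h6 : 0 ≤ (c - a) * (b - t) := mul_nonneg (by linarith) (by linarith)
        have h7 : (c - a) * (b - t) + (t - c) * (b - d) = 0 := by linarith
        have h8 : (c - a) * (b - t) = 0 := by linarith
        rcases mul_eq_zero.1 h8 with h' | h'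
        · linarith
        · rw [← h, h', mul_zero]
    rcases lt_trichotomy a c with hac | rfl | hac
    · rw [h]
      refine nested a b c d hac.le (not_lt.1 fun hbd => h1 ⟨hac, hbc, hbd⟩) hat htb hct htd h h3
    · rcases le_total b d with hbd | hdb
      · exact nested a d a b le_rfl hbd hct htd hat htb h.symm fun h4 => h3 ⟨rfl, h4.2.symm⟩
      · rw [h]
        exact nested a b a d le_rfl hdb hat htb hct htd h h3
    · exact nested c d a b hac.le (not_lt.1 fun hdb => h2 ⟨hac, hda, hdb⟩) hct htd hat htb h.symm
        fun h4 => h3 ⟨h4.1.symm, h4.2.symm⟩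
  constructor
  · rcases mul_eq_zero.1 key with h' | h'
    · left; linarith
    · right; linarith
  · rcases mul_eq_zero.1 (h.symm.trans key) with h' | h'
    · left; linarith
    · right; linarith

theorem isPolygonalArc_segment {a b : EuclideanSpace ℝ (Fin 2)} (hab : a ≠ b) :
    IsPolygonalArc (segment ℝ a b) a b := by
  refine ⟨0, fun i => if i = 0 then a else b, by simp, by simp, ?_, ?_, ?_, ?_⟩
  · intro i hi
    obtain rfl : i = 0 := by omega
    simpa using hab
  · intro i hi
    omega
  · intro i j h1 h2
    omega
  · ext z
    simp

end Parabola

section Embedding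

variable {V : Type*} [LinearOrder V] {G : SimpleGraph V}

theorem exists_strictMono_real [Finite V] : ∃ f : V → ℝ, StrictMono f := by
  classical
  have := Fintype.ofFinite V
  refine ⟨fun v => ((Finset.univ.filter fun w => w < v).card : ℝ), fun u v huv => ?_⟩
  refine Nat.cast_lt.2 (Finset.card_lt_card ⟨fun w hw => ?_, fun hs => ?_⟩)
  · simp only [Finset.mem_filter, Finset.mem_univ, true_and] at hw ⊢
    exact hw.trans huv
  · have := @hs u (by simpa using huv)
    simp at this

/-- The chord of the parabola that represents an edge. -/
noncomputable def chord (f : V → ℝ) : Sym2 V → Set (EuclideanSpace ℝ (Fin 2)) :=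
  Sym2.lift ⟨fun u v => segment ℝ (parabolaPoint (f u)) (parabolaPoint (f v)),
    fun _ _ => segment_symm ℝ _ _⟩

theorem exists_lt_of_mem_edgeSet {e : Sym2 V} (he : e ∈ G.edgeSet) :
    ∃ u v, u < v ∧ G.Adj u v ∧ e = s(u, v) := by
  induction e with
  | _ u v =>
    rcases lt_or_gt_of_ne (G.ne_of_adj he) with h | h
    · exact ⟨u, v, h, he, rfl⟩
    · exact ⟨v, u, h, he.symm, Sym2.eq_swap⟩

theorem mem_chord {f : V → ℝ} (hf : StrictMono f) {u v : V} (huv : u < v)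
    {z : EuclideanSpace ℝ (Fin 2)} (hz : z ∈ chord f s(u, v)) :
    f u ≤ z 0 ∧ z 0 ≤ f v ∧ z 1 - z 0 ^ 2 = (z 0 - f u) * (f v - z 0) :=
  mem_segment_parabolaPoint (hf huv).le hz

/-- The straight-line embedding with the vertices on a parabola. -/
noncomputable def IsNoncrossing.planeEmbedding (h : G.IsNoncrossing) {f : V → ℝ}
    (hf : StrictMono f) : G.PlaneEmbedding where
  vert v := parabolaPoint (f v)
  arc := chord f
  vert_injective := parabolaPoint_injective.comp hf.injective
  isPolygonalArc u v huv :=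
    isPolygonalArc_segment fun he => huv.ne (hf.injective (parabolaPoint_injective he))
  mem_of_vert_mem_arc e he w hw := by
    obtain ⟨u, v, huv, -, rfl⟩ := exists_lt_of_mem_edgeSet he
    obtain ⟨-, -, h3⟩ := mem_chord hf huv hw
    have h4 : (f w - f u) * (f v - f w) = 0 := by
      simpa [parabolaPoint, eq_comm] using h3
    rw [Sym2.mem_iff]
    rcases mul_eq_zero.1 h4 with h5 | h5
    · exact Or.inl (hf.injective (by linarith))
    · exact Or.inr (hf.injective (by linarith))
  arc_inter_subset e he e' he' hne := by
    rintro z ⟨hz, hz'⟩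
    obtain ⟨a, b, hab, haab, rfl⟩ := exists_lt_of_mem_edgeSet he
    obtain ⟨c, d, hcd, hacd, rfl⟩ := exists_lt_of_mem_edgeSet he'
    obtain ⟨h1, h2, h3⟩ := mem_chord hf hab hz
    obtain ⟨h4, h5, h6⟩ := mem_chord hf hcd hz'
    obtain ⟨h7, h8⟩ := eq_end_of_mem_chords h1 h2 h4 h5 (h3.symm.trans h6)
      (fun hc => h (hf.lt_iff_lt.1 hc.1) (hf.lt_iff_lt.1 hc.2.1) (hf.lt_iff_lt.1 hc.2.2) haab hacd)
      (fun hc => h (hf.lt_iff_lt.1 hc.1) (hf.lt_iff_lt.1 hc.2.1) (hf.lt_iff_lt.1 hc.2.2) hacd haab)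
      (fun hc => hne (by rw [hf.injective hc.1, hf.injective hc.2]))
    have hzero : (z 0 - f a) * (f b - z 0) = 0 := by
      rcases h7 with h7 | h7 <;> simp [h7]
    have hz2 := eq_parabolaPoint (z := z) (by linarith)
    have key : ∀ x y : V, z 0 = f x → z 0 = f y → x = y := fun x y hx hy =>
      hf.injective (hx.symm.trans hy)
    rcases h7 with h7 | h7 <;> rcases h8 with h8 | h8 <;> have e := key _ _ h7 h8 <;> subst e
    all_goals
      rw [h7] at hz2
      exact ⟨_, by simp, hz2.symm⟩

/-- A shear carries a half-plane onto this region. -/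
theorem isPreconnected_below_parabola :
    IsPreconnected {z : EuclideanSpace ℝ (Fin 2) | z 1 < z 0 ^ 2} := by
  have e : {z : EuclideanSpace ℝ (Fin 2) | z 1 < z 0 ^ 2} =
      (fun p : ℝ × ℝ => (!₂[p.1, p.1 ^ 2 - p.2] : EuclideanSpace ℝ (Fin 2))) ''
        (Set.univ ×ˢ Set.Ioi 0) := by
    ext z
    constructor
    · intro hz
      refine ⟨(z 0, z 0 ^ 2 - z 1), ⟨trivial, ?_⟩, ?_⟩
      · simpa using hz
      · ext i
        fin_cases i <;> simp
    · rintro ⟨p, ⟨-, hp⟩, rfl⟩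
      simpa using hp
  rw [e]
  refine ((convex_univ.prod (convex_Ioi 0)).isPreconnected).image _ (Continuous.continuousOn ?_)
  refine (PiLp.continuous_toLp 2 _).comp ?_
  refine continuous_pi fun i => ?_
  fin_cases i
  · exact continuous_fst
  · exact (continuous_fst.pow 2).sub continuous_snd

/-- All chords lie on or above the parabola, so the connected unbounded region below it belongs to
one face, and every vertex is a limit of points of that region. -/
theorem IsNoncrossing.isOuterplanar [Finite V] (h : G.IsNoncrossing) : G.IsOuterplanar := by
  obtain ⟨f, hf⟩ := exists_strictMono_real (V := V)
  set E := h.planeEmbedding hf with hE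
  set B : Set (EuclideanSpace ℝ (Fin 2)) := {z | z 1 < z 0 ^ 2} with hB
  have hBs : B ⊆ E.supportᶜ := by
    rintro z hz (⟨v, rfl⟩ | hz')
    · simp [hE, hB, planeEmbedding, parabolaPoint] at hz
    · simp only [Set.mem_iUnion] at hz'
      obtain ⟨e, he, hze⟩ := hz'
      obtain ⟨a, b, hab, -, rfl⟩ := exists_lt_of_mem_edgeSet he
      obtain ⟨h1, h2, h3⟩ := mem_chord hf hab hze
      have : 0 ≤ (z 0 - f a) * (f b - z 0) := mul_nonneg (by linarith) (by linarith)
      simp only [hB, Set.mem_ofPred_eq] at hz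
      linarith
  have hbelow : ∀ x s : ℝ, 0 < s → (!₂[x, x ^ 2 - s] : EuclideanSpace ℝ (Fin 2)) ∈ B := by
    intro x s hs
    simpa [hB] using hs
  have hBF := isPreconnected_below_parabola.subset_connectedComponentIn (hbelow 0 1 one_pos) hBs
  refine ⟨E, connectedComponentIn E.supportᶜ !₂[0, 0 ^ 2 - 1],
    ⟨_, hBs (hbelow 0 1 one_pos), rfl⟩, ?_, ?_⟩
  · intro hb
    obtain ⟨C, hC⟩ := (hb.subset hBF).exists_norm_le
    have h1 := hC _ (hbelow 0 (|C| + 1) (by positivity))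
    have h2 := (PiLp.norm_apply_le (!₂[(0 : ℝ), 0 ^ 2 - (|C| + 1)]) 1).trans h1
    simp only [Fin.isValue, Matrix.cons_val_one, Matrix.cons_val_fin_one,
      Real.norm_eq_abs] at h2
    have h3 := neg_abs_le ((0 : ℝ) ^ 2 - (|C| + 1))
    have := le_abs_self C
    linarith
  · intro v
    refine ⟨closure_mono hBF ?_, fun hv => ?_⟩
    · refine mem_closure_of_tendsto (f := fun s : ℝ => (!₂[f v, f v ^ 2 - s] :
        EuclideanSpace ℝ (Fin 2))) (b := nhdsWithin 0 (Set.Ioi 0)) ?_ ?_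
      · have hc : Continuous fun s : ℝ => (!₂[f v, f v ^ 2 - s] : EuclideanSpace ℝ (Fin 2)) := by
          refine (PiLp.continuous_toLp 2 _).comp (continuous_pi fun i => ?_)
          fin_cases i
          · exact continuous_const
          · exact continuous_const.sub continuous_id
        have := (hc.tendsto 0).mono_left (nhdsWithin_le_nhds (s := Set.Ioi 0))
        simpa [hE, planeEmbedding, parabolaPoint] using this
      · filter_upwards [self_mem_nhdsWithin] with s hs
        exact hbelow _ _ hs
    · exact connectedComponentIn_subset _ _ (interior_subset hv) (Or.inl ⟨v, rfl⟩)

/-- If no edge crossed `u v`, the enlarged graph would be noncrossing for the same order and hence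
outerplanar. -/
theorem IsNoncrossing.exists_crossing_of_isMaximalOuterplanar [Finite V] (h : G.IsNoncrossing)
    (hmax : G.IsMaximalOuterplanar) {u v : V} (huv : u < v) (hadj : ¬ G.Adj u v) :
    ∃ c d, G.Adj c d ∧ ((u < c ∧ c < v ∧ v < d) ∨ (c < u ∧ u < d ∧ d < v)) := by
  have hnot : ¬ (G ⊔ edge u v).IsNoncrossing := fun hn => hmax.2 u v huv.ne hadj hn.isOuterplanar
  simp only [IsNoncrossing, not_forall, not_not] at hnot
  obtain ⟨a, b, c, d, hab, hbc, hcd, hac, hbd⟩ := hnot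
  rw [sup_adj, edge_adj] at hac hbd
  rcases hac with hac | ⟨⟨rfl, rfl⟩ | ⟨rfl, rfl⟩, -⟩
  · rcases hbd with hbd | ⟨⟨rfl, rfl⟩ | ⟨rfl, rfl⟩, -⟩
    · exact absurd hbd (h hab hbc hcd hac)
    · exact ⟨a, c, hac, Or.inr ⟨hab, hbc, hcd⟩⟩
    · exact absurd huv (hbc.trans hcd).not_gt
  · rcases hbd with hbd | ⟨⟨rfl, rfl⟩ | ⟨rfl, rfl⟩, -⟩
    · exact ⟨b, d, hbd, Or.inl ⟨hab, hbc, hcd⟩⟩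
    · exact absurd hab (lt_irrefl _)
    · exact absurd huv (hbc.trans hcd).not_gt
  · exact absurd huv (hab.trans hbc).not_gt

theorem IsNoncrossing.isPolygonTriangulation [Finite V] (h : G.IsNoncrossing)
    (hmax : G.IsMaximalOuterplanar) : G.IsPolygonTriangulation where
  noncrossing := h
  root i j hij hne := by
    by_contra hadj
    have hlt := lt_of_le_of_ne (hij j).1 hne
    obtain ⟨c, d, -, ⟨-, -, h1⟩ | ⟨h1, -⟩⟩ :=
      h.exists_crossing_of_isMaximalOuterplanar hmax hlt hadj
    · exact absurd (hij d).2 (not_le.2 h1)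
    · exact absurd (hij c).1 (not_le.2 h1)
  apex i j hadj hlt hw := by
    -- `w` is the immediate successor of `i`. Nothing lies between them, so no edge can cross `i w`,
    -- and it must be present.
    have hcover : ∃ w, (i < w ∧ w < j) ∧ ∀ x, i < x ∧ x < j → w ≤ x := by
      obtain ⟨w, hw, hmin⟩ := Set.exists_min_image {x | i < x ∧ x < j} id (Set.toFinite _) hw
      exact ⟨w, hw, hmin⟩
    obtain ⟨w, hw, hmin⟩ := hcover
    have hiw : G.Adj i w := by
      by_contra hn
      obtain ⟨c, d, -, ⟨h1, h2, -⟩ | ⟨-, h1, h2⟩⟩ :=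
        h.exists_crossing_of_isMaximalOuterplanar hmax hw.1 hn
      · exact absurd (hmin c ⟨h1, h2.trans hw.2⟩) (not_le.2 h2)
      · exact absurd (hmin d ⟨h1, h2.trans hw.2⟩) (not_le.2 h2)
    -- The apex is the last neighbour of `i` before `j`. An edge crossing `k j` would cross `i j` or
    -- `i k`, or would give a later neighbour of `i`.
    obtain ⟨k, ⟨hk, hik⟩, hkmax⟩ := Set.exists_max_image {x | (i < x ∧ x < j) ∧ G.Adj i x} id
      (Set.toFinite _) ⟨w, hw, hiw⟩
    refine ⟨k, hk.1, hk.2, hik, ?_⟩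
    by_contra hn
    obtain ⟨c, d, hcd, ⟨h1, h2, h3⟩ | ⟨h1, h2, h3⟩⟩ :=
      h.exists_crossing_of_isMaximalOuterplanar hmax hk.2 hn
    · exact absurd (h.mem_Icc hadj (hk.1.trans h1) h2 hcd).2 (not_le.2 h3)
    · obtain ⟨h4, -⟩ := h.mem_Icc hadj (hk.1.trans h2) h3 hcd.symm
      rcases h4.eq_or_lt with rfl | h4
      · exact absurd (hkmax d ⟨⟨hk.1.trans h2, h3⟩, hcd⟩) (not_le.2 h2)
      · exact absurd (h.mem_Icc hik h4 h1 hcd).2 (not_le.2 h2)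

end Embedding

end SimpleGraph

namespace PlaneTopology

open Set Filter Topology

/-! ### Polar coordinates around a point of the plane -/

/-- The point with polar coordinates `ρ`, `θ` with respect to `p`. -/
noncomputable def polar (p : ℂ) (ρ θ : ℝ) : ℂ := p + ρ * Complex.exp (θ * Complex.I)

theorem continuous_polar (p : ℂ) : Continuous fun x : ℝ × ℝ => polar p x.1 x.2 := by
  unfold polar
  fun_prop

theorem polar_add_two_pi (p : ℂ) (ρ θ : ℝ) : polar p ρ (θ + 2 * Real.pi) = polar p ρ θ := by
  unfold polar
  push_cast
  rw [add_mul, Complex.exp_periodic]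

theorem norm_polar_sub (p : ℂ) {ρ : ℝ} (hρ : 0 ≤ ρ) (θ : ℝ) : ‖polar p ρ θ - p‖ = ρ := by
  simp [polar, Complex.norm_exp_ofReal_mul_I, abs_of_nonneg hρ]

theorem exists_eq_polar (p z : ℂ) (a : ℝ) :
    ∃ θ ∈ Ico a (a + 2 * Real.pi), z = polar p ‖z - p‖ θ := by
  refine ⟨toIcoMod Real.two_pi_pos a (Complex.arg (z - p)), toIcoMod_mem_Ico _ _ _, ?_⟩
  have h1 : Complex.exp ((toIcoMod Real.two_pi_pos a (Complex.arg (z - p)) : ℝ) * Complex.I) =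
      Complex.exp (Complex.arg (z - p) * Complex.I) := by
    rw [Complex.exp_eq_exp_iff_exists_int]
    refine ⟨-toIcoDiv Real.two_pi_pos a (Complex.arg (z - p)), ?_⟩
    have : toIcoMod Real.two_pi_pos a (Complex.arg (z - p)) = Complex.arg (z - p) -
        toIcoDiv Real.two_pi_pos a (Complex.arg (z - p)) • (2 * Real.pi) := rfl
    rw [this]
    push_cast
    simp only [zsmul_eq_mul]
    ring
  rw [polar, h1, Complex.norm_mul_exp_arg_mul_I]
  ring

theorem polar_injective {p : ℂ} {a ρ ρ' θ θ' : ℝ} (hρ : 0 < ρ) (hρ' : 0 < ρ')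
    (hθ : θ ∈ Ico a (a + 2 * Real.pi)) (hθ' : θ' ∈ Ico a (a + 2 * Real.pi))
    (h : polar p ρ θ = polar p ρ' θ') : θ = θ' := by
  have h1 : ρ = ρ' := by
    rw [← norm_polar_sub p hρ.le θ, ← norm_polar_sub p hρ'.le θ', h]
  subst h1
  have h2 : Complex.exp (θ * Complex.I) = Complex.exp (θ' * Complex.I) := by
    have : (ρ : ℂ) ≠ 0 := by exact_mod_cast hρ.ne'
    exact mul_left_cancel₀ this (add_left_cancel h)
  rw [Complex.exp_eq_exp_iff_exists_int] at h2
  obtain ⟨n, hn⟩ := h2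
  have h3 : θ = θ' + n * (2 * Real.pi) := by
    have := congrArg Complex.im hn
    simpa using this
  have hpi := Real.two_pi_pos
  have h4 : (n : ℝ) < 1 := by
    by_contra! hn1
    have : 2 * Real.pi ≤ n * (2 * Real.pi) := by nlinarith
    linarith [hθ.2, hθ'.1]
  have h5 : (-1 : ℝ) < n := by
    by_contra! hn1
    have : n * (2 * Real.pi) ≤ - (2 * Real.pi) := by nlinarith
    linarith [hθ.1, hθ'.2]
  have h6 : n = 0 := by
    have h4' : n < 1 := by exact_mod_cast h4
    have h5' : -1 < n := by exact_mod_cast h5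
    omega
  simp [h3, h6]

/-- An open circular sector with apex `p`. -/
def sector (p : ℂ) (r α β : ℝ) : Set ℂ := (fun x : ℝ × ℝ => polar p x.1 x.2) '' (Ioo 0 r ×ˢ Ioo α β)

theorem mem_sector {p : ℂ} {r α β ρ θ : ℝ} (hρ : 0 < ρ) (hr : ρ < r) (hα : α < θ) (hβ : θ < β) :
    polar p ρ θ ∈ sector p r α β :=
  ⟨(ρ, θ), ⟨⟨hρ, hr⟩, hα, hβ⟩, rfl⟩

theorem isPreconnected_sector (p : ℂ) (r α β : ℝ) : IsPreconnected (sector p r α β) :=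
  ((convex_Ioo 0 r).prod (convex_Ioo α β)).isPreconnected.image _ (continuous_polar p).continuousOn

theorem polar_mem_closure_sector {p : ℂ} {r α β ρ θ : ℝ} (hρ : 0 < ρ) (hr : ρ < r) (hαβ : α < β)
    (hθ : θ ∈ Icc α β) : polar p ρ θ ∈ closure (sector p r α β) := by
  refine image_closure_subset_closure_image (continuous_polar p) ⟨(ρ, θ), ?_, rfl⟩
  rw [closure_prod_eq, closure_Ioo hαβ.ne]
  exact ⟨subset_closure ⟨hρ, hr⟩, hθ⟩

theorem sector_add_two_pi (p : ℂ) (r α β : ℝ) :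
    sector p r (α + 2 * Real.pi) (β + 2 * Real.pi) = sector p r α β := by
  ext z
  constructor
  · rintro ⟨⟨ρ, θ⟩, ⟨hρ, hθ⟩, rfl⟩
    refine ⟨(ρ, θ - 2 * Real.pi), ⟨hρ, ?_, ?_⟩, ?_⟩
    · have := hθ.1; simp only at this ⊢; linarith
    · have := hθ.2; simp only at this ⊢; linarith
    · simp only
      rw [← polar_add_two_pi, sub_add_cancel]
  · rintro ⟨⟨ρ, θ⟩, ⟨hρ, hθ⟩, rfl⟩
    refine ⟨(ρ, θ + 2 * Real.pi), ⟨hρ, ?_, ?_⟩, polar_add_two_pi p ρ θ⟩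
    · have := hθ.1; simp only at this ⊢; linarith
    · have := hθ.2; simp only at this ⊢; linarith

/-- Dividing by `m - p` moves the angle to a neighbourhood of 0, where `Complex.arg` is continuous,
so no branch cut interferes. -/
theorem eventually_exists_polar (p : ℂ) {r ρ α δ : ℝ} (hρ : 0 < ρ) (hr : ρ < r) (hδ : 0 < δ) :
    ∀ᶠ z in 𝓝 (polar p ρ α), ∃ ρ' θ, 0 < ρ' ∧ ρ' < r ∧ |θ - α| < δ ∧ z = polar p ρ' θ := by
  set m := polar p ρ α with hm
  have hmp : m - p ≠ 0 := by
    rw [← norm_ne_zero_iff, norm_polar_sub p hρ.le]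
    exact hρ.ne'
  have hpolar : m - p = ρ * Complex.exp (α * Complex.I) := by simp [hm, polar]
  have c1 : ContinuousAt (fun z : ℂ => ‖z - p‖) m := by fun_prop
  have c2 : ContinuousAt (fun z : ℂ => Complex.arg ((z - p) / (m - p))) m := by
    refine ContinuousAt.comp (g := Complex.arg) (f := fun z : ℂ => (z - p) / (m - p)) ?_ (by fun_prop)
    rw [div_self hmp]
    exact Complex.continuousAt_arg (by simp)
  have e1 : ∀ᶠ z in 𝓝 m, 0 < ‖z - p‖ := c1.eventually (lt_mem_nhds (norm_pos_iff.2 hmp))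
  have e2 : ∀ᶠ z in 𝓝 m, ‖z - p‖ < r := by
    refine c1.eventually (gt_mem_nhds ?_)
    change ‖m - p‖ < r
    rwa [hm, norm_polar_sub p hρ.le]
  have e3 : ∀ᶠ z in 𝓝 m, |Complex.arg ((z - p) / (m - p))| < δ := by
    refine c2.abs.eventually (gt_mem_nhds ?_)
    simpa [div_self hmp] using hδ
  filter_upwards [e1, e2, e3] with z h1 h2 h3
  refine ⟨‖z - p‖, α + Complex.arg ((z - p) / (m - p)), h1, h2, by simpa using h3, ?_⟩
  have h4 := Complex.norm_mul_exp_arg_mul_I ((z - p) / (m - p))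
  rw [norm_div, norm_polar_sub p hρ.le] at h4
  have hρ' : (ρ : ℂ) ≠ 0 := by exact_mod_cast hρ.ne'
  have h5 : z - p = (‖z - p‖ / ρ : ℝ) *
      Complex.exp (Complex.arg ((z - p) / (m - p)) * Complex.I) * (m - p) := by
    rw [h4, div_mul_cancel₀ _ hmp]
  have h6 : z - p = ‖z - p‖ *
      Complex.exp ((α + Complex.arg ((z - p) / (m - p)) : ℝ) * Complex.I) := by
    push_cast
    rw [add_mul, Complex.exp_add]
    conv_lhs => rw [h5]
    conv_lhs => rw [hpolar]
    push_cast
    field_simp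
    rw [hpolar]
  rw [polar, ← h6]
  ring

/-! ### Sectors between radii of the drawing, and which of them belong to a face. -/

/-- `F` is a connected component of the complement of `S`. -/
structure IsComponent (S F : Set ℂ) : Prop where
  disjoint : ∀ z ∈ F, z ∉ S
  preconnected : IsPreconnected F
  maximal : ∀ T, IsPreconnected T → (∀ z ∈ T, z ∉ S) → (∃ z ∈ T, z ∈ F) → T ⊆ F

theorem isComponent_connectedComponentIn (S : Set ℂ) (x : ℂ) :
    IsComponent S (connectedComponentIn Sᶜ x) where
  disjoint z hz := connectedComponentIn_subset _ _ hz
  preconnected := isPreconnected_connectedComponentIn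
  maximal T hT hTS := by
    rintro ⟨z, hzT, hzF⟩
    rw [connectedComponentIn_eq hzF]
    exact hT.subset_connectedComponentIn hzT hTS

/-- Near `p`, the set `S` consists of three radii (the last two may coincide). -/
structure IsTripod (S : Set ℂ) (p : ℂ) (r α₁ α₂ α₃ : ℝ) : Prop where
  pos : 0 < r
  lt₁₂ : α₁ < α₂
  le₂₃ : α₂ ≤ α₃
  lt₃₁ : α₃ < α₁ + 2 * Real.pi
  polar_mem : ∀ ρ θ, 0 < ρ → ρ < r → θ ∈ Ico α₁ (α₁ + 2 * Real.pi) →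
    (polar p ρ θ ∈ S ↔ θ = α₁ ∨ θ = α₂ ∨ θ = α₃)

section Tripod

variable {S F : Set ℂ} {p : ℂ} {r α₁ α₂ α₃ : ℝ}

theorem IsComponent.sector_subset (hF : IsComponent S F) {α β : ℝ}
    (h : ∀ z ∈ sector p r α β, z ∉ S) {z : ℂ} (hz : z ∈ sector p r α β) (hzF : z ∈ F) :
    sector p r α β ⊆ F :=
  hF.maximal _ (isPreconnected_sector p r α β) h ⟨z, hz, hzF⟩

theorem IsTripod.sector₁₂ (h : IsTripod S p r α₁ α₂ α₃) : ∀ z ∈ sector p r α₁ α₂, z ∉ S := by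
  rintro _ ⟨⟨ρ, θ⟩, ⟨⟨hρ, hr⟩, h1, h2⟩, rfl⟩ hz
  simp only at h1 h2 hρ hr
  have := h.le₂₃
  have := h.lt₃₁
  rcases (h.polar_mem ρ θ hρ hr ⟨h1.le, by linarith⟩).1 hz with h3 | h3 | h3 <;> linarith

theorem IsTripod.sector₂₃ (h : IsTripod S p r α₁ α₂ α₃) : ∀ z ∈ sector p r α₂ α₃, z ∉ S := by
  rintro _ ⟨⟨ρ, θ⟩, ⟨⟨hρ, hr⟩, h1, h2⟩, rfl⟩ hz
  simp only at h1 h2 hρ hr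
  have := h.lt₁₂
  have := h.lt₃₁
  rcases (h.polar_mem ρ θ hρ hr ⟨by linarith, by linarith⟩).1 hz with h3 | h3 | h3 <;> linarith

theorem IsTripod.sector₃₁ (h : IsTripod S p r α₁ α₂ α₃) :
    ∀ z ∈ sector p r α₃ (α₁ + 2 * Real.pi), z ∉ S := by
  rintro _ ⟨⟨ρ, θ⟩, ⟨⟨hρ, hr⟩, h1, h2⟩, rfl⟩ hz
  simp only at h1 h2 hρ hr
  have := h.lt₁₂
  have := h.le₂₃
  rcases (h.polar_mem ρ θ hρ hr ⟨by linarith, by linarith⟩).1 hz with h3 | h3 | h3 <;> linarith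

theorem IsTripod.sector₃₁' (h : IsTripod S p r α₁ α₂ α₃) :
    ∀ z ∈ sector p r (α₃ - 2 * Real.pi) α₁, z ∉ S := by
  rw [← sector_add_two_pi, sub_add_cancel]
  exact h.sector₃₁

/-- A point of `F` close to `p` lies in an open sector free of `S`; being connected, the whole
sector lies in `F`. -/
theorem IsTripod.exists_sector_subset (h : IsTripod S p r α₁ α₂ α₃) (hF : IsComponent S F)
    (hpS : p ∈ S) (hp : p ∈ closure F) :
    sector p r α₁ α₂ ⊆ F ∨ (α₂ < α₃ ∧ sector p r α₂ α₃ ⊆ F) ∨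
      sector p r α₃ (α₁ + 2 * Real.pi) ⊆ F := by
  obtain ⟨z, hzF, hz⟩ := Metric.mem_closure_iff.1 hp r h.pos
  have hzp : z ≠ p := by rintro rfl; exact hF.disjoint _ hzF hpS
  have hρ : 0 < ‖z - p‖ := norm_pos_iff.2 (sub_ne_zero.2 hzp)
  have hr : ‖z - p‖ < r := by rwa [← dist_eq_norm, dist_comm]
  obtain ⟨θ, hθ, hzθ⟩ := exists_eq_polar p z α₁
  have hnot : ¬ (θ = α₁ ∨ θ = α₂ ∨ θ = α₃) := by
    rw [← h.polar_mem _ θ hρ hr hθ, ← hzθ]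
    exact hF.disjoint z hzF
  push Not at hnot
  obtain ⟨h1, h2, h3⟩ := hnot
  have h1' := lt_of_le_of_ne hθ.1 h1.symm
  rcases lt_or_gt_of_ne h2 with h2 | h2
  · left
    refine hF.sector_subset h.sector₁₂ (z := z) ?_ hzF
    rw [hzθ]; exact mem_sector hρ hr h1' h2
  rcases lt_or_gt_of_ne h3 with h3 | h3
  · right; left
    refine ⟨h2.trans h3, hF.sector_subset h.sector₂₃ (z := z) ?_ hzF⟩
    rw [hzθ]; exact mem_sector hρ hr h2 h3
  · right; right
    refine hF.sector_subset h.sector₃₁ (z := z) ?_ hzF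
    rw [hzθ]; exact mem_sector hρ hr h3 hθ.2

/-- A radius that belongs to the closure of `F` and separates two sectors has one of them in `F`. -/
theorem IsComponent.sector_subset_or (hF : IsComponent S F) {γ α β ρ : ℝ} (hγα : γ < α)
    (hαβ : α < β) (hl : ∀ z ∈ sector p r γ α, z ∉ S) (hr : ∀ z ∈ sector p r α β, z ∉ S)
    (hrad : ∀ ρ, 0 < ρ → ρ < r → polar p ρ α ∈ S) (hρ : 0 < ρ) (hρr : ρ < r)
    (hcl : polar p ρ α ∈ closure F) : sector p r γ α ⊆ F ∨ sector p r α β ⊆ F := by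
  have hev := eventually_exists_polar p (α := α) hρ hρr
    (δ := min (α - γ) (β - α)) (lt_min (by linarith) (by linarith))
  obtain ⟨z, ⟨ρ', θ, h1, h2, h3, rfl⟩, hzF⟩ := (mem_closure_iff_frequently.1 hcl).and_eventually hev
    |>.exists.imp fun _ hx => hx.symm
  have h4 := abs_lt.1 (h3.trans_le (min_le_left _ _))
  have h5 := abs_lt.1 (h3.trans_le (min_le_right _ _))
  rcases lt_trichotomy θ α with h6 | rfl | h6
  · exact Or.inl (hF.sector_subset hl (mem_sector h1 h2 (by linarith) h6) hzF)
  · exact absurd (hrad _ h1 h2) (hF.disjoint _ hzF)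
  · exact Or.inr (hF.sector_subset hr (mem_sector h1 h2 h6 (by linarith)) hzF)

/-- Two neighbouring sectors together with their common radius form a neighbourhood of each point of
that radius. -/
theorem eventually_mem_of_sectors {γ α β ρ : ℝ} (hγα : γ < α) (hαβ : α < β)
    (hl : sector p r γ α ⊆ F) (hr : sector p r α β ⊆ F)
    (hrad : ∀ ρ, 0 < ρ → ρ < r → polar p ρ α ∈ S) (hρ : 0 < ρ) (hρr : ρ < r) :
    ∀ᶠ z in 𝓝 (polar p ρ α), z ∉ S → z ∈ F := by
  have hev := eventually_exists_polar p (α := α) hρ hρr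
    (δ := min (α - γ) (β - α)) (lt_min (by linarith) (by linarith))
  filter_upwards [hev]
  rintro _ ⟨ρ', θ, h1, h2, h3, rfl⟩ hz
  have h4 := abs_lt.1 (h3.trans_le (min_le_left _ _))
  have h5 := abs_lt.1 (h3.trans_le (min_le_right _ _))
  rcases lt_trichotomy θ α with h6 | rfl | h6
  · exact hl (mem_sector h1 h2 (by linarith) h6)
  · exact absurd (hrad _ h1 h2) hz
  · exact hr (mem_sector h1 h2 h6 (by linarith))

/-- Every radius borders a sector in `F`, and one sector borders only two of the three radii. So at
least two sectors lie in `F`, and any two of the three share a radius. -/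
theorem IsTripod.exists_two_sided (h : IsTripod S p r α₁ α₂ α₃) (h23 : α₂ < α₃)
    (hF : IsComponent S F)
    (h₁ : ∃ ρ, 0 < ρ ∧ ρ < r ∧ polar p ρ α₁ ∈ closure F)
    (h₂ : ∃ ρ, 0 < ρ ∧ ρ < r ∧ polar p ρ α₂ ∈ closure F)
    (h₃ : ∃ ρ, 0 < ρ ∧ ρ < r ∧ polar p ρ α₃ ∈ closure F) :
    ∃ α, (α = α₁ ∨ α = α₂ ∨ α = α₃) ∧ ∀ ρ, 0 < ρ → ρ < r →
      ∀ᶠ z in 𝓝 (polar p ρ α), z ∉ S → z ∈ F := by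
  have l12 := h.lt₁₂
  have l31 := h.lt₃₁
  have r₁ : ∀ ρ, 0 < ρ → ρ < r → polar p ρ α₁ ∈ S := fun ρ h1 h2 =>
    (h.polar_mem ρ α₁ h1 h2 ⟨le_rfl, by linarith⟩).2 (Or.inl rfl)
  have r₂ : ∀ ρ, 0 < ρ → ρ < r → polar p ρ α₂ ∈ S := fun ρ h1 h2 =>
    (h.polar_mem ρ α₂ h1 h2 ⟨by linarith, by linarith⟩).2 (Or.inr (Or.inl rfl))
  have r₃ : ∀ ρ, 0 < ρ → ρ < r → polar p ρ α₃ ∈ S := fun ρ h1 h2 =>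
    (h.polar_mem ρ α₃ h1 h2 ⟨by linarith, by linarith⟩).2 (Or.inr (Or.inr rfl))
  have e31 : sector p r (α₃ - 2 * Real.pi) α₁ = sector p r α₃ (α₁ + 2 * Real.pi) := by
    rw [← sector_add_two_pi, sub_add_cancel]
  obtain ⟨ρ₁, h11, h12, h13⟩ := h₁
  obtain ⟨ρ₂, h21, h22, h23'⟩ := h₂
  obtain ⟨ρ₃, h31, h32, h33⟩ := h₃
  have t₁ := hF.sector_subset_or (by linarith) l12 h.sector₃₁' h.sector₁₂ r₁ h11 h12 h13
  have t₂ := hF.sector_subset_or l12 h23 h.sector₁₂ h.sector₂₃ r₂ h21 h22 h23'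
  have t₃ := hF.sector_subset_or h23 l31 h.sector₂₃ h.sector₃₁ r₃ h31 h32 h33
  have c₂ : sector p r α₁ α₂ ⊆ F → sector p r α₂ α₃ ⊆ F → _ := fun hA hB =>
    (⟨α₂, Or.inr (Or.inl rfl), fun ρ h1 h2 =>
      eventually_mem_of_sectors l12 h23 hA hB r₂ h1 h2⟩ : ∃ α, (α = α₁ ∨ α = α₂ ∨ α = α₃) ∧
        ∀ ρ, 0 < ρ → ρ < r → ∀ᶠ z in 𝓝 (polar p ρ α), z ∉ S → z ∈ F)
  rcases t₁ with t₁ | t₁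
  · rcases t₂ with t₂ | t₂
    · exact ⟨α₁, Or.inl rfl, fun ρ h1 h2 =>
        eventually_mem_of_sectors (by linarith) l12 t₁ t₂ r₁ h1 h2⟩
    · exact ⟨α₃, Or.inr (Or.inr rfl), fun ρ h1 h2 =>
        eventually_mem_of_sectors h23 l31 t₂ (e31 ▸ t₁) r₃ h1 h2⟩
  · rcases t₃ with t₃ | t₃
    · exact c₂ t₁ t₃
    · exact ⟨α₁, Or.inl rfl, fun ρ h1 h2 =>
        eventually_mem_of_sectors (by linarith) l12 (e31.symm ▸ t₃) t₁ r₁ h1 h2⟩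

end Tripod

end PlaneTopology

/-! ### Finitely many segments issuing from a point. -/

namespace PlaneTopology

open Set Filter Topology

/-- Near `p`, the set `S` is the union of the segments from `p` to the points of `U`, and these
segments meet only in `p`. -/
structure IsStar (S : Set ℂ) (p : ℂ) (U : Set ℂ) : Prop where
  finite : U.Finite
  ne : ∀ u ∈ U, u ≠ p
  inter : ∀ u ∈ U, ∀ u' ∈ U, u ≠ u' → ∀ z ∈ segment ℝ p u, z ∈ segment ℝ p u' → z = p
  eventually_mem : ∀ᶠ z in 𝓝 p, z ∈ S ↔ ∃ u ∈ U, z ∈ segment ℝ p u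

/-- The initial part of the segment from `p` to `u` belongs to the closure of `F`. -/
def Abuts (F : Set ℂ) (p u : ℂ) : Prop := ∀ᶠ z in 𝓝 p, z ∈ segment ℝ p u → z ∈ closure F

/-- On both sides of the initial part of the segment from `p` to `u`, all points belong to `F`. -/
def TwoSided (S F : Set ℂ) (p u : ℂ) : Prop :=
  ∀ᶠ m in 𝓝 p, m ∈ segment ℝ p u → m ≠ p → ∀ᶠ z in 𝓝 m, z ∉ S → z ∈ F

theorem polar_mem_segment {p u : ℂ} {ρ θ : ℝ} (hρ : 0 < ρ) (hu : ρ ≤ ‖u - p‖)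
    (h : u = polar p ‖u - p‖ θ) : polar p ρ θ ∈ segment ℝ p u := by
  generalize ‖u - p‖ = R at hu h
  subst h
  have hR : 0 < R := hρ.trans_le hu
  rw [segment_eq_image']
  refine ⟨ρ / R, ⟨by positivity, (div_le_one hR).2 hu⟩, ?_⟩
  have h2 : (R : ℂ) ≠ 0 := by exact_mod_cast hR.ne'
  simp only [polar, add_sub_cancel_left, add_right_inj, Complex.real_smul]
  push_cast
  field_simp

theorem eq_polar_of_mem_segment {p u z : ℂ} {θ : ℝ} (h : u = polar p ‖u - p‖ θ)
    (hz : z ∈ segment ℝ p u) : z = polar p ‖z - p‖ θ := by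
  have hR := norm_nonneg (u - p)
  generalize ‖u - p‖ = R at hR h
  subst h
  rw [segment_eq_image'] at hz
  obtain ⟨t, ht, rfl⟩ := hz
  have h1 : p + t • (polar p R θ - p) = polar p (t * R) θ := by
    simp [polar, mul_assoc]
  simp only [h1, norm_polar_sub p (mul_nonneg ht.1 hR)]

/-- Polar angles are normalised to a full turn starting at `u₀`. Within a radius smaller than every
segment, the segments are radii, with distinct angles since they meet only in `p`. -/
theorem IsStar.exists_angles {S U : Set ℂ} {p u₀ : ℂ} (h : IsStar S p U) (hu₀ : u₀ ∈ U) :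
    ∃ r > 0, ∃ ang : ℂ → ℝ, (∀ u ∈ U, ang u ∈ Ico (ang u₀) (ang u₀ + 2 * Real.pi)) ∧
      (∀ u ∈ U, ∀ u' ∈ U, ang u = ang u' → u = u') ∧
      (∀ u ∈ U, ∀ z ∈ segment ℝ p u, z = polar p ‖z - p‖ (ang u)) ∧
      (∀ u ∈ U, ∀ ρ, 0 < ρ → ρ < r → polar p ρ (ang u) ∈ segment ℝ p u) ∧
      ∀ ρ θ, 0 < ρ → ρ < r → θ ∈ Ico (ang u₀) (ang u₀ + 2 * Real.pi) →
        (polar p ρ θ ∈ S ↔ ∃ u ∈ U, θ = ang u) := by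
  obtain ⟨a, -, ha⟩ := exists_eq_polar p u₀ 0
  choose ang hang hpol using fun u => exists_eq_polar p u a
  have hpos : ∀ u ∈ U, 0 < ‖u - p‖ := fun u hu => norm_pos_iff.2 (sub_ne_zero.2 (h.ne u hu))
  have ha0 : ang u₀ = a := polar_injective (hpos u₀ hu₀) (hpos u₀ hu₀) (hang u₀)
    ⟨le_rfl, by linarith [Real.two_pi_pos]⟩ ((hpol u₀).symm.trans ha)
  have hsmall : ∀ᶠ z in 𝓝 p, ∀ u ∈ U, ‖z - p‖ < ‖u - p‖ := by
    rw [h.finite.eventually_all]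
    intro u hu
    have hc : Continuous fun z : ℂ => ‖z - p‖ := by fun_prop
    refine (hc.tendsto p).eventually (gt_mem_nhds ?_)
    simpa using hpos u hu
  obtain ⟨r, hr, hball⟩ := Metric.eventually_nhds_iff.1 (h.eventually_mem.and hsmall)
  have hdist : ∀ ρ θ, 0 < ρ → ρ < r → dist (polar p ρ θ) p < r := by
    intro ρ θ h1 h2
    rwa [dist_eq_norm, norm_polar_sub p h1.le]
  have hseg : ∀ u ∈ U, ∀ ρ, 0 < ρ → ρ < r → polar p ρ (ang u) ∈ segment ℝ p u := by
    intro u hu ρ h1 h2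
    refine polar_mem_segment h1 ?_ (hpol u)
    have := (hball (hdist ρ (ang u) h1 h2)).2 u hu
    rw [norm_polar_sub p h1.le] at this
    exact this.le
  have hne : ∀ ρ θ, 0 < ρ → polar p ρ θ ≠ p := by
    intro ρ θ h1 h2
    have := norm_polar_sub p h1.le θ
    rw [h2, sub_self, norm_zero] at this
    exact h1.ne this
  refine ⟨r, hr, ang, ?_, ?_, fun u hu z hz => eq_polar_of_mem_segment (hpol u) hz, hseg, ?_⟩
  · intro u _
    rw [ha0]
    exact hang u
  · intro u hu u' hu' he
    by_contra hne'
    refine hne (r / 2) (ang u) (by positivity) (h.inter u hu u' hu' hne' _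
      (hseg u hu _ (by positivity) (by linarith)) ?_)
    rw [he]
    exact hseg u' hu' _ (by positivity) (by linarith)
  · intro ρ θ h1 h2 hθ
    rw [(hball (hdist ρ θ h1 h2)).1]
    constructor
    · rintro ⟨u, hu, hz⟩
      refine ⟨u, hu, ?_⟩
      have h3 := eq_polar_of_mem_segment (hpol u) hz
      rw [norm_polar_sub p h1.le] at h3
      rw [ha0] at hθ
      exact polar_injective h1 h1 hθ (hang u) h3
    · rintro ⟨u, hu, rfl⟩
      exact ⟨u, hu, hseg u hu ρ h1 h2⟩

theorem abuts_of_polar {F : Set ℂ} {p u : ℂ} {r θ : ℝ} (hr : 0 < r) (hp : p ∈ closure F)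
    (hseg : ∀ z ∈ segment ℝ p u, z = polar p ‖z - p‖ θ)
    (h : ∀ ρ, 0 < ρ → ρ < r → polar p ρ θ ∈ closure F) : Abuts F p u := by
  filter_upwards [Metric.ball_mem_nhds p hr] with z hz hzu
  rcases eq_or_ne z p with rfl | hzp
  · exact hp
  · rw [hseg z hzu]
    refine h _ (norm_pos_iff.2 (sub_ne_zero.2 hzp)) ?_
    rwa [← dist_eq_norm]

theorem Abuts.exists_polar {F : Set ℂ} {p u : ℂ} {r θ : ℝ} (hr : 0 < r) (h : Abuts F p u)
    (hseg : ∀ ρ, 0 < ρ → ρ < r → polar p ρ θ ∈ segment ℝ p u) :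
    ∃ ρ, 0 < ρ ∧ ρ < r ∧ polar p ρ θ ∈ closure F := by
  obtain ⟨ε, hε, hball⟩ := Metric.eventually_nhds_iff.1 h
  have h1 : 0 < min r ε / 2 := by positivity
  have h2 : min r ε / 2 < r := by linarith [min_le_left r ε]
  have h3 : min r ε / 2 < ε := by linarith [min_le_right r ε]
  refine ⟨min r ε / 2, h1, h2, hball ?_ (hseg _ h1 h2)⟩
  rwa [dist_eq_norm, norm_polar_sub p h1.le]

variable {S F : Set ℂ} {p u₁ u₂ u₃ : ℂ}

/-- With two segments there are two sectors, and each of them borders both segments. This is the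
tripod with its last two radii equal. -/
theorem IsStar.abuts_pair (h : IsStar S p {u₁, u₂}) (hne : u₁ ≠ u₂) (hF : IsComponent S F)
    (hpS : p ∈ S) (hp : p ∈ closure F) : Abuts F p u₁ ∧ Abuts F p u₂ := by
  obtain ⟨r, hr, ang, hIco, hinj, hpol, -, hS⟩ := h.exists_angles (mem_insert u₁ _)
  have hu₂ : u₂ ∈ ({u₁, u₂} : Set ℂ) := by simp
  have hu₁ : u₁ ∈ ({u₁, u₂} : Set ℂ) := by simp
  have hlt : ang u₁ < ang u₂ :=
    lt_of_le_of_ne (hIco u₂ hu₂).1 fun he => hne (hinj u₁ hu₁ u₂ hu₂ he)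
  have ht : IsTripod S p r (ang u₁) (ang u₂) (ang u₂) :=
    ⟨hr, hlt, le_rfl, (hIco u₂ hu₂).2, fun ρ θ h1 h2 h3 => by rw [hS ρ θ h1 h2 h3]; simp⟩
  have key : (∀ ρ, 0 < ρ → ρ < r → polar p ρ (ang u₁) ∈ closure F) ∧
      ∀ ρ, 0 < ρ → ρ < r → polar p ρ (ang u₂) ∈ closure F := by
    rcases ht.exists_sector_subset hF hpS hp with hs | ⟨hs, -⟩ | hs
    · exact ⟨fun ρ h1 h2 => closure_mono hs (polar_mem_closure_sector h1 h2 hlt ⟨le_rfl, hlt.le⟩),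
        fun ρ h1 h2 => closure_mono hs (polar_mem_closure_sector h1 h2 hlt ⟨hlt.le, le_rfl⟩)⟩
    · exact absurd hs (lt_irrefl _)
    · refine ⟨fun ρ h1 h2 => ?_, fun ρ h1 h2 => closure_mono hs
        (polar_mem_closure_sector h1 h2 ht.lt₃₁ ⟨le_rfl, ht.lt₃₁.le⟩)⟩
      rw [← polar_add_two_pi]
      exact closure_mono hs (polar_mem_closure_sector h1 h2 ht.lt₃₁ ⟨ht.lt₃₁.le, le_rfl⟩)
  exact ⟨abuts_of_polar hr hp (hpol u₁ hu₁) key.1, abuts_of_polar hr hp (hpol u₂ hu₂) key.2⟩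

theorem IsStar.exists_tripod (h : IsStar S p {u₁, u₂, u₃}) (h12 : u₁ ≠ u₂) (h13 : u₁ ≠ u₃)
    (h23 : u₂ ≠ u₃) : ∃ r > 0, ∃ ang : ℂ → ℝ,
      (∀ u ∈ ({u₁, u₂, u₃} : Set ℂ), ∀ z ∈ segment ℝ p u, z = polar p ‖z - p‖ (ang u)) ∧
      (∀ u ∈ ({u₁, u₂, u₃} : Set ℂ), ∀ ρ, 0 < ρ → ρ < r → polar p ρ (ang u) ∈ segment ℝ p u) ∧
      ∃ v₂ v₃, (v₂ = u₂ ∧ v₃ = u₃ ∨ v₂ = u₃ ∧ v₃ = u₂) ∧ ang v₂ < ang v₃ ∧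
        IsTripod S p r (ang u₁) (ang v₂) (ang v₃) := by
  obtain ⟨r, hr, ang, hIco, hinj, hpol, hseg, hS⟩ := h.exists_angles (mem_insert u₁ _)
  have hu₁ : u₁ ∈ ({u₁, u₂, u₃} : Set ℂ) := by simp
  have hu₂ : u₂ ∈ ({u₁, u₂, u₃} : Set ℂ) := by simp
  have hu₃ : u₃ ∈ ({u₁, u₂, u₃} : Set ℂ) := by simp
  have l12 : ang u₁ < ang u₂ :=
    lt_of_le_of_ne (hIco u₂ hu₂).1 fun he => h12 (hinj u₁ hu₁ u₂ hu₂ he)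
  have l13 : ang u₁ < ang u₃ :=
    lt_of_le_of_ne (hIco u₃ hu₃).1 fun he => h13 (hinj u₁ hu₁ u₃ hu₃ he)
  refine ⟨r, hr, ang, hpol, hseg, ?_⟩
  rcases lt_trichotomy (ang u₂) (ang u₃) with hlt | heq | hlt
  · exact ⟨u₂, u₃, Or.inl ⟨rfl, rfl⟩, hlt, hr, l12, hlt.le, (hIco u₃ hu₃).2,
      fun ρ θ h1 h2 h3 => by rw [hS ρ θ h1 h2 h3]; simp⟩
  · exact absurd (hinj u₂ hu₂ u₃ hu₃ heq) h23
  · refine ⟨u₃, u₂, Or.inr ⟨rfl, rfl⟩, hlt, hr, l13, hlt.le, (hIco u₂ hu₂).2,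
      fun ρ θ h1 h2 h3 => ?_⟩
    rw [hS ρ θ h1 h2 h3]
    simp only [mem_insert_iff, mem_singleton_iff, exists_eq_or_imp, exists_eq_left]
    tauto

/-- Whichever sector belongs to `F`, it is bordered by `u₁` or by the next segment in angular order.
-/
theorem IsStar.exists_abuts (h : IsStar S p {u₁, u₂, u₃}) (h12 : u₁ ≠ u₂) (h13 : u₁ ≠ u₃)
    (h23 : u₂ ≠ u₃) (hF : IsComponent S F) (hpS : p ∈ S) (hp : p ∈ closure F) :
    Abuts F p u₁ ∨ Abuts F p u₂ ∨ Abuts F p u₃ := by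
  obtain ⟨r, hr, ang, hpol, -, v₂, v₃, hv, hlt, ht⟩ := h.exists_tripod h12 h13 h23
  have hv₂ : v₂ ∈ ({u₁, u₂, u₃} : Set ℂ) := by rcases hv with hv | hv <;> simp [hv.1]
  have key : Abuts F p u₁ ∨ Abuts F p v₂ := by
    rcases ht.exists_sector_subset hF hpS hp with hs | ⟨-, hs⟩ | hs
    · exact Or.inl (abuts_of_polar hr hp (hpol u₁ (by simp)) fun ρ h1 h2 => closure_mono hs
        (polar_mem_closure_sector h1 h2 ht.lt₁₂ ⟨le_rfl, ht.lt₁₂.le⟩))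
    · exact Or.inr (abuts_of_polar hr hp (hpol v₂ hv₂) fun ρ h1 h2 => closure_mono hs
        (polar_mem_closure_sector h1 h2 hlt ⟨le_rfl, hlt.le⟩))
    · refine Or.inl (abuts_of_polar hr hp (hpol u₁ (by simp)) fun ρ h1 h2 => ?_)
      rw [← polar_add_two_pi]
      exact closure_mono hs (polar_mem_closure_sector h1 h2 ht.lt₃₁ ⟨ht.lt₃₁.le, le_rfl⟩)
  rcases key with key | key
  · exact Or.inl key
  · rcases hv with ⟨rfl, -⟩ | ⟨rfl, -⟩
    · exact Or.inr (Or.inl key)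
    · exact Or.inr (Or.inr key)

theorem IsStar.exists_twoSided (h : IsStar S p {u₁, u₂, u₃}) (h12 : u₁ ≠ u₂) (h13 : u₁ ≠ u₃)
    (h23 : u₂ ≠ u₃) (hF : IsComponent S F) (h₁ : Abuts F p u₁) (h₂ : Abuts F p u₂)
    (h₃ : Abuts F p u₃) : TwoSided S F p u₁ ∨ TwoSided S F p u₂ ∨ TwoSided S F p u₃ := by
  obtain ⟨r, hr, ang, hpol, hseg, v₂, v₃, hv, hlt, ht⟩ := h.exists_tripod h12 h13 h23
  have e₁ := h₁.exists_polar hr (hseg u₁ (by simp))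
  have e₂ := h₂.exists_polar hr (hseg u₂ (by simp))
  have e₃ := h₃.exists_polar hr (hseg u₃ (by simp))
  obtain ⟨α, hα, htwo⟩ : ∃ α, (α = ang u₁ ∨ α = ang u₂ ∨ α = ang u₃) ∧ ∀ ρ, 0 < ρ → ρ < r →
      ∀ᶠ z in 𝓝 (polar p ρ α), z ∉ S → z ∈ F := by
    rcases hv with ⟨rfl, rfl⟩ | ⟨rfl, rfl⟩
    · exact ht.exists_two_sided hlt hF e₁ e₂ e₃
    · obtain ⟨α, hα, htwo⟩ := ht.exists_two_sided hlt hF e₁ e₃ e₂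
      exact ⟨α, by tauto, htwo⟩
  have key : ∀ u ∈ ({u₁, u₂, u₃} : Set ℂ), α = ang u → TwoSided S F p u := by
    rintro u hu rfl
    filter_upwards [Metric.ball_mem_nhds p hr] with m hm hmu hmp
    rw [hpol u hu m hmu]
    refine htwo _ (norm_pos_iff.2 (sub_ne_zero.2 hmp)) ?_
    rwa [← dist_eq_norm]
  rcases hα with hα | hα | hα
  · exact Or.inl (key u₁ (by simp) hα)
  · exact Or.inr (Or.inl (key u₂ (by simp) hα))
  · exact Or.inr (Or.inr (key u₃ (by simp) hα))

end PlaneTopology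

/-! ### Drawings with straight edges, and propagation of a face along an edge. -/

namespace PlaneTopology

open Set Filter Topology

/-- The union of the edges of a graph drawn with straight edges on points of the plane. -/
def drawing (Γ : SimpleGraph ℂ) : Set ℂ := {z | ∃ p q, Γ.Adj p q ∧ z ∈ segment ℝ p q}

/-- A finite graph on points of the plane whose edges, drawn as segments, meet only in common
ends. -/
structure IsStraight (Γ : SimpleGraph ℂ) : Prop where
  finite : Γ.edgeSet.Finite
  inter : ∀ p q p' q', Γ.Adj p q → Γ.Adj p' q' → s(p, q) ≠ s(p', q') →
    ∀ z ∈ segment ℝ p q, z ∈ segment ℝ p' q' → (z = p ∨ z = q) ∧ (z = p' ∨ z = q')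

section Straight

variable {Γ : SimpleGraph ℂ}

/-- The segment spanned by an unordered pair of points. -/
def sym2Segment : Sym2 ℂ → Set ℂ :=
  Sym2.lift ⟨fun p q => segment ℝ p q, fun _ _ => segment_symm ℝ _ _⟩

theorem isClosed_segment (p q : ℂ) : IsClosed (segment ℝ p q) := by
  rw [segment_eq_image']
  exact (isCompact_Icc.image (by fun_prop)).isClosed

/-- Finitely many closed segments: those missing `z₀` miss a whole neighbourhood of it. -/
theorem IsStraight.eventually_mem_segment (h : IsStraight Γ) (z₀ : ℂ) :
    ∀ᶠ z in 𝓝 z₀, ∀ p q, Γ.Adj p q → z ∈ segment ℝ p q → z₀ ∈ segment ℝ p q := by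
  have h1 : ∀ᶠ z in 𝓝 z₀, ∀ e ∈ Γ.edgeSet, z ∈ sym2Segment e → z₀ ∈ sym2Segment e := by
    rw [h.finite.eventually_all]
    intro e _
    have hc : IsClosed (sym2Segment e) := by
      induction e with
      | _ p q => exact isClosed_segment p q
    by_cases hz : z₀ ∈ sym2Segment e
    · exact Eventually.of_forall fun _ _ => hz
    · filter_upwards [hc.isOpen_compl.mem_nhds hz] with z hz' hz''
      exact absurd hz'' hz'
  filter_upwards [h1] with z hz p q hpq
  exact hz s(p, q) hpq

theorem IsStraight.isStar_neighborSet (h : IsStraight Γ) {p u₀ : ℂ} (hu₀ : Γ.Adj p u₀) :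
    IsStar (drawing Γ) p (Γ.neighborSet p) where
  finite := by
    refine Finite.of_injOn (f := fun u => s(p, u)) (t := Γ.edgeSet) (fun u hu => hu) ?_ h.finite
    intro u _ u' _ he
    exact Sym2.congr_right.1 he
  ne u hu := (Γ.ne_of_adj hu).symm
  inter u hu u' hu' hne z hz hz' := by
    obtain ⟨h1, h2⟩ := h.inter p u p u' hu hu' (fun he => hne (Sym2.congr_right.1 he)) z hz hz'
    rcases h1 with h1 | rfl
    · exact h1
    · rcases h2 with h2 | h2
      · exact h2
      · exact absurd h2 hne
  eventually_mem := by
    filter_upwards [h.eventually_mem_segment p] with z hz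
    constructor
    · rintro ⟨a, b, hab, hzab⟩
      have hp := hz a b hab hzab
      have hpab : p = a ∨ p = b := by
        by_cases he : s(a, b) = s(p, u₀)
        · have : p ∈ s(a, b) := he ▸ Sym2.mem_mk_left p u₀
          simpa using this
        · exact (h.inter a b p u₀ hab hu₀ he p hp (left_mem_segment ℝ p u₀)).1
      rcases hpab with rfl | rfl
      · exact ⟨b, hab, hzab⟩
      · exact ⟨a, hab.symm, segment_symm ℝ a p ▸ hzab⟩
    · rintro ⟨u, hu, hzu⟩
      exact ⟨p, u, hu, hzu⟩

theorem eq_of_mem_segments {u v p z : ℂ} (hp : p ∈ segment ℝ u v) (hpu : p ≠ u) (hpv : p ≠ v)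
    (h1 : z ∈ segment ℝ p u) (h2 : z ∈ segment ℝ p v) : z = p := by
  rw [segment_eq_image'] at hp h1 h2
  obtain ⟨s, ⟨hs0, hs1⟩, rfl⟩ := hp
  obtain ⟨a, ⟨ha0, ha1⟩, rfl⟩ := h1
  obtain ⟨b, ⟨hb0, hb1⟩, hb⟩ := h2
  have hs0' : 0 < s := lt_of_le_of_ne hs0 (by rintro rfl; simp at hpu)
  have hs1' : s < 1 := lt_of_le_of_ne hs1 (by rintro rfl; simp at hpv)
  have huv : v - u ≠ 0 := by
    intro h0
    simp [h0] at hpu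
  have h3 : ((b * (1 - s) + a * s : ℝ) : ℂ) * (v - u) = 0 := by
    simp only [Complex.real_smul] at hb
    push_cast
    linear_combination hb
  have h4 : b * (1 - s) + a * s = 0 := by
    rcases mul_eq_zero.1 h3 with h5 | h5
    · exact_mod_cast h5
    · exact absurd h5 huv
  have h5 : a * s = 0 := by nlinarith [mul_nonneg hb0 (by linarith : 0 ≤ 1 - s), mul_nonneg ha0 hs0]
  have h6 : a = 0 := (mul_eq_zero.1 h5).resolve_right hs0'.ne'
  simp [h6]

theorem mem_segment_iff_of_mem {u v p z : ℂ} (hp : p ∈ segment ℝ u v) :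
    z ∈ segment ℝ u v ↔ z ∈ segment ℝ p u ∨ z ∈ segment ℝ p v := by
  constructor
  · intro hz
    rw [segment_eq_image'] at hp hz
    obtain ⟨s, ⟨hs0, hs1⟩, rfl⟩ := hp
    obtain ⟨t, ⟨ht0, ht1⟩, rfl⟩ := hz
    rcases le_total t s with hts | hts
    · left
      rcases hs0.eq_or_lt with rfl | hs0
      · obtain rfl : t = 0 := le_antisymm hts ht0
        exact left_mem_segment ℝ _ _
      · rw [segment_symm, segment_eq_image']
        refine ⟨t / s, ⟨by positivity, (div_le_one hs0).2 hts⟩, ?_⟩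
        have : (s : ℂ) ≠ 0 := by exact_mod_cast hs0.ne'
        simp only [Complex.real_smul]
        push_cast
        field_simp
        ring
    · right
      rcases hs1.eq_or_lt with rfl | hs1
      · obtain rfl : t = 1 := le_antisymm ht1 hts
        exact left_mem_segment ℝ _ _
      · rw [segment_eq_image']
        refine ⟨(t - s) / (1 - s), ⟨div_nonneg (by linarith) (by linarith),
          (div_le_one (by linarith)).2 (by linarith)⟩, ?_⟩
        have : (1 - s : ℂ) ≠ 0 := by
          have h0 : (1 - s : ℝ) ≠ 0 := by linarith
          exact_mod_cast h0
        simp only [Complex.real_smul]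
        push_cast
        field_simp
        ring
  · rintro (hz | hz)
    · exact (convex_segment u v).segment_subset hp (left_mem_segment ℝ u v) hz
    · exact (convex_segment u v).segment_subset hp (right_mem_segment ℝ u v) hz

/-- At an inner point of an edge the drawing is a star with two rays, so `IsStar.abuts_pair` applies
there too. -/
theorem IsStraight.isStar_inner (h : IsStraight Γ) {p u v : ℂ} (huv : Γ.Adj u v)
    (hp : p ∈ segment ℝ u v) (hpu : p ≠ u) (hpv : p ≠ v) : IsStar (drawing Γ) p {u, v} where
  finite := by simp
  ne := by
    rintro x (rfl | rfl)
    exacts [hpu.symm, hpv.symm]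
  inter := by
    rintro x (rfl | rfl) y (rfl | rfl) hne z hz hz'
    · exact absurd rfl hne
    · exact eq_of_mem_segments hp hpu hpv hz hz'
    · exact eq_of_mem_segments hp hpu hpv hz' hz
    · exact absurd rfl hne
  eventually_mem := by
    filter_upwards [h.eventually_mem_segment p] with z hz
    have e : (∃ x ∈ ({u, v} : Set ℂ), z ∈ segment ℝ p x) ↔ z ∈ segment ℝ u v := by
      rw [mem_segment_iff_of_mem hp]
      simp
    rw [e]
    constructor
    · rintro ⟨a, b, hab, hzab⟩
      by_cases he : s(u, v) = s(a, b)
      · rcases Sym2.eq_iff.1 he with ⟨rfl, rfl⟩ | ⟨rfl, rfl⟩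
        · exact hzab
        · rwa [segment_symm]
      · rcases (h.inter u v a b huv hab he p hp (hz a b hab hzab)).1 with h1 | h1
        · exact absurd h1 hpu
        · exact absurd h1 hpv
    · exact fun hz => ⟨u, v, huv, hz⟩

variable {F : Set ℂ}

theorem mem_drawing_of_adj {p u : ℂ} (h : Γ.Adj p u) : p ∈ drawing Γ :=
  ⟨p, u, h, left_mem_segment ℝ p u⟩

/-- A continuity argument on the parameter interval: being in the closure of `F` is a closed
condition, and at each point reached the local two-ray picture carries it a bit further. -/
theorem IsStraight.mem_closure_of_abuts (h : IsStraight Γ) (hF : IsComponent (drawing Γ) F)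
    {u v : ℂ} (huv : Γ.Adj u v) (hab : Abuts F u v) :
    ∀ z ∈ segment ℝ u v, z ∈ closure F := by
  set γ : ℝ → ℂ := fun t => u + t • (v - u) with hγ
  have hγc : Continuous γ := by fun_prop
  have hne := Γ.ne_of_adj huv
  have hmem : ∀ t ∈ Icc (0 : ℝ) 1, γ t ∈ segment ℝ u v := by
    intro t ht
    rw [segment_eq_image']
    exact ⟨t, ht, rfl⟩
  have step : ∀ x ∈ Ico (0 : ℝ) 1, γ x ∈ closure F → Abuts F (γ x) v := by
    intro x hx hxF
    rcases hx.1.eq_or_lt with rfl | hx0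
    · simpa [hγ] using hab
    · refine ((h.isStar_inner huv (hmem x ⟨hx.1, hx.2.le⟩) ?_ ?_).abuts_pair hne hF
        ⟨u, v, huv, hmem x ⟨hx.1, hx.2.le⟩⟩ hxF).2
      · intro he
        have h0 : x • (v - u) = 0 := by simpa [hγ] using he
        rcases smul_eq_zero.1 h0 with h1 | h1
        · exact hx0.ne' h1
        · exact hne (sub_eq_zero.1 h1).symm
      · intro he
        have h0 : (1 - x) • (v - u) = 0 := by
          rw [sub_smul, one_smul, sub_eq_zero, ← sub_eq_iff_eq_add'.2 he.symm]
        rcases smul_eq_zero.1 h0 with h1 | h1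
        · linarith [hx.2]
        · exact hne (sub_eq_zero.1 h1).symm
  have hsub : Icc (0 : ℝ) 1 ⊆ γ ⁻¹' closure F := by
    refine IsClosed.Icc_subset_of_forall_exists_gt ?_ ?_ ?_
    · exact (isClosed_closure.preimage hγc).inter isClosed_Icc
    · have := hab.self_of_nhds (left_mem_segment ℝ u v)
      simpa [hγ] using this
    · rintro x ⟨hxF, hx⟩ y hy
      have h1 : ∀ᶠ t in 𝓝[>] x, γ t ∈ segment ℝ (γ x) v → γ t ∈ closure F :=
        (hγc.tendsto x).mono_left nhdsWithin_le_nhds |>.eventually (step x hx hxF)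
      have h2 : ∀ᶠ t in 𝓝[>] x, t ∈ Ioc x (min y 1) :=
        Ioc_mem_nhdsGT (lt_min hy hx.2)
      obtain ⟨t, ht1, ht2⟩ := (h1.and h2).exists
      refine ⟨t, ht1 ?_, ht2.1, ht2.2.trans (min_le_left _ _)⟩
      have ht3 : t ≤ 1 := ht2.2.trans (min_le_right _ _)
      have h1x : 0 < 1 - x := by linarith [hx.2]
      rw [segment_eq_image']
      refine ⟨(t - x) / (1 - x), ⟨div_nonneg (by linarith [ht2.1]) h1x.le,
        (div_le_one h1x).2 (by linarith)⟩, ?_⟩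
      have : (1 - x : ℂ) ≠ 0 := by exact_mod_cast h1x.ne'
      simp only [hγ, Complex.real_smul]
      push_cast
      field_simp
      ring
  intro z hz
  rw [segment_eq_image'] at hz
  obtain ⟨t, ht, rfl⟩ := hz
  exact hsub ht

theorem IsStraight.abuts_symm (h : IsStraight Γ) (hF : IsComponent (drawing Γ) F)
    {u v : ℂ} (huv : Γ.Adj u v) (hab : Abuts F u v) : Abuts F v u :=
  Eventually.of_forall fun z hz => h.mem_closure_of_abuts hF huv hab z (segment_symm ℝ u v ▸ hz)

theorem IsStraight.abuts_of_neighborSet_eq_pair (h : IsStraight Γ) (hF : IsComponent (drawing Γ) F)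
    {p u v : ℂ} (hne : u ≠ v) (hN : Γ.neighborSet p = {u, v}) (hp : p ∈ closure F) :
    Abuts F p u ∧ Abuts F p v := by
  have hu : Γ.Adj p u := by rw [← SimpleGraph.mem_neighborSet, hN]; simp
  have hs := h.isStar_neighborSet hu
  rw [hN] at hs
  exact hs.abuts_pair hne hF (mem_drawing_of_adj hu) hp

end Straight

end PlaneTopology

namespace PlaneTopology

open Set Filter Topology Complex

/-! ### Winding of a closed polygon -/

/-- The quotient is a nonpositive real only if `p` and `q` lie in opposite directions from `z`, or
`z = q`; in either case `z` is on the segment. So off the segment its argument varies continuously.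
-/
theorem div_mem_slitPlane {p q z : ℂ} (hz : z ∉ segment ℝ p q) : (q - z) / (p - z) ∈ slitPlane := by
  have hzp : p - z ≠ 0 := by
    intro h0
    rw [sub_eq_zero.1 h0] at hz
    exact hz (left_mem_segment ℝ z q)
  rw [mem_slitPlane_iff]
  by_contra! hcon
  obtain ⟨hre, him⟩ := hcon
  set x := -((q - z) / (p - z)).re with hx
  have hx0 : 0 ≤ x := by linarith
  have h1 : (q - z) / (p - z) = ((-x : ℝ) : ℂ) := by
    apply Complex.ext
    · simp [hx]
    · simpa using him
  rw [div_eq_iff hzp] at h1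
  have h2 : ((1 + x : ℝ) : ℂ) ≠ 0 := by
    have : (1 + x : ℝ) ≠ 0 := by positivity
    exact_mod_cast this
  refine hz ⟨x / (1 + x), 1 / (1 + x), by positivity, by positivity, ?_, ?_⟩
  · field_simp
    ring
  · simp only [real_smul]
    push_cast at h1 h2 ⊢
    field_simp
    linear_combination h1

theorem continuousAt_arg_div {p q z : ℂ} (hz : z ∉ segment ℝ p q) :
    ContinuousAt (fun z => arg ((q - z) / (p - z))) z := by
  have hzp : p - z ≠ 0 := by
    intro h0
    rw [sub_eq_zero.1 h0] at hz
    exact hz (left_mem_segment ℝ z q)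
  refine ContinuousAt.comp (g := arg) (f := fun z => (q - z) / (p - z))
    (continuousAt_arg (div_mem_slitPlane hz)) ?_
  exact ContinuousAt.div (by fun_prop) (by fun_prop) hzp

theorem exists_eq_mul_exp_arg {p q z : ℂ} (hz : z ∉ segment ℝ p q) :
    ∃ c : ℝ, 0 < c ∧ q - z = c * exp (arg ((q - z) / (p - z)) * I) * (p - z) := by
  have hzp : p - z ≠ 0 := by
    intro h0
    rw [sub_eq_zero.1 h0] at hz
    exact hz (left_mem_segment ℝ z q)
  refine ⟨‖(q - z) / (p - z)‖, norm_pos_iff.2 (slitPlane_ne_zero (div_mem_slitPlane hz)), ?_⟩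
  rw [norm_mul_exp_arg_mul_I, div_mul_cancel₀ _ hzp]

/-- From far away a fixed segment is seen under a small angle. -/
theorem tendsto_arg_div_cobounded (p q : ℂ) :
    Tendsto (fun z => arg ((q - z) / (p - z))) (Bornology.cobounded ℂ) (𝓝 0) := by
  have h1 : Tendsto (fun z : ℂ => 1 + (q - p) * (p - z)⁻¹) (Bornology.cobounded ℂ) (𝓝 1) := by
    have h2 : Tendsto (fun z : ℂ => p - z) (Bornology.cobounded ℂ) (Bornology.cobounded ℂ) := by
      rw [← tendsto_norm_atTop_iff_cobounded]
      have h3 : Tendsto (fun z : ℂ => ‖z‖ - ‖p‖) (Bornology.cobounded ℂ) atTop :=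
        tendsto_atTop_add_const_right _ _ tendsto_norm_cobounded_atTop
      refine tendsto_atTop_mono (fun z => ?_) h3
      rw [norm_sub_rev]
      exact norm_sub_norm_le z p
    have h4 := (tendsto_inv₀_cobounded.comp h2).const_mul (q - p)
    simpa using h4.const_add 1
  have h5 : Tendsto (fun z => arg (1 + (q - p) * (p - z)⁻¹)) (Bornology.cobounded ℂ) (𝓝 0) := by
    have := (continuousAt_arg (x := 1) (by simp)).tendsto.comp h1
    rwa [arg_one] at this
  refine h5.congr' ?_
  have h6 : ∀ᶠ z : ℂ in Bornology.cobounded ℂ, z ≠ p := by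
    have : Bornology.IsBounded ({p} : Set ℂ) := Bornology.isBounded_singleton
    exact this
  filter_upwards [h6] with z hz
  have : p - z ≠ 0 := sub_ne_zero.2 hz.symm
  congr 1
  field_simp
  ring

/-- A continuous choice of the angle under which a path of a plane graph is seen. -/
theorem exists_angle_of_reachable {Γ : SimpleGraph ℂ} {p q : ℂ} (h : Γ.Reachable p q) :
    ∃ g : ℂ → ℝ, (∀ z, z ∉ drawing Γ → ContinuousAt g z) ∧
      (∀ z, z ∉ drawing Γ → ∃ c : ℝ, 0 < c ∧ q - z = c * exp (g z * I) * (p - z)) ∧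
      Tendsto g (Bornology.cobounded ℂ) (𝓝 0) := by
  obtain ⟨w⟩ := h
  induction w with
  | nil => exact ⟨fun _ => 0, fun _ _ => continuousAt_const, fun _ _ => ⟨1, by simp, by simp⟩,
      tendsto_const_nhds⟩
  | @cons a b c hab _ ih =>
    obtain ⟨g, hc, he, ht⟩ := ih
    have hseg : ∀ z, z ∉ drawing Γ → z ∉ segment ℝ a b := fun z hz hz' => hz ⟨a, b, hab, hz'⟩
    -- The angles of the successive segments add up.
    refine ⟨fun z => g z + arg ((b - z) / (a - z)),
      fun z hz => (hc z hz).add (continuousAt_arg_div (hseg z hz)), fun z hz => ?_, ?_⟩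
    · obtain ⟨r, hr, h1⟩ := he z hz
      obtain ⟨s, hs, h2⟩ := exists_eq_mul_exp_arg (hseg z hz)
      refine ⟨r * s, mul_pos hr hs, ?_⟩
      rw [h1]
      conv_lhs => rw [h2]
      push_cast
      rw [add_mul, exp_add]
      ring
    · simpa using ht.add (tendsto_arg_div_cobounded a b)

theorem exists_int_of_exp_eq {c c' x y : ℝ} {w w' : ℂ} (hc : 0 < c) (hc' : 0 < c') (hw : w ≠ 0)
    (h1 : w' = c * exp (x * I) * w) (h2 : w' = c' * exp (y * I) * w) :
    ∃ n : ℤ, x = y + n * (2 * Real.pi) := by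
  have h3 : (c : ℂ) * exp (x * I) = c' * exp (y * I) := mul_right_cancel₀ hw (h1.symm.trans h2)
  have h4 : c = c' := by
    have := congrArg norm h3
    simpa [norm_exp_ofReal_mul_I, abs_of_pos hc, abs_of_pos hc'] using this
  subst h4
  have h5 : exp (x * I) = exp (y * I) :=
    mul_left_cancel₀ (by exact_mod_cast hc.ne') h3
  obtain ⟨n, hn⟩ := exp_eq_exp_iff_exists_int.1 h5
  refine ⟨n, ?_⟩
  have := congrArg im hn
  simpa using this

/-- Here `D` is an angle around a closed polygon, hence `2π` times an integer. It is 0 somewhere far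
out in `F`, and any other value would by connectedness force a value of modulus `π`. -/
theorem eq_zero_of_isPreconnected {F : Set ℂ} (hF : IsPreconnected F)
    (hunb : ¬ Bornology.IsBounded F) {D : ℂ → ℝ} (hc : ContinuousOn D F)
    (hint : ∀ z ∈ F, ∃ n : ℤ, D z = n * (2 * Real.pi))
    (ht : Tendsto D (Bornology.cobounded ℂ) (𝓝 0)) : ∀ z ∈ F, D z = 0 := by
  have hpi := Real.two_pi_pos
  have h1 : ∀ᶠ z in Bornology.cobounded ℂ, |D z| < 2 * Real.pi := by
    have := ht.abs
    rw [abs_zero] at this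
    exact this.eventually (gt_mem_nhds hpi)
  obtain ⟨z₀, hz₀F, hz₀⟩ : ∃ z₀ ∈ F, |D z₀| < 2 * Real.pi := by
    by_contra! hcon
    refine hunb ?_
    rw [← Bornology.isCobounded_compl_iff]
    filter_upwards [h1] with z hz hzF
    exact absurd hz (not_lt.2 (hcon z hzF))
  have small : ∀ z ∈ F, |D z| < 2 * Real.pi → D z = 0 := by
    intro z hz hlt
    obtain ⟨n, hn⟩ := hint z hz
    rw [hn, abs_mul, abs_of_pos hpi] at hlt
    have h2 : |(n : ℝ)| < 1 := by
      by_contra! h3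
      nlinarith
    have h3 : |n| < 1 := by exact_mod_cast h2
    rw [hn, Int.abs_lt_one_iff.1 h3]
    simp
  have hD₀ := small z₀ hz₀F hz₀
  have hord := (hF.image D hc).ordConnected
  intro z hz
  by_contra hne
  have hmem : ∃ y ∈ D '' F, |y| = Real.pi := by
    have h2 : 2 * Real.pi ≤ |D z| := by
      by_contra! h3
      exact hne (small z hz h3)
    rcases le_abs'.1 h2 with h3 | h3
    · exact ⟨-Real.pi, hord.out ⟨z, hz, rfl⟩ ⟨z₀, hz₀F, rfl⟩
        ⟨by linarith, by rw [hD₀]; linarith⟩, by rw [abs_neg, abs_of_pos Real.pi_pos]⟩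
    · exact ⟨Real.pi, hord.out ⟨z₀, hz₀F, rfl⟩ ⟨z, hz, rfl⟩
        ⟨by rw [hD₀]; linarith, by linarith⟩, abs_of_pos Real.pi_pos⟩
  obtain ⟨_, ⟨y, hy, rfl⟩, hy'⟩ := hmem
  have := small y hy (by rw [hy']; linarith [Real.pi_pos])
  rw [this, abs_zero] at hy'
  exact Real.pi_pos.ne hy'

/-- The condition on `ε` puts both points inside the circle with diameter from `a` to `a + d`, so
the segment is seen under an angle beyond `π / 2`, with opposite signs on its two sides. -/
theorem arg_jump {a d : ℂ} (hd : d ≠ 0) {s ε : ℝ} (hs0 : 0 < s) (hε : 0 < ε)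
    (hε' : ε ^ 2 < s * (1 - s)) :
    Real.pi < arg ((a + d - (a + s * d + ε * I * d)) / (a - (a + s * d + ε * I * d))) -
      arg ((a + d - (a + s * d - ε * I * d)) / (a - (a + s * d - ε * I * d))) := by
  have hpos : 0 < s ^ 2 + ε ^ 2 := by positivity
  have hc : ((s ^ 2 + ε ^ 2 : ℝ) : ℂ) ≠ 0 := by exact_mod_cast hpos.ne'
  have e1 : (a + d - (a + s * d + ε * I * d)) / (a - (a + s * d + ε * I * d)) =
      ((s ^ 2 + ε ^ 2)⁻¹ : ℝ) * (((ε ^ 2 - s * (1 - s) : ℝ) : ℂ) + (ε : ℝ) * I) := by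
    have h0 : (s : ℂ) + ε * I ≠ 0 := by
      intro h
      have := congrArg re h
      simp at this
      exact hs0.ne' this
    have h1 : a - (a + s * d + ε * I * d) ≠ 0 := by
      have : a - (a + s * d + ε * I * d) = -((s + ε * I) * d) := by ring
      rw [this]
      exact neg_ne_zero.2 (mul_ne_zero h0 hd)
    rw [div_eq_iff h1]
    push_cast at hc ⊢
    field_simp
    ring_nf
    simp only [I_sq]
    ring
  have e2 : (a + d - (a + s * d - ε * I * d)) / (a - (a + s * d - ε * I * d)) =
      ((s ^ 2 + ε ^ 2)⁻¹ : ℝ) * (((ε ^ 2 - s * (1 - s) : ℝ) : ℂ) - (ε : ℝ) * I) := by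
    have h0 : (s : ℂ) - ε * I ≠ 0 := by
      intro h
      have := congrArg re h
      simp at this
      exact hs0.ne' this
    have h1 : a - (a + s * d - ε * I * d) ≠ 0 := by
      have : a - (a + s * d - ε * I * d) = -((s - ε * I) * d) := by ring
      rw [this]
      exact neg_ne_zero.2 (mul_ne_zero h0 hd)
    rw [div_eq_iff h1]
    push_cast at hc ⊢
    field_simp
    ring_nf
    simp only [I_sq]
    ring
  rw [e1, e2, arg_real_mul _ (inv_pos.2 hpos), arg_real_mul _ (inv_pos.2 hpos)]
  have k1 : Real.pi / 2 < arg (((ε ^ 2 - s * (1 - s) : ℝ) : ℂ) + (ε : ℝ) * I) := by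
    have h1 : 0 ≤ arg (((ε ^ 2 - s * (1 - s) : ℝ) : ℂ) + (ε : ℝ) * I) := by
      rw [arg_nonneg_iff]
      simp only [add_im, ofReal_im, mul_im, ofReal_re, I_im, I_re]
      linarith
    have h2 : ¬ |arg (((ε ^ 2 - s * (1 - s) : ℝ) : ℂ) + (ε : ℝ) * I)| ≤ Real.pi / 2 := by
      rw [abs_arg_le_pi_div_two_iff]
      simp only [add_re, ofReal_im, mul_re, ofReal_re, I_im, I_re]
      linarith
    rw [abs_of_nonneg h1] at h2
    exact not_le.1 h2
  have k2 : arg (((ε ^ 2 - s * (1 - s) : ℝ) : ℂ) - (ε : ℝ) * I) < -(Real.pi / 2) := by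
    have h1 : arg (((ε ^ 2 - s * (1 - s) : ℝ) : ℂ) - (ε : ℝ) * I) < 0 := by
      rw [arg_neg_iff]
      simp only [sub_im, ofReal_im, mul_im, ofReal_re, I_im, I_re]
      linarith
    have h2 : ¬ |arg (((ε ^ 2 - s * (1 - s) : ℝ) : ℂ) - (ε : ℝ) * I)| ≤ Real.pi / 2 := by
      rw [abs_arg_le_pi_div_two_iff]
      simp only [sub_re, ofReal_im, mul_re, ofReal_re, I_im, I_re]
      linarith
    rw [abs_of_neg h1] at h2
    linarith [not_le.1 h2]
  linarith

theorem add_mul_I_notMem_segment {a d : ℂ} (hd : d ≠ 0) {s ε : ℝ} (hε : ε ≠ 0) :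
    a + s * d + ε * I * d ∉ segment ℝ a (a + d) := by
  intro h
  rw [segment_eq_image'] at h
  obtain ⟨t, -, ht⟩ := h
  have h1 : ((s - t : ℝ) + (ε : ℝ) * I : ℂ) * d = 0 := by
    simp only [real_smul] at ht
    push_cast
    linear_combination -ht
  have h2 := congrArg im ((mul_eq_zero.1 h1).resolve_right hd)
  simp at h2
  exact hε h2

/-- The edge together with a path avoiding it closes up. The total angle vanishes on the unbounded
component. Across the edge, however, only the angle of the edge jumps, while that of the path stays
continuous; so the two sides cannot both lie in `F`. -/
theorem IsStraight.not_twoSided {Γ : SimpleGraph ℂ} (h : IsStraight Γ) {F : Set ℂ}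
    (hF : IsComponent (drawing Γ) F) (hunb : ¬ Bornology.IsBounded F) {a u : ℂ} (hau : Γ.Adj a u)
    (hreach : (Γ.deleteEdges {s(a, u)}).Reachable a u) : ¬ TwoSided (drawing Γ) F a u := by
  intro htwo
  obtain ⟨g, hgc, hge, hgt⟩ := exists_angle_of_reachable hreach
  have hsub : ∀ z, z ∉ drawing Γ → z ∉ drawing (Γ.deleteEdges {s(a, u)}) := by
    rintro z hz ⟨p, q, hpq, hzpq⟩
    exact hz ⟨p, q, (SimpleGraph.deleteEdges_adj.1 hpq).1, hzpq⟩
  have hseg : ∀ z, z ∉ drawing Γ → z ∉ segment ℝ a u := fun z hz hz' => hz ⟨a, u, hau, hz'⟩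
  have hzero : ∀ z ∈ F, arg ((u - z) / (a - z)) - g z = 0 := by
    refine eq_zero_of_isPreconnected hF.preconnected hunb ?_ ?_ ?_
    · intro z hz
      exact ((continuousAt_arg_div (hseg z (hF.disjoint z hz))).sub
        (hgc z (hsub z (hF.disjoint z hz)))).continuousWithinAt
    · intro z hz
      have hzS := hF.disjoint z hz
      obtain ⟨c, hc, h1⟩ := exists_eq_mul_exp_arg (hseg z hzS)
      obtain ⟨c', hc', h2⟩ := hge z (hsub z hzS)
      have hne : a - z ≠ 0 := by
        intro h0
        rw [← sub_eq_zero.1 h0] at hzS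
        exact hzS (mem_drawing_of_adj hau)
      obtain ⟨n, hn⟩ := exists_int_of_exp_eq hc hc' hne h1 h2
      exact ⟨n, by linarith⟩
    · simpa using (tendsto_arg_div_cobounded a u).sub hgt
  obtain ⟨d, rfl⟩ : ∃ d, u = a + d := ⟨u - a, by ring⟩
  have hd : d ≠ 0 := by
    rintro rfl
    simp at hau
  obtain ⟨s, hs, hside⟩ : ∃ s : ℝ, (0 < s ∧ s < 1) ∧
      ∀ᶠ z in 𝓝 (a + s * d), z ∉ drawing Γ → z ∈ F := by
    have hc : Continuous fun s : ℝ => a + s * d := by fun_prop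
    have h1 : ∀ᶠ s : ℝ in 𝓝[>] 0, a + s * d ∈ segment ℝ a (a + d) → a + s * d ≠ a →
        ∀ᶠ z in 𝓝 (a + s * d), z ∉ drawing Γ → z ∈ F := by
      have h0 : Tendsto (fun s : ℝ => a + s * d) (𝓝[>] 0) (𝓝 a) := by
        simpa using (hc.tendsto 0).mono_left (nhdsWithin_le_nhds (s := Ioi 0))
      exact h0.eventually htwo
    have h2 : ∀ᶠ s : ℝ in 𝓝[>] 0, s ∈ Ioo 0 1 := Ioo_mem_nhdsGT one_pos
    obtain ⟨s, h3, h4⟩ := (h1.and h2).exists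
    refine ⟨s, h4, h3 ?_ ?_⟩
    · rw [segment_eq_image']
      exact ⟨s, ⟨h4.1.le, h4.2.le⟩, by simp⟩
    · simpa [hd] using h4.1.ne'
  set m := a + s * d with hm
  have hmseg : m ∈ segment ℝ a (a + d) := by
    rw [segment_eq_image']
    exact ⟨s, ⟨hs.1.le, hs.2.le⟩, by simp [hm]⟩
  have hma : m ≠ a := by simpa [hm, hd] using hs.1.ne'
  have hmu : m ≠ a + d := by
    intro h0
    have h1 : ((1 - s : ℝ) : ℂ) * d = 0 := by
      push_cast
      linear_combination -h0
    have h2 : ((1 - s : ℝ) : ℂ) ≠ 0 := by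
      have : (1 - s : ℝ) ≠ 0 := by linarith
      exact_mod_cast this
    exact (mul_ne_zero h2 hd) h1
  have hother : ∀ p q, Γ.Adj p q → m ∈ segment ℝ p q → s(a, a + d) = s(p, q) := by
    intro p q hpq hmpq
    by_contra hne
    rcases (h.inter _ _ p q hau hpq hne m hmseg hmpq).1 with h1 | h1
    · exact hma h1
    · exact hmu h1
  -- `m` lies on no segment other than the deleted one, so the path angle `g` is continuous at `m`.
  have hmS : m ∉ drawing (Γ.deleteEdges {s(a, a + d)}) := by
    rintro ⟨p, q, hpq, hmpq⟩
    rw [SimpleGraph.deleteEdges_adj] at hpq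
    exact hpq.2 (hother p q hpq.1 hmpq).symm
  have hgm : ∀ᶠ z in 𝓝 m, |g z - g m| < Real.pi / 2 := by
    have := ((hgc m hmS).sub (continuousAt_const (y := g m))).abs
    refine this.eventually (gt_mem_nhds ?_)
    simpa using Real.pi_div_two_pos
  have hnear : ∀ᶠ z in 𝓝 m, z ∉ segment ℝ a (a + d) → z ∉ drawing Γ := by
    filter_upwards [h.eventually_mem_segment m] with z hz hzseg
    rintro ⟨p, q, hpq, hzpq⟩
    rcases Sym2.eq_iff.1 (hother p q hpq (hz p q hpq hzpq)) with ⟨h1, h2⟩ | ⟨h1, h2⟩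
    · rw [← h1, ← h2] at hzpq
      exact hzseg hzpq
    · rw [← h1, ← h2, segment_symm] at hzpq
      exact hzseg hzpq
  have hgood := (hgm.and (hnear.and hside))
  have c1 : Tendsto (fun ε : ℝ => m + ε * I * d) (𝓝[>] 0) (𝓝 m) := by
    have hc : Continuous fun ε : ℝ => m + ε * I * d := by fun_prop
    simpa using (hc.tendsto 0).mono_left nhdsWithin_le_nhds
  have c2 : Tendsto (fun ε : ℝ => m - ε * I * d) (𝓝[>] 0) (𝓝 m) := by
    have hc : Continuous fun ε : ℝ => m - ε * I * d := by fun_prop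
    simpa using (hc.tendsto 0).mono_left nhdsWithin_le_nhds
  have c3 : ∀ᶠ ε : ℝ in 𝓝[>] 0, ε ^ 2 < s * (1 - s) := by
    have hc : Continuous fun ε : ℝ => ε ^ 2 := by fun_prop
    refine ((hc.tendsto 0).mono_left nhdsWithin_le_nhds).eventually (gt_mem_nhds ?_)
    simpa using mul_pos hs.1 (sub_pos.2 hs.2)
  obtain ⟨ε, ⟨⟨⟨hg1, hn1, hs1⟩, ⟨hg2, hn2, hs2⟩⟩, hε'⟩, hε⟩ :=
    (((c1.eventually hgood).and (c2.eventually hgood)).and c3 |>.and self_mem_nhdsWithin).exists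
  have hε : 0 < ε := hε
  have m1 : m + ε * I * d ∉ segment ℝ a (a + d) := add_mul_I_notMem_segment hd hε.ne'
  have m2 : m - ε * I * d ∉ segment ℝ a (a + d) := by
    have e : m - ε * I * d = a + s * d + (-ε : ℝ) * I * d := by
      rw [hm]
      push_cast
      ring
    rw [e]
    exact add_mul_I_notMem_segment hd (neg_ne_zero.2 hε.ne')
  have z1 := hzero _ (hs1 (hn1 m1))
  have z2 := hzero _ (hs2 (hn2 m2))
  -- The edge angle jumps by more than `π`; on `F` it equals `g`, which moves by less than `π / 2`
  -- on each side of `m`.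
  have hjump := arg_jump (a := a) hd hs.1 hε hε'
  have b1 := abs_lt.1 hg1
  have b2 := abs_lt.1 hg2
  linarith [b1.1, b1.2, b2.1, b2.2]

/-- A point with exactly three neighbours, none of whose edges is a bridge, cannot have all its edges
on the boundary of the unbounded component. -/
theorem IsStraight.not_abuts_three {Γ : SimpleGraph ℂ} (h : IsStraight Γ) {F : Set ℂ}
    (hF : IsComponent (drawing Γ) F) (hunb : ¬ Bornology.IsBounded F) {a u₁ u₂ u₃ : ℂ}
    (hN : Γ.neighborSet a = {u₁, u₂, u₃}) (h12 : u₁ ≠ u₂) (h13 : u₁ ≠ u₃) (h23 : u₂ ≠ u₃)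
    (hreach : ∀ u, Γ.Adj a u → (Γ.deleteEdges {s(a, u)}).Reachable a u)
    (h₁ : Abuts F a u₁) (h₂ : Abuts F a u₂) (h₃ : Abuts F a u₃) : False := by
  have a1 : Γ.Adj a u₁ := by rw [← SimpleGraph.mem_neighborSet, hN]; simp
  have a2 : Γ.Adj a u₂ := by rw [← SimpleGraph.mem_neighborSet, hN]; simp
  have a3 : Γ.Adj a u₃ := by rw [← SimpleGraph.mem_neighborSet, hN]; simp
  have hs := h.isStar_neighborSet a1
  rw [hN] at hs
  rcases hs.exists_twoSided h12 h13 h23 hF h₁ h₂ h₃ with h0 | h0 | h0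
  · exact h.not_twoSided hF hunb a1 (hreach _ a1) h0
  · exact h.not_twoSided hF hunb a2 (hreach _ a2) h0
  · exact h.not_twoSided hF hunb a3 (hreach _ a3) h0

end PlaneTopology

namespace PlaneTopology

open Set Filter Topology

/-! ### Polygonal lines -/

/-- The points `q 0 = a, …, q (n + 1) = b` span a polygonal line without self-intersections. -/
structure IsPolyline (n : ℕ) (q : ℕ → ℂ) (a b : ℂ) : Prop where
  start : q 0 = a
  finish : q (n + 1) = b
  ne_succ : ∀ i ≤ n, q i ≠ q (i + 1)
  inter_succ : ∀ i < n, ∀ z ∈ segment ℝ (q i) (q (i + 1)),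
    z ∈ segment ℝ (q (i + 1)) (q (i + 2)) → z = q (i + 1)
  disjoint : ∀ i j, i + 1 < j → j ≤ n → ∀ z ∈ segment ℝ (q i) (q (i + 1)),
    z ∉ segment ℝ (q j) (q (j + 1))

/-- The segments of a polygonal line. -/
def polylineEdges (n : ℕ) (q : ℕ → ℂ) : Set (Sym2 ℂ) := {x | ∃ i ≤ n, x = s(q i, q (i + 1))}

namespace IsPolyline

variable {n : ℕ} {q : ℕ → ℂ} {a b : ℂ}

theorem reverse (h : IsPolyline n q a b) : IsPolyline n (fun i => q (n + 1 - i)) b a where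
  start := by simpa using h.finish
  finish := by simpa using h.start
  ne_succ i hi := by
    have e : n + 1 - i = (n - i) + 1 := by omega
    have e' : n + 1 - (i + 1) = n - i := by omega
    simp only [e, e']
    exact (h.ne_succ (n - i) (by omega)).symm
  inter_succ i hi z hz hz' := by
    have e : n + 1 - i = (n - i - 1) + 2 := by omega
    have e' : n + 1 - (i + 1) = (n - i - 1) + 1 := by omega
    have e'' : n + 1 - (i + 2) = n - i - 1 := by omega
    simp only [e, e', e''] at hz hz' ⊢
    rw [segment_symm] at hz hz'
    exact h.inter_succ (n - i - 1) (by omega) z hz' hz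
  disjoint i j hij hj z hz hz' := by
    have e : n + 1 - i = (n - i) + 1 := by omega
    have e' : n + 1 - (i + 1) = n - i := by omega
    have e2 : n + 1 - j = (n - j) + 1 := by omega
    have e2' : n + 1 - (j + 1) = n - j := by omega
    simp only [e, e', e2, e2'] at hz hz'
    rw [segment_symm] at hz hz'
    exact h.disjoint (n - j) (n - i) (by omega) (by omega) z hz' hz

theorem polylineEdges_reverse (n : ℕ) (q : ℕ → ℂ) :
    polylineEdges n (fun i => q (n + 1 - i)) = polylineEdges n q := by
  ext x
  constructor
  · rintro ⟨i, hi, rfl⟩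
    refine ⟨n - i, by omega, ?_⟩
    have e : n + 1 - i = (n - i) + 1 := by omega
    have e' : n + 1 - (i + 1) = n - i := by omega
    simp only [e, e']
    exact Sym2.eq_swap
  · rintro ⟨i, hi, rfl⟩
    refine ⟨n - i, by omega, ?_⟩
    have e : n + 1 - (n - i) = i + 1 := by omega
    have e' : n + 1 - (n - i + 1) = i := by omega
    simp only [e, e']
    exact Sym2.eq_swap

theorem eq_of_mem_segments (h : IsPolyline n q a b) {i j : ℕ} (hij : i < j) (hj : j ≤ n) {z : ℂ}
    (hz : z ∈ segment ℝ (q i) (q (i + 1))) (hz' : z ∈ segment ℝ (q j) (q (j + 1))) :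
    j = i + 1 ∧ z = q j := by
  rcases (show i + 1 ≤ j from hij).eq_or_lt with rfl | hlt
  · exact ⟨rfl, h.inter_succ i (by omega) z hz hz'⟩
  · exact absurd hz' (h.disjoint i j hlt hj z hz)

theorem ne_of_lt (h : IsPolyline n q a b) {i j : ℕ} (hij : i < j) (hj : j ≤ n + 1) : q i ≠ q j := by
  intro he
  obtain ⟨k, rfl⟩ : ∃ k, j = k + 1 := ⟨j - 1, by omega⟩
  rcases (show i ≤ k by omega).eq_or_lt with rfl | hlt
  · exact h.ne_succ i (by omega) he
  · obtain ⟨h1, h2⟩ := h.eq_of_mem_segments hlt (by omega) (left_mem_segment ℝ (q i) (q (i + 1)))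
      (he ▸ right_mem_segment ℝ (q k) (q (k + 1)))
    subst h1
    exact h.ne_succ i (by omega) h2

theorem eq_of_eq (h : IsPolyline n q a b) {i j : ℕ} (hi : i ≤ n + 1) (hj : j ≤ n + 1)
    (he : q i = q j) : i = j := by
  rcases lt_trichotomy i j with hij | hij | hij
  · exact absurd he (h.ne_of_lt hij hj)
  · exact hij
  · exact absurd he.symm (h.ne_of_lt hij hi)

theorem eq_or_of_mem_segment (h : IsPolyline n q a b) {k i : ℕ} (hk : k ≤ n + 1) (hi : i ≤ n)
    (hm : q k ∈ segment ℝ (q i) (q (i + 1))) : k = i ∨ k = i + 1 := by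
  by_contra! hcon
  rcases lt_or_gt_of_ne hcon.1 with hlt | hlt
  · obtain ⟨h1, h2⟩ := h.eq_of_mem_segments hlt hi (left_mem_segment ℝ (q k) (q (k + 1))) hm
    exact h.ne_of_lt hlt (by omega) h2
  · obtain ⟨l, rfl⟩ : ∃ l, k = l + 1 := ⟨k - 1, by omega⟩
    obtain ⟨h1, h2⟩ := h.eq_of_mem_segments (show i < l by omega) (by omega) hm
      (right_mem_segment ℝ (q l) (q (l + 1)))
    exact h.ne_of_lt (Nat.lt_succ_self l) (by omega) h2.symm

theorem inter (h : IsPolyline n q a b) {i j : ℕ} (hi : i ≤ n) (hj : j ≤ n) (hij : i ≠ j) {z : ℂ}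
    (hz : z ∈ segment ℝ (q i) (q (i + 1))) (hz' : z ∈ segment ℝ (q j) (q (j + 1))) :
    (z = q i ∨ z = q (i + 1)) ∧ (z = q j ∨ z = q (j + 1)) := by
  rcases lt_or_gt_of_ne hij with hlt | hlt
  · obtain ⟨rfl, h2⟩ := h.eq_of_mem_segments hlt hj hz hz'
    exact ⟨Or.inr h2, Or.inl h2⟩
  · obtain ⟨rfl, h2⟩ := h.eq_of_mem_segments hlt hi hz' hz
    exact ⟨Or.inl h2, Or.inr h2⟩

end IsPolyline

/-! ### Polygonal drawings of graphs -/

/-- A drawing of a graph in the plane with polygonal lines as edges; `edges e` is the set of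
segments of the line that represents `e`. -/
structure PolygonalDrawing {V : Type*} (G : SimpleGraph V) where
  vert : V → ℂ
  edges : Sym2 V → Set (Sym2 ℂ)
  polyline : ∀ u v, G.Adj u v → ∃ n q, IsPolyline n q (vert u) (vert v) ∧
    edges s(u, v) = polylineEdges n q
  mem_of_vert_mem : ∀ e ∈ G.edgeSet, ∀ w, ∀ x ∈ edges e, vert w ∈ sym2Segment x → w ∈ e
  inter : ∀ e ∈ G.edgeSet, ∀ f ∈ G.edgeSet, e ≠ f → ∀ x ∈ edges e, ∀ y ∈ edges f,
    ∀ z ∈ sym2Segment x, z ∈ sym2Segment y → ∃ w, w ∈ e ∧ w ∈ f ∧ vert w = z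

namespace PolygonalDrawing

variable {V : Type*} {G H : SimpleGraph V} (D : PolygonalDrawing G)

/-- The graph formed by all segments that belong to edges of `H`. -/
def graph (H : SimpleGraph V) : SimpleGraph ℂ where
  Adj p q := p ≠ q ∧ ∃ e ∈ H.edgeSet, s(p, q) ∈ D.edges e
  symm := ⟨fun p q h => ⟨h.1.symm, by rw [Sym2.eq_swap]; exact h.2⟩⟩
  loopless := ⟨fun p h => h.1 rfl⟩

theorem finite_edges {e : Sym2 V} (he : e ∈ G.edgeSet) : (D.edges e).Finite := by
  induction e with
  | _ u v =>
    obtain ⟨n, q, -, hq⟩ := D.polyline u v he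
    rw [hq]
    refine ((Finset.range (n + 1)).finite_toSet.image fun i => s(q i, q (i + 1))).subset ?_
    rintro x ⟨i, hi, rfl⟩
    exact ⟨i, by simpa using Nat.lt_succ_of_le hi, rfl⟩

/-- Orient the line to start at `w`. It does not return to its start, so only its first segment
contains that point. -/
theorem eq_end_of_vert_mem {e : Sym2 V} (he : e ∈ G.edgeSet) {w : V} {p q : ℂ}
    (hpq : s(p, q) ∈ D.edges e) (hw : D.vert w ∈ segment ℝ p q) : D.vert w = p ∨ D.vert w = q := by
  have hwe := D.mem_of_vert_mem e he w _ hpq hw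
  obtain ⟨v, rfl⟩ := Sym2.mem_iff_exists.1 hwe
  obtain ⟨n, r, hr, hE⟩ := D.polyline w v he
  rw [hE] at hpq
  obtain ⟨i, hi, hi'⟩ := hpq
  have key : ∀ j ≤ n, D.vert w ∈ segment ℝ (r j) (r (j + 1)) → D.vert w = r j := by
    intro j hj hm
    rw [← hr.start] at hm ⊢
    rcases hr.eq_or_of_mem_segment (Nat.zero_le _) hj hm with h | h
    · rw [← h]
    · omega
  rcases Sym2.eq_iff.1 hi' with ⟨rfl, rfl⟩ | ⟨rfl, rfl⟩
  · exact Or.inl (key i hi hw)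
  · rw [segment_symm] at hw
    exact Or.inr (key i hi hw)

/-- Treating the corners of the lines as vertices turns a polygonal drawing into a straight one. -/
theorem isStraight_graph [Finite V] (hH : H ≤ G) : IsStraight (D.graph H) where
  finite := by
    have hf : (⋃ e ∈ H.edgeSet, D.edges e).Finite :=
      (Set.toFinite H.edgeSet).biUnion fun e he => D.finite_edges (SimpleGraph.edgeSet_mono hH he)
    refine hf.subset fun x hx => ?_
    induction x with
    | _ p q =>
      obtain ⟨-, e, he, hpq⟩ := hx
      simp only [mem_iUnion]
      exact ⟨e, he, hpq⟩
  inter p q p' q' hpq hpq' hne z hz hz' := by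
    obtain ⟨-, e, he, hpq⟩ := hpq
    obtain ⟨-, f, hf, hpq'⟩ := hpq'
    have heG := SimpleGraph.edgeSet_mono hH he
    have hfG := SimpleGraph.edgeSet_mono hH hf
    by_cases hef : e = f
    · subst hef
      induction e with
      | _ u v =>
        obtain ⟨n, r, hr, hE⟩ := D.polyline u v heG
        rw [hE] at hpq hpq'
        obtain ⟨i, hi, hi'⟩ := hpq
        obtain ⟨j, hj, hj'⟩ := hpq'
        have hij : i ≠ j := by
          rintro rfl
          exact hne (hi'.trans hj'.symm)
        have hz1 : z ∈ segment ℝ (r i) (r (i + 1)) := by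
          rcases Sym2.eq_iff.1 hi' with ⟨h1, h2⟩ | ⟨h1, h2⟩
          · rwa [h1, h2] at hz
          · rwa [h1, h2, segment_symm] at hz
        have hz2 : z ∈ segment ℝ (r j) (r (j + 1)) := by
          rcases Sym2.eq_iff.1 hj' with ⟨h1, h2⟩ | ⟨h1, h2⟩
          · rwa [h1, h2] at hz'
          · rwa [h1, h2, segment_symm] at hz'
        have := hr.inter hi hj hij hz1 hz2
        rw [← Sym2.mem_iff, ← Sym2.mem_iff, hi', hj', Sym2.mem_iff, Sym2.mem_iff]
        exact this
    · obtain ⟨w, -, -, rfl⟩ := D.inter e heG f hfG hef _ hpq _ hpq' z hz hz'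
      exact ⟨D.eq_end_of_vert_mem heG hpq hz, D.eq_end_of_vert_mem hfG hpq' hz'⟩

theorem exists_first {a x : V} (h : G.Adj a x) : ∃ p, s(D.vert a, p) ∈ D.edges s(a, x) ∧
    D.vert a ≠ p := by
  obtain ⟨n, q, hq, hE⟩ := D.polyline a x h
  refine ⟨q 1, ?_, ?_⟩
  · rw [hE, ← hq.start]
    exact ⟨0, Nat.zero_le _, rfl⟩
  · rw [← hq.start]
    exact hq.ne_succ 0 (Nat.zero_le _)

open Classical in
/-- The first corner after `a` on the line that represents the edge `a x`. -/
noncomputable def first (a x : V) : ℂ :=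
  if h : G.Adj a x then (D.exists_first h).choose else 0

theorem first_mem {a x : V} (h : G.Adj a x) : s(D.vert a, D.first a x) ∈ D.edges s(a, x) := by
  rw [first, dif_pos h]
  exact (D.exists_first h).choose_spec.1

theorem vert_ne_first {a x : V} (h : G.Adj a x) : D.vert a ≠ D.first a x := by
  rw [first, dif_pos h]
  exact (D.exists_first h).choose_spec.2

theorem eq_of_mem_edges {a x : V} {n : ℕ} {q : ℕ → ℂ} (hq : IsPolyline n q (D.vert a) (D.vert x))
    (hE : D.edges s(a, x) = polylineEdges n q) {p : ℂ} (hp : s(D.vert a, p) ∈ D.edges s(a, x)) :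
    p = q 1 := by
  rw [hE, ← hq.start] at hp
  obtain ⟨i, hi, h⟩ := hp
  rcases Sym2.eq_iff.1 h with ⟨h1, h2⟩ | ⟨h1, h2⟩
  · obtain rfl := hq.eq_of_eq (Nat.zero_le _) (by omega) h1
    exact h2
  · exact absurd (hq.eq_of_eq (Nat.zero_le _) (by omega) h1) (by omega)

theorem eq_first {a x : V} (h : G.Adj a x) {p : ℂ} (hp : s(D.vert a, p) ∈ D.edges s(a, x)) :
    p = D.first a x := by
  obtain ⟨n, q, hq, hE⟩ := D.polyline a x h
  rw [D.eq_of_mem_edges hq hE hp, D.eq_of_mem_edges hq hE (D.first_mem h)]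

theorem graph_adj_first (hH : H ≤ G) {a x : V} (h : H.Adj a x) :
    (D.graph H).Adj (D.vert a) (D.first a x) :=
  ⟨D.vert_ne_first (hH h), s(a, x), h, D.first_mem (hH h)⟩

theorem neighborSet_vert (hH : H ≤ G) (a : V) :
    (D.graph H).neighborSet (D.vert a) = D.first a '' H.neighborSet a := by
  ext p
  constructor
  · rintro ⟨-, e, he, hp⟩
    have hae := D.mem_of_vert_mem e (SimpleGraph.edgeSet_mono hH he) a _ hp
      (left_mem_segment ℝ _ _)
    obtain ⟨x, rfl⟩ := Sym2.mem_iff_exists.1 hae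
    exact ⟨x, he, (D.eq_first (hH he) hp).symm⟩
  · rintro ⟨x, hx, rfl⟩
    exact D.graph_adj_first hH hx

theorem first_injective {a x y : V} (hx : G.Adj a x) (hy : G.Adj a y)
    (h : D.first a x = D.first a y) : x = y := by
  by_contra hne
  have hne' : s(a, x) ≠ s(a, y) := fun he => hne (Sym2.congr_right.1 he)
  obtain ⟨w, hw1, hw2, hw⟩ := D.inter _ hx _ hy hne' _ (D.first_mem hx) _ (D.first_mem hy)
    (D.first a x) (right_mem_segment ℝ _ _) (h ▸ right_mem_segment ℝ _ _)
  rcases Sym2.mem_iff.1 hw1 with rfl | rfl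
  · exact D.vert_ne_first hx hw
  · rcases Sym2.mem_iff.1 hw2 with rfl | rfl
    · exact D.vert_ne_first hx hw
    · exact hne rfl

/-- Inner corners belong to one edge only and have degree 2 in the drawing, so a face continues past
them. -/
theorem neighborSet_corner (hH : H ≤ G) {u v : V} (huv : H.Adj u v) {n : ℕ} {q : ℕ → ℂ}
    (hq : IsPolyline n q (D.vert u) (D.vert v)) (hE : D.edges s(u, v) = polylineEdges n q) {k : ℕ}
    (hk : k < n) : (D.graph H).neighborSet (q (k + 1)) = {q k, q (k + 2)} := by
  have hmem : ∀ i ≤ n, s(q i, q (i + 1)) ∈ D.edges s(u, v) := fun i hi => by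
    rw [hE]; exact ⟨i, hi, rfl⟩
  ext p
  constructor
  · rintro ⟨-, e, he, hp⟩
    have heq : s(u, v) = e := by
      by_contra hne
      obtain ⟨w, hw1, -, hw⟩ := D.inter _ (hH huv) e (SimpleGraph.edgeSet_mono hH he) hne _
        (hmem k hk.le) _ hp (q (k + 1)) (right_mem_segment ℝ _ _) (left_mem_segment ℝ _ _)
      rcases Sym2.mem_iff.1 hw1 with rfl | rfl
      · rw [← hq.start] at hw
        have := hq.eq_of_eq (Nat.zero_le _) (by omega) hw
        omega
      · rw [← hq.finish] at hw
        have := hq.eq_of_eq (by omega) (by omega) hw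
        omega
    rw [← heq, hE] at hp
    obtain ⟨i, hi, h⟩ := hp
    rcases Sym2.eq_iff.1 h with ⟨h1, h2⟩ | ⟨h1, h2⟩
    · obtain rfl := hq.eq_of_eq (by omega) (by omega) h1
      exact Or.inr h2
    · have := hq.eq_of_eq (by omega) (by omega) h1
      obtain rfl : k = i := by omega
      exact Or.inl h2
  · rintro (rfl | rfl)
    · refine ⟨(hq.ne_succ k hk.le).symm, s(u, v), huv, ?_⟩
      rw [Sym2.eq_swap (a := q (k + 1))]
      exact hmem k hk.le
    · exact ⟨hq.ne_succ (k + 1) hk, s(u, v), huv, hmem (k + 1) hk⟩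

/-- At `x`, of degree 2, the face borders both edges. It then follows the line segment by segment
through corners of degree 2 until it reaches `a`; the last segment is read backwards. -/
theorem abuts_first_of_neighborSet_eq_pair [Finite V] (hH : H ≤ G) {F : Set ℂ}
    (hF : IsComponent (drawing (D.graph H)) F) {a x y : V} (hay : a ≠ y)
    (hN : H.neighborSet x = {a, y}) (hx : D.vert x ∈ closure F) :
    Abuts F (D.vert a) (D.first a x) := by
  have hs := D.isStraight_graph hH
  have hxa : H.Adj x a := by rw [← SimpleGraph.mem_neighborSet, hN]; simp
  have hxy : H.Adj x y := by rw [← SimpleGraph.mem_neighborSet, hN]; simp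
  obtain ⟨n, q, hq, hE⟩ := D.polyline x a (hH hxa)
  have hmem : ∀ i ≤ n, s(q i, q (i + 1)) ∈ D.edges s(x, a) := fun i hi => by
    rw [hE]; exact ⟨i, hi, rfl⟩
  have hadj : ∀ i ≤ n, (D.graph H).Adj (q i) (q (i + 1)) := fun i hi =>
    ⟨hq.ne_succ i hi, s(x, a), hxa, hmem i hi⟩
  have key : ∀ i ≤ n, Abuts F (q i) (q (i + 1)) := by
    intro i
    induction i with
    | zero =>
      intro _
      have hN' := D.neighborSet_vert hH x
      rw [hN, image_pair] at hN'
      have hne : D.first x a ≠ D.first x y := fun he =>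
        hay (D.first_injective (hH hxa) (hH hxy) he)
      have := (hs.abuts_of_neighborSet_eq_pair hF hne hN' hx).1
      rw [zero_add, ← D.eq_of_mem_edges hq hE (D.first_mem (hH hxa)), hq.start]
      exact this
    | succ k ih =>
      intro hk
      have hcl := hs.mem_closure_of_abuts hF (hadj k (by omega)) (ih (by omega)) (q (k + 1))
        (right_mem_segment ℝ _ _)
      exact (hs.abuts_of_neighborSet_eq_pair hF (hq.ne_of_lt (by omega) (by omega))
        (D.neighborSet_corner hH hxa hq hE hk) hcl).2
  have hlast := hs.abuts_symm hF (hadj n le_rfl) (key n le_rfl)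
  rw [hq.finish] at hlast
  have hm := hmem n le_rfl
  rw [hq.finish, Sym2.eq_swap (a := q n), Sym2.eq_swap (a := x)] at hm
  rwa [← D.eq_first (hH hxa.symm) hm]

/-- The detour goes from `a` to `x` along the lifted path and then back along the line of `a x` to
its first corner; neither part uses the first segment. -/
theorem reachable_first (hH : H ≤ G) {a x : V} (hax : H.Adj a x)
    (hreach : (H.deleteEdges {s(a, x)}).Reachable a x) :
    ((D.graph H).deleteEdges {s(D.vert a, D.first a x)}).Reachable (D.vert a) (D.first a x) := by
  set Γ := (D.graph H).deleteEdges {s(D.vert a, D.first a x)} with hΓ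
  have walk : ∀ u v, (H.deleteEdges {s(a, x)}).Adj u v → Γ.Reachable (D.vert u) (D.vert v) := by
    intro u v huv
    rw [SimpleGraph.deleteEdges_adj, mem_singleton_iff] at huv
    obtain ⟨huv, hne⟩ := huv
    obtain ⟨n, q, hq, hE⟩ := D.polyline u v (hH huv)
    have step : ∀ i ≤ n, Γ.Adj (q i) (q (i + 1)) := by
      intro i hi
      have hm : s(q i, q (i + 1)) ∈ D.edges s(u, v) := by rw [hE]; exact ⟨i, hi, rfl⟩
      rw [hΓ, SimpleGraph.deleteEdges_adj, mem_singleton_iff]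
      refine ⟨⟨hq.ne_succ i hi, s(u, v), huv, hm⟩, fun he => ?_⟩
      have hm' := D.first_mem (hH hax)
      rw [← he] at hm'
      obtain ⟨w, hw1, hw2, hw⟩ := D.inter _ (hH huv) _ (hH hax) hne _ hm _ hm' (q i)
        (left_mem_segment ℝ _ _) (left_mem_segment ℝ _ _)
      obtain ⟨w', hw1', hw2', hw'⟩ := D.inter _ (hH huv) _ (hH hax) hne _ hm _ hm' (q (i + 1))
        (right_mem_segment ℝ _ _) (right_mem_segment ℝ _ _)
      have hww' : w ≠ w' := by
        rintro rfl
        exact hq.ne_succ i hi (hw.symm.trans hw')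
      exact hne (Sym2.eq_of_ne_mem hww' hw1 hw1' hw2 hw2')
    have chain : ∀ i ≤ n + 1, Γ.Reachable (q 0) (q i) := by
      intro i
      induction i with
      | zero => exact fun _ => SimpleGraph.Reachable.refl _
      | succ k ih => exact fun hk => (ih (by omega)).trans (step k (by omega)).reachable
    have := chain (n + 1) le_rfl
    rwa [hq.start, hq.finish] at this
  have h1 : Γ.Reachable (D.vert a) (D.vert x) := by
    have lift : ∀ u v, (H.deleteEdges {s(a, x)}).Reachable u v →
        Γ.Reachable (D.vert u) (D.vert v) := by
      rintro u v ⟨w⟩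
      induction w with
      | nil => exact SimpleGraph.Reachable.refl _
      | cons h _ ih => exact (walk _ _ h).trans ih
    exact lift a x hreach
  obtain ⟨n, q, hq, hE⟩ := D.polyline a x (hH hax)
  have hfirst : D.first a x = q 1 := D.eq_of_mem_edges hq hE (D.first_mem (hH hax))
  have step : ∀ i ≤ n, 1 ≤ i → Γ.Adj (q i) (q (i + 1)) := by
    intro i hi hi1
    have hm : s(q i, q (i + 1)) ∈ D.edges s(a, x) := by rw [hE]; exact ⟨i, hi, rfl⟩
    rw [hΓ, SimpleGraph.deleteEdges_adj, mem_singleton_iff]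
    refine ⟨⟨hq.ne_succ i hi, s(a, x), hax, hm⟩, fun he => ?_⟩
    rw [← hq.start] at he
    rcases Sym2.eq_iff.1 he with ⟨h2, -⟩ | ⟨-, h2⟩
    · have := hq.eq_of_eq (by omega) (by omega) h2
      omega
    · have := hq.eq_of_eq (by omega) (by omega) h2
      omega
  have chain : ∀ i ≤ n, Γ.Reachable (q 1) (q (i + 1)) := by
    intro i
    induction i with
    | zero => exact fun _ => SimpleGraph.Reachable.refl _
    | succ k ih => exact fun hk => (ih (by omega)).trans (step (k + 1) hk (by omega)).reachable
  have h2 := chain n le_rfl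
  rw [hq.finish, ← hfirst] at h2
  exact h1.trans h2.symm

end PolygonalDrawing

end PlaneTopology

/-! ### From plane embeddings to excluded subgraphs. -/

namespace PlaneTopology

open Set Filter Topology

/-- The identification of the Euclidean plane with the complex plane. -/
noncomputable def toComplex : EuclideanSpace ℝ (Fin 2) ≃ₗᵢ[ℝ] ℂ :=
  Complex.orthonormalBasisOneI.repr.symm

theorem mem_segment_toComplex {a b z : EuclideanSpace ℝ (Fin 2)} :
    toComplex z ∈ segment ℝ (toComplex a) (toComplex b) ↔ z ∈ segment ℝ a b := by
  have h := image_segment ℝ (toComplex.toLinearEquiv.toLinearMap.toAffineMap) a b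
  have h' : toComplex '' segment ℝ a b = segment ℝ (toComplex a) (toComplex b) := h
  rw [← h']
  exact toComplex.injective.mem_set_image

theorem exists_polyline_of_isPolygonalArc {A : Set (EuclideanSpace ℝ (Fin 2))}
    {a b : EuclideanSpace ℝ (Fin 2)} (h : SimpleGraph.IsPolygonalArc A a b) :
    ∃ n q, IsPolyline n q (toComplex a) (toComplex b) ∧
      ∀ z, (∃ i ≤ n, z ∈ segment ℝ (q i) (q (i + 1))) ↔ z ∈ toComplex '' A := by
  obtain ⟨n, q, h0, h1, hne, hsucc, hdisj, hA⟩ := h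
  refine ⟨n, fun i => toComplex (q i), ⟨by rw [h0], by rw [h1], ?_, ?_, ?_⟩, ?_⟩
  · exact fun i hi he => hne i hi (toComplex.injective he)
  · intro i hi z hz hz'
    obtain ⟨z, rfl⟩ := toComplex.surjective z
    rw [mem_segment_toComplex] at hz hz'
    have : z ∈ ({q (i + 1)} : Set _) := hsucc i hi ▸ ⟨hz, hz'⟩
    rw [mem_singleton_iff.1 this]
  · intro i j hij hj z hz hz'
    obtain ⟨z, rfl⟩ := toComplex.surjective z
    rw [mem_segment_toComplex] at hz hz'
    exact Set.disjoint_left.1 (hdisj i j hij hj) hz hz'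
  · intro z
    obtain ⟨z, rfl⟩ := toComplex.surjective z
    rw [toComplex.injective.mem_set_image, hA]
    simp only [mem_segment_toComplex, mem_iUnion, exists_prop]

variable {V : Type*} {G : SimpleGraph V}

/-- The set of segments must serve both orientations of the edge, whence the quantification over all
ways to write `e`. -/
theorem exists_polyline_of_planeEmbedding (E : G.PlaneEmbedding) (e : Sym2 V) (he : e ∈ G.edgeSet) :
    ∃ N : Set (Sym2 ℂ), (∀ u v, e = s(u, v) → ∃ n q,
      IsPolyline n q (toComplex (E.vert u)) (toComplex (E.vert v)) ∧ N = polylineEdges n q) ∧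
      ∀ z, (∃ x ∈ N, z ∈ sym2Segment x) ↔ z ∈ toComplex '' E.arc e := by
  induction e with
  | _ a b =>
    obtain ⟨n, q, hq, hA⟩ := exists_polyline_of_isPolygonalArc (E.isPolygonalArc a b he)
    refine ⟨polylineEdges n q, fun u v huv => ?_, fun z => ?_⟩
    · rcases Sym2.eq_iff.1 huv with ⟨rfl, rfl⟩ | ⟨rfl, rfl⟩
      · exact ⟨n, q, hq, rfl⟩
      · exact ⟨n, _, hq.reverse, (IsPolyline.polylineEdges_reverse n q).symm⟩
    · rw [← hA]
      constructor
      · rintro ⟨x, ⟨i, hi, rfl⟩, hz⟩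
        exact ⟨i, hi, hz⟩
      · rintro ⟨i, hi, hz⟩
        exact ⟨_, ⟨i, hi, rfl⟩, hz⟩

/-- `F₀` need not be a full component for the drawing: subgraphs are considered later, and each time
the component containing `F₀` is taken. -/
theorem exists_polygonalDrawing (h : G.IsOuterplanar) :
    ∃ (D : PolygonalDrawing G) (F₀ : Set ℂ), IsPreconnected F₀ ∧ ¬ Bornology.IsBounded F₀ ∧
      (∀ z ∈ F₀, z ∉ drawing (D.graph G)) ∧ ∀ v, D.vert v ∈ closure F₀ := by
  classical
  obtain ⟨E, F, ⟨x, hx, rfl⟩, hunb, hfr⟩ := h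
  choose N hN hN' using exists_polyline_of_planeEmbedding E
  have harc : ∀ e (he : e ∈ G.edgeSet), ∀ y ∈ N e he, ∀ z ∈ sym2Segment y,
      z ∈ toComplex '' E.arc e := fun e he y hy z hz => (hN' e he z).1 ⟨y, hy, hz⟩
  let D : PolygonalDrawing G :=
    { vert := fun v => toComplex (E.vert v)
      edges := fun e => if he : e ∈ G.edgeSet then N e he else ∅
      polyline := by
        intro u v huv
        rw [dif_pos (show s(u, v) ∈ G.edgeSet from huv)]
        exact hN s(u, v) huv u v rfl
      mem_of_vert_mem := by
        intro e he w y hy hw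
        rw [dif_pos he] at hy
        have := harc e he y hy _ hw
        rw [toComplex.injective.mem_set_image] at this
        exact E.mem_of_vert_mem_arc e he w this
      inter := by
        intro e he f hf hne y hy y' hy' z hz hz'
        rw [dif_pos he] at hy
        rw [dif_pos hf] at hy'
        have h1 := harc e he y hy z hz
        have h2 := harc f hf y' hy' z hz'
        obtain ⟨z, rfl⟩ := toComplex.surjective z
        rw [toComplex.injective.mem_set_image] at h1 h2
        obtain ⟨w, ⟨hw1, hw2⟩, rfl⟩ := E.arc_inter_subset e he f hf hne ⟨h1, h2⟩
        exact ⟨w, hw1, hw2, rfl⟩ }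
  refine ⟨D, toComplex '' connectedComponentIn E.supportᶜ x, ?_, ?_, ?_, ?_⟩
  · exact isPreconnected_connectedComponentIn.image _ toComplex.continuous.continuousOn
  · intro hb
    have := toComplex.symm.lipschitz.isBounded_image hb
    rw [← image_comp] at this
    simp only [LinearIsometryEquiv.symm_comp_self, image_id] at this
    exact hunb this
  · rintro _ ⟨z, hz, rfl⟩ ⟨p, q, ⟨-, e, he, hpq⟩, hzpq⟩
    change s(p, q) ∈ (if he : e ∈ G.edgeSet then N e he else ∅) at hpq
    rw [dif_pos he] at hpq
    have h1 := harc e he _ hpq _ hzpq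
    rw [toComplex.injective.mem_set_image] at h1
    refine connectedComponentIn_subset _ _ hz (Or.inr ?_)
    simp only [mem_iUnion]
    exact ⟨e, he, h1⟩
  · intro v
    exact image_closure_subset_closure_image toComplex.continuous
      ⟨E.vert v, frontier_subset_closure (hfr v), rfl⟩

theorem drawing_mono {Γ Γ' : SimpleGraph ℂ} (h : Γ ≤ Γ') : drawing Γ ⊆ drawing Γ' := by
  rintro z ⟨p, q, hpq, hz⟩
  exact ⟨p, q, h hpq, hz⟩

theorem PolygonalDrawing.graph_mono (D : PolygonalDrawing G) {H H' : SimpleGraph V} (h : H ≤ H') :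
    D.graph H ≤ D.graph H' := by
  rintro p q ⟨hne, e, he, hpq⟩
  exact ⟨hne, e, SimpleGraph.edgeSet_mono h he, hpq⟩

/-- The component of the complement of the drawing of `H` that contains `F₀`. -/
theorem exists_component {S F₀ : Set ℂ} (hc : IsPreconnected F₀) (hunb : ¬ Bornology.IsBounded F₀)
    (hS : ∀ z ∈ F₀, z ∉ S) : ∃ F, IsComponent S F ∧ F₀ ⊆ F ∧ ¬ Bornology.IsBounded F := by
  obtain ⟨z, hz⟩ : F₀.Nonempty := by
    rw [nonempty_iff_ne_empty]
    rintro rfl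
    exact hunb Bornology.isBounded_empty
  have hsub : F₀ ⊆ connectedComponentIn Sᶜ z := hc.subset_connectedComponentIn hz hS
  exact ⟨_, isComponent_connectedComponentIn S z, hsub, fun hb => hunb (hb.subset hsub)⟩

theorem PolygonalDrawing.not_three_abuts [Finite V] (D : PolygonalDrawing G) {H : SimpleGraph V}
    (hH : H ≤ G) {F : Set ℂ} (hF : IsComponent (drawing (D.graph H)) F)
    (hunb : ¬ Bornology.IsBounded F) {a x₁ x₂ x₃ : V} (hN : H.neighborSet a = {x₁, x₂, x₃})
    (h12 : x₁ ≠ x₂) (h13 : x₁ ≠ x₃) (h23 : x₂ ≠ x₃)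
    (hreach : ∀ x, H.Adj a x → (H.deleteEdges {s(a, x)}).Reachable a x)
    (h₁ : Abuts F (D.vert a) (D.first a x₁)) (h₂ : Abuts F (D.vert a) (D.first a x₂))
    (h₃ : Abuts F (D.vert a) (D.first a x₃)) : False := by
  have a1 : H.Adj a x₁ := by rw [← SimpleGraph.mem_neighborSet, hN]; simp
  have a2 : H.Adj a x₂ := by rw [← SimpleGraph.mem_neighborSet, hN]; simp
  have a3 : H.Adj a x₃ := by rw [← SimpleGraph.mem_neighborSet, hN]; simp
  have hN' := D.neighborSet_vert hH a
  rw [hN, image_insert_eq, image_pair] at hN'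
  refine (D.isStraight_graph hH).not_abuts_three hF hunb hN'
    (fun he => h12 (D.first_injective (hH a1) (hH a2) he))
    (fun he => h13 (D.first_injective (hH a1) (hH a3) he))
    (fun he => h23 (D.first_injective (hH a2) (hH a3) he)) ?_ h₁ h₂ h₃
  intro u hu
  have hu' : u ∈ (D.graph H).neighborSet (D.vert a) := hu
  rw [D.neighborSet_vert hH a] at hu'
  obtain ⟨x, hx, rfl⟩ := hu'
  exact D.reachable_first hH hx (hreach x hx)

/-- In an outerplanar graph there is no subgraph with a vertex of degree three, on three edges that
are not bridges, all of whose neighbours have degree two. -/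
theorem not_isOuterplanar_of_tripod [Finite V] {H : SimpleGraph V} (hH : H ≤ G)
    {a x₁ x₂ x₃ y₁ y₂ y₃ : V} (hN : H.neighborSet a = {x₁, x₂, x₃})
    (h12 : x₁ ≠ x₂) (h13 : x₁ ≠ x₃) (h23 : x₂ ≠ x₃)
    (hreach : ∀ x, H.Adj a x → (H.deleteEdges {s(a, x)}).Reachable a x)
    (hN₁ : H.neighborSet x₁ = {a, y₁}) (hN₂ : H.neighborSet x₂ = {a, y₂})
    (hN₃ : H.neighborSet x₃ = {a, y₃}) (hy₁ : a ≠ y₁) (hy₂ : a ≠ y₂) (hy₃ : a ≠ y₃) :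
    ¬ G.IsOuterplanar := by
  intro h
  obtain ⟨D, F₀, hc, hunb, hS, hcl⟩ := exists_polygonalDrawing h
  obtain ⟨F, hF, hsub, hFunb⟩ := exists_component hc hunb
    (S := drawing (D.graph H)) fun z hz hz' => hS z hz (drawing_mono (D.graph_mono hH) hz')
  have hcl' : ∀ v, D.vert v ∈ closure F := fun v => closure_mono hsub (hcl v)
  exact D.not_three_abuts hH hF hFunb hN h12 h13 h23 hreach
    (D.abuts_first_of_neighborSet_eq_pair hH hF hy₁ hN₁ (hcl' _))
    (D.abuts_first_of_neighborSet_eq_pair hH hF hy₂ hN₂ (hcl' _))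
    (D.abuts_first_of_neighborSet_eq_pair hH hF hy₃ hN₃ (hcl' _))

/-- The complete graph on four of the vertices. -/
def fourClique (a b c d : V) : SimpleGraph V where
  Adj u v := u ≠ v ∧ u ∈ ({a, b, c, d} : Set V) ∧ v ∈ ({a, b, c, d} : Set V)
  symm := ⟨fun _ _ h => ⟨h.1.symm, h.2.2, h.2.1⟩⟩
  loopless := ⟨fun _ h => h.1 rfl⟩

theorem fourClique_comm₁ (a b c d : V) : fourClique a b c d = fourClique a c b d := by
  ext u v
  simp only [fourClique, mem_insert_iff, mem_singleton_iff]
  tauto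

theorem fourClique_comm₂ (a b c d : V) : fourClique a b c d = fourClique a d c b := by
  ext u v
  simp only [fourClique, mem_insert_iff, mem_singleton_iff]
  tauto

/-- Without the edge `y z`, the vertices `y` and `z` have degree 2 and the face borders `a y` and `a
z` as well. With `a x` this makes all three edges at `a`. -/
theorem PolygonalDrawing.not_abuts_fourClique [Finite V] (D : PolygonalDrawing G) {F₀ : Set ℂ}
    (hc : IsPreconnected F₀) (hunb : ¬ Bornology.IsBounded F₀) {a x y z : V}
    (hS : ∀ w ∈ F₀, w ∉ drawing (D.graph (fourClique a x y z)))
    (hcl : ∀ v, D.vert v ∈ closure F₀)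
    (hle : fourClique a x y z ≤ G) (hax : a ≠ x) (hay : a ≠ y) (haz : a ≠ z) (hxy : x ≠ y)
    (hxz : x ≠ z) (hyz : y ≠ z) : ¬ Abuts F₀ (D.vert a) (D.first a x) := by
  intro hab
  set H := (fourClique a x y z).deleteEdges {s(y, z)} with hHdef
  have hHle : H ≤ fourClique a x y z := SimpleGraph.deleteEdges_le _
  have hH : H ≤ G := hHle.trans hle
  obtain ⟨F, hF, hsub, hFunb⟩ := exists_component hc hunb
    (S := drawing (D.graph H)) fun w hw hw' => hS w hw (drawing_mono (D.graph_mono hHle) hw')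
  have hcl' : ∀ v, D.vert v ∈ closure F := fun v => closure_mono hsub (hcl v)
  have hadj : ∀ u v, H.Adj u v ↔ (u ≠ v ∧ (u = a ∨ u = x ∨ u = y ∨ u = z) ∧
      (v = a ∨ v = x ∨ v = y ∨ v = z)) ∧ ¬ (u = y ∧ v = z ∨ u = z ∧ v = y) := by
    intro u v
    rw [hHdef, SimpleGraph.deleteEdges_adj, mem_singleton_iff, Sym2.eq_iff]
    rfl
  have hNa : H.neighborSet a = {x, y, z} := by
    ext v
    simp only [SimpleGraph.mem_neighborSet, hadj, mem_insert_iff, mem_singleton_iff]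
    constructor
    · rintro ⟨⟨h1, -, h2⟩, -⟩
      rcases h2 with h2 | h2
      · exact absurd h2.symm h1
      · exact h2
    · rintro (rfl | rfl | rfl) <;> simp [*]
  have hNy : H.neighborSet y = {a, x} := by
    ext v
    simp only [SimpleGraph.mem_neighborSet, hadj, mem_insert_iff, mem_singleton_iff]
    constructor
    · rintro ⟨⟨h1, -, h2⟩, h3⟩
      rcases h2 with h2 | h2 | h2 | h2
      · exact Or.inl h2
      · exact Or.inr h2
      · exact absurd h2.symm h1
      · exact absurd (Or.inl ⟨trivial, h2⟩) h3
    · rintro (rfl | rfl) <;> simp [*, Ne.symm]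
  have hNz : H.neighborSet z = {a, x} := by
    ext v
    simp only [SimpleGraph.mem_neighborSet, hadj, mem_insert_iff, mem_singleton_iff]
    constructor
    · rintro ⟨⟨h1, -, h2⟩, h3⟩
      rcases h2 with h2 | h2 | h2 | h2
      · exact Or.inl h2
      · exact Or.inr h2
      · exact absurd (Or.inr ⟨trivial, h2⟩) h3
      · exact absurd h2.symm h1
    · rintro (rfl | rfl) <;> simp [*, Ne.symm]
  have path : ∀ u w v, H.Adj u w → H.Adj w v → s(u, w) ≠ s(u, v) → s(w, v) ≠ s(u, v) →
      (H.deleteEdges {s(u, v)}).Reachable u v := by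
    intro u w v h1 h2 h3 h4
    have e1 : (H.deleteEdges {s(u, v)}).Adj u w := SimpleGraph.deleteEdges_adj.2 ⟨h1, h3⟩
    have e2 : (H.deleteEdges {s(u, v)}).Adj w v := SimpleGraph.deleteEdges_adj.2 ⟨h2, h4⟩
    exact e1.reachable.trans e2.reachable
  refine D.not_three_abuts hH hF hFunb hNa hxy hxz hyz ?_
    (hab.mono fun w hw hw' => closure_mono hsub (hw hw'))
    (D.abuts_first_of_neighborSet_eq_pair hH hF hax hNy (hcl' _))
    (D.abuts_first_of_neighborSet_eq_pair hH hF hax hNz (hcl' _))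
  intro v hv
  rw [← SimpleGraph.mem_neighborSet, hNa] at hv
  rcases hv with rfl | rfl | rfl
  · refine path a y v ?_ ?_ ?_ ?_
    · rw [hadj]; simp [*]
    · rw [hadj]; simp [*, Ne.symm]
    · rw [Ne, Sym2.eq_iff]; simp [*, Ne.symm]
    · rw [Ne, Sym2.eq_iff]; simp [*, Ne.symm]
  · refine path a x v ?_ ?_ ?_ ?_
    · rw [hadj]; simp [*]
    · rw [hadj]; simp [*, Ne.symm]
    · rw [Ne, Sym2.eq_iff]; simp [*, Ne.symm]
    · rw [Ne, Sym2.eq_iff]; simp [*, Ne.symm]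
  · refine path a x v ?_ ?_ ?_ ?_
    · rw [hadj]; simp [*]
    · rw [hadj]; simp [*, Ne.symm]
    · rw [Ne, Sym2.eq_iff]; simp [*, Ne.symm]
    · rw [Ne, Sym2.eq_iff]; simp [*, Ne.symm]

/-- The face borders at least one edge at `a`; by symmetry of the clique the other end of that edge
can play the role of `x`. -/
theorem not_isOuterplanar_of_fourClique [Finite V] {a b c d : V} (hle : fourClique a b c d ≤ G)
    (hab : a ≠ b) (hac : a ≠ c) (had : a ≠ d) (hbc : b ≠ c) (hbd : b ≠ d) (hcd : c ≠ d) :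
    ¬ G.IsOuterplanar := by
  intro h
  obtain ⟨D, F₀, hc, hunb, hS, hcl⟩ := exists_polygonalDrawing h
  obtain ⟨F, hF, hsub, hFunb⟩ := exists_component hc hunb
    (S := drawing (D.graph (fourClique a b c d))) fun z hz hz' =>
      hS z hz (drawing_mono (D.graph_mono hle) hz')
  have hcl' : ∀ v, D.vert v ∈ closure F := fun v => closure_mono hsub (hcl v)
  have hN : (fourClique a b c d).neighborSet a = {b, c, d} := by
    ext v
    simp only [SimpleGraph.mem_neighborSet, fourClique, mem_insert_iff, mem_singleton_iff]
    constructor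
    · rintro ⟨h1, -, h2⟩
      rcases h2 with h2 | h2
      · exact absurd h2.symm h1
      · exact h2
    · rintro (rfl | rfl | rfl) <;> simp [*]
  have adj : ∀ v ∈ (fourClique a b c d).neighborSet a, G.Adj a v := fun v hv => hle hv
  rw [hN] at adj
  have a1 := adj b (by simp)
  have a2 := adj c (by simp)
  have a3 := adj d (by simp)
  have hN' := D.neighborSet_vert hle a
  have a4 : (D.graph (fourClique a b c d)).Adj (D.vert a) (D.first a b) :=
    D.graph_adj_first hle (by rw [← SimpleGraph.mem_neighborSet, hN]; simp)
  rw [hN, image_insert_eq, image_pair] at hN'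
  have hs := (D.isStraight_graph hle).isStar_neighborSet a4
  rw [hN'] at hs
  rcases hs.exists_abuts (fun he => hbc (D.first_injective a1 a2 he))
    (fun he => hbd (D.first_injective a1 a3 he)) (fun he => hcd (D.first_injective a2 a3 he))
    hF (mem_drawing_of_adj a4) (hcl' a) with h1 | h1 | h1
  · exact D.not_abuts_fourClique hF.preconnected hFunb hF.disjoint hcl' hle hab hac had hbc hbd hcd h1
  · rw [fourClique_comm₁] at hF hle
    exact D.not_abuts_fourClique hF.preconnected hFunb hF.disjoint hcl' hle hac hab had hbc.symm
      hcd hbd h1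
  · rw [fourClique_comm₂] at hF hle
    exact D.not_abuts_fourClique hF.preconnected hFunb hF.disjoint hcl' hle had hac hab hcd.symm
      hbd.symm hbc.symm h1

end PlaneTopology

/-! ### Theta graphs and crossing chords of a cycle. -/

namespace SimpleGraph

section Theta

variable {V : Type*} {G : SimpleGraph V}

theorem _root_.List.isChain_iff_infix {α : Type*} {R : α → α → Prop} {L : List α} :
    L.IsChain R ↔ ∀ u v, [u, v] <:+: L → R u v := by
  refine ⟨fun h u v huv => by simpa using h.infix huv, fun h => ?_⟩
  rw [List.isChain_iff_forall_rel_of_append_cons_cons]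
  rintro a b l₁ l₂ rfl
  exact h a b ⟨l₁, l₂, by simp⟩

/-- The edges between consecutive entries of a list. -/
def pathGraphOf (L : List V) : SimpleGraph V := fromRel fun u v => [u, v] <:+: L

theorem pathGraphOf_le {L : List V} (h : L.IsChain G.Adj) : pathGraphOf L ≤ G := by
  rw [List.isChain_iff_infix] at h
  rintro u v ⟨-, huv | huv⟩
  exacts [h u v huv, (h v u huv).symm]

theorem isChain_pathGraphOf {L : List V} (h : L.Nodup) : L.IsChain (pathGraphOf L).Adj := by
  rw [List.isChain_iff_infix]
  refine fun u v huv => ⟨?_, Or.inl huv⟩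
  rintro rfl
  simpa using h.sublist huv.sublist

theorem pathGraphOf_adj_head {a x v : V} {L : List V} (ha : a ∉ x :: L) :
    (pathGraphOf (a :: x :: L)).Adj a v ↔ v = x := by
  have h1 : ¬ [a, v] <:+: x :: L := fun h => ha (h.subset (by simp))
  have h2 : ¬ [v, a] <:+: x :: L := fun h => ha (h.subset (by simp))
  have hax : a ≠ x := fun h => ha (by simp [h])
  simp only [pathGraphOf, fromRel_adj, List.infix_cons_iff (l₂ := x :: L), h1, h2,
    List.cons_prefix_cons, List.nil_prefix, hax, true_and, and_true, and_false, or_false]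
  exact ⟨fun h => h.2, fun h => ⟨h ▸ hax, h⟩⟩

theorem pathGraphOf_adj_second {a x y v : V} {L : List V} (ha : a ∉ x :: y :: L)
    (hx : x ∉ y :: L) : (pathGraphOf (a :: x :: y :: L)).Adj x v ↔ v = a ∨ v = y := by
  have h1 : ¬ [x, v] <:+: y :: L := fun h => hx (h.subset (by simp))
  have h2 : ¬ [v, x] <:+: y :: L := fun h => hx (h.subset (by simp))
  have hxa : x ≠ a := fun h => ha (by simp [h])
  have hxy : x ≠ y := fun h => hx (by simp [h])
  simp only [pathGraphOf, fromRel_adj, List.infix_cons_iff (l₂ := x :: y :: L),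
    List.infix_cons_iff (l₂ := y :: L), h1, h2,
    List.cons_prefix_cons, List.nil_prefix, hxa, hxy, true_and, and_true, and_false, false_and,
    or_false, false_or]
  constructor
  · rintro ⟨-, h | h⟩
    exacts [Or.inr h, Or.inl h]
  · rintro (rfl | rfl)
    exacts [⟨hxa, Or.inr rfl⟩, ⟨hxy, Or.inl rfl⟩]

theorem pathGraphOf_not_adj {x v : V} {L : List V} (hx : x ∉ L) : ¬ (pathGraphOf L).Adj x v := by
  rintro ⟨-, h | h⟩ <;> exact hx (h.subset (by simp))

/-- A path that avoids one end of `e` does not use `e`. -/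
theorem reachable_deleteEdges_of_isChain {H : SimpleGraph V} {e : Sym2 V} {c : V} (hc : c ∈ e) :
    ∀ {L : List V} {u v : V}, (u :: L).IsChain H.Adj → c ∉ u :: L → v ∈ u :: L →
      (H.deleteEdges {e}).Reachable u v
  | [], u, v, _, _, hv => by
    rw [List.mem_singleton.1 hv]
  | w :: L, u, v, h, hcL, hv => by
    rw [List.isChain_cons_cons] at h
    rcases List.mem_cons.1 hv with rfl | hv
    · exact Reachable.refl _
    have hadj : (H.deleteEdges {e}).Adj u w := by
      refine deleteEdges_adj.2 ⟨h.1, fun he => ?_⟩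
      rw [← Set.mem_singleton_iff.1 he, Sym2.mem_iff] at hc
      rcases hc with rfl | rfl <;> simp at hcL
    exact hadj.reachable.trans (reachable_deleteEdges_of_isChain hc h.2
      (fun h' => hcL (List.mem_cons_of_mem _ h')) hv)

-- Only the start `a` and the first inner vertices `x₁`, `x₂`, `x₃` have to be private to their
-- paths. Their degrees in the union of the paths are 3 and 2, whatever happens further along.
open PlaneTopology in
theorem IsOuterplanar.not_theta_aux [Finite V] (hG : G.IsOuterplanar)
    {a b x₁ x₂ x₃ y₁ y₂ y₃ : V} {r₁ r₂ r₃ : List V}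
    (h₁ : (a :: x₁ :: y₁ :: r₁).IsChain G.Adj) (h₂ : (a :: x₂ :: y₂ :: r₂).IsChain G.Adj)
    (h₃ : (a :: x₃ :: y₃ :: r₃).IsChain G.Adj)
    (hn₁ : (a :: x₁ :: y₁ :: r₁).Nodup) (hn₂ : (a :: x₂ :: y₂ :: r₂).Nodup)
    (hn₃ : (a :: x₃ :: y₃ :: r₃).Nodup)
    (hb₁ : b ∈ y₁ :: r₁) (hb₂ : b ∈ y₂ :: r₂) (hb₃ : b ∈ y₃ :: r₃)
    (h12 : x₁ ∉ x₂ :: y₂ :: r₂) (h13 : x₁ ∉ x₃ :: y₃ :: r₃) (h21 : x₂ ∉ x₁ :: y₁ :: r₁)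
    (h23 : x₂ ∉ x₃ :: y₃ :: r₃) (h31 : x₃ ∉ x₁ :: y₁ :: r₁) (h32 : x₃ ∉ x₂ :: y₂ :: r₂) :
    False := by
  set P₁ := pathGraphOf (a :: x₁ :: y₁ :: r₁) with hP₁
  set P₂ := pathGraphOf (a :: x₂ :: y₂ :: r₂) with hP₂
  set P₃ := pathGraphOf (a :: x₃ :: y₃ :: r₃) with hP₃
  have hc₁ := (isChain_pathGraphOf hn₁).imp (S := (P₁ ⊔ P₂ ⊔ P₃).Adj)
    fun u v h => Or.inl (Or.inl h)
  have hc₂ := (isChain_pathGraphOf hn₂).imp (S := (P₁ ⊔ P₂ ⊔ P₃).Adj)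
    fun u v h => Or.inl (Or.inr h)
  have hc₃ := (isChain_pathGraphOf hn₃).imp (S := (P₁ ⊔ P₂ ⊔ P₃).Adj)
    fun u v h => Or.inr h
  obtain ⟨ha₁, hm₁⟩ := List.nodup_cons.1 hn₁
  obtain ⟨ha₂, hm₂⟩ := List.nodup_cons.1 hn₂
  obtain ⟨ha₃, hm₃⟩ := List.nodup_cons.1 hn₃
  have hx₁ := (List.nodup_cons.1 hm₁).1
  have hx₂ := (List.nodup_cons.1 hm₂).1
  have hx₃ := (List.nodup_cons.1 hm₃).1
  have hxa₁ : x₁ ≠ a := fun h => ha₁ (by simp [h])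
  have hxa₂ : x₂ ≠ a := fun h => ha₂ (by simp [h])
  have hxa₃ : x₃ ≠ a := fun h => ha₃ (by simp [h])
  have hya₁ : a ≠ y₁ := fun h => ha₁ (by simp [h])
  have hya₂ : a ≠ y₂ := fun h => ha₂ (by simp [h])
  have hya₃ : a ≠ y₃ := fun h => ha₃ (by simp [h])
  have n12 : x₁ ∉ a :: x₂ :: y₂ :: r₂ := fun h => (List.mem_cons.1 h).elim hxa₁ h12
  have n13 : x₁ ∉ a :: x₃ :: y₃ :: r₃ := fun h => (List.mem_cons.1 h).elim hxa₁ h13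
  have n21 : x₂ ∉ a :: x₁ :: y₁ :: r₁ := fun h => (List.mem_cons.1 h).elim hxa₂ h21
  have n23 : x₂ ∉ a :: x₃ :: y₃ :: r₃ := fun h => (List.mem_cons.1 h).elim hxa₂ h23
  have n31 : x₃ ∉ a :: x₁ :: y₁ :: r₁ := fun h => (List.mem_cons.1 h).elim hxa₃ h31
  have n32 : x₃ ∉ a :: x₂ :: y₂ :: r₂ := fun h => (List.mem_cons.1 h).elim hxa₃ h32
  have hle : P₁ ⊔ P₂ ⊔ P₃ ≤ G :=
    sup_le (sup_le (pathGraphOf_le h₁) (pathGraphOf_le h₂)) (pathGraphOf_le h₃)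
  -- To bypass the edge `a x`, go to `b` along another path, which avoids `x`, and return along the
  -- own path, which avoids `a` after its start.
  have key : ∀ {x x' : V} {r r' : List V}, (a :: x :: r).IsChain (P₁ ⊔ P₂ ⊔ P₃).Adj →
      (a :: x' :: r').IsChain (P₁ ⊔ P₂ ⊔ P₃).Adj → a ∉ x :: r → x ∉ a :: x' :: r' →
      b ∈ r → b ∈ r' → ((P₁ ⊔ P₂ ⊔ P₃).deleteEdges {s(a, x)}).Reachable a x := by
    intro x x' r r' c c' ha hx hb hb'
    have e1 := reachable_deleteEdges_of_isChain (e := s(a, x)) (c := x) (v := b) (by simp) c' hx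
      (by simp [hb'])
    have e2 := reachable_deleteEdges_of_isChain (e := s(a, x)) (c := a) (v := b) (by simp)
      (List.isChain_cons_cons.1 c).2 ha (by simp [hb])
    exact e1.trans e2.symm
  refine not_isOuterplanar_of_tripod (G := G) hle (a := a) (x₁ := x₁) (x₂ := x₂) (x₃ := x₃)
    (y₁ := y₁) (y₂ := y₂) (y₃ := y₃) ?_ ?_ ?_ ?_ ?_ ?_ ?_ ?_ hya₁ hya₂ hya₃ hG
  · ext v
    simp only [mem_neighborSet, sup_adj, hP₁, hP₂, hP₃, pathGraphOf_adj_head ha₁,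
      pathGraphOf_adj_head ha₂, pathGraphOf_adj_head ha₃, Set.mem_insert_iff,
      Set.mem_singleton_iff, or_assoc]
  · exact fun h => h12 (by simp [h])
  · exact fun h => h13 (by simp [h])
  · exact fun h => h23 (by simp [h])
  · intro x hx
    simp only [sup_adj, hP₁, hP₂, hP₃, pathGraphOf_adj_head ha₁,
      pathGraphOf_adj_head ha₂, pathGraphOf_adj_head ha₃, or_assoc] at hx
    rcases hx with rfl | rfl | rfl
    · exact key hc₁ hc₂ ha₁ n12 hb₁ hb₂
    · exact key hc₂ hc₁ ha₂ n21 hb₂ hb₁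
    · exact key hc₃ hc₁ ha₃ n31 hb₃ hb₁
  · ext v
    simp only [mem_neighborSet, sup_adj, hP₁, hP₂, hP₃, pathGraphOf_adj_second ha₁ hx₁,
      pathGraphOf_not_adj n12, pathGraphOf_not_adj n13, Set.mem_insert_iff,
      Set.mem_singleton_iff, or_false]
  · ext v
    simp only [mem_neighborSet, sup_adj, hP₁, hP₂, hP₃, pathGraphOf_adj_second ha₂ hx₂,
      pathGraphOf_not_adj n21, pathGraphOf_not_adj n23, Set.mem_insert_iff,
      Set.mem_singleton_iff, or_false, false_or]
  · ext v
    simp only [mem_neighborSet, sup_adj, hP₁, hP₂, hP₃, pathGraphOf_adj_second ha₃ hx₃,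
      pathGraphOf_not_adj n31, pathGraphOf_not_adj n32, Set.mem_insert_iff,
      Set.mem_singleton_iff, false_or]

/-- The vertices of `l` are the inner vertices of a walk from `a` to `b`. -/
def Linked (G : SimpleGraph V) (a : V) (l : List V) (b : V) : Prop :=
  (a :: (l ++ [b])).IsChain G.Adj

theorem linked_nil {a b : V} : G.Linked a [] b ↔ G.Adj a b := by
  simp [Linked]

theorem Linked.symm {a b : V} {l : List V} (h : G.Linked a l b) : G.Linked b l.reverse a := by
  have h' := List.isChain_reverse.2 (h.imp fun _ _ h => h.symm : List.IsChain _ _)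
  simpa [Linked] using h'

theorem linked_append {a b c : V} {l l' : List V} :
    G.Linked a (l ++ b :: l') c ↔ G.Linked a l b ∧ G.Linked b l' c := by
  have := List.isChain_split (R := G.Adj) (c := b) (l₁ := a :: l) (l₂ := l' ++ [c])
  simpa [Linked] using this

theorem Linked.trans {a b c : V} {l l' : List V} (h : G.Linked a l b) (h' : G.Linked b l' c) :
    G.Linked a (l ++ b :: l') c :=
  linked_append.2 ⟨h, h'⟩

theorem IsOuterplanar.not_theta [Finite V] (hG : G.IsOuterplanar) {a b : V} {l₁ l₂ l₃ : List V}
    (hl₁ : l₁ ≠ []) (hl₂ : l₂ ≠ []) (hl₃ : l₃ ≠ []) (hn : (a :: b :: (l₁ ++ l₂ ++ l₃)).Nodup)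
    (h₁ : G.Linked a l₁ b) (h₂ : G.Linked a l₂ b) (h₃ : G.Linked a l₃ b) : False := by
  have split : ∀ l : List V, l ≠ [] → ∃ x y r, l ++ [b] = x :: y :: r ∧ b ∈ y :: r ∧ x ∈ l := by
    rintro (_ | ⟨x, _ | ⟨y, r⟩⟩) hl
    · exact absurd rfl hl
    · exact ⟨x, b, [], by simp⟩
    · exact ⟨x, y, r ++ [b], by simp⟩
  obtain ⟨x₁, y₁, r₁, e₁, hb₁, hx₁⟩ := split l₁ hl₁
  obtain ⟨x₂, y₂, r₂, e₂, hb₂, hx₂⟩ := split l₂ hl₂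
  obtain ⟨x₃, y₃, r₃, e₃, hb₃, hx₃⟩ := split l₃ hl₃
  simp only [List.nodup_cons, List.nodup_append', List.disjoint_append_left, List.mem_cons,
    List.mem_append, not_or] at hn
  obtain ⟨⟨hab, ⟨ha₁, ha₂⟩, ha₃⟩, ⟨⟨hb1, hb2⟩, hb3⟩, ⟨⟨d1, d2, d12⟩, d3, d13, d23⟩⟩ := hn
  have hnd : ∀ l : List V, l.Nodup → a ∉ l → b ∉ l → (a :: (l ++ [b])).Nodup := by
    intro l hl ha hb
    simp [List.nodup_append', hl, ha, hb, hab]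
  have hne : ∀ (l l' : List V) x, List.Disjoint l l' → b ∉ l → x ∈ l → x ∉ l' ++ [b] := by
    intro l l' x hd hb hx hx'
    rcases List.mem_append.1 hx' with h | h
    · exact hd hx h
    · exact hb (List.mem_singleton.1 h ▸ hx)
  rw [Linked] at h₁ h₂ h₃
  refine hG.not_theta_aux (a := a) (b := b) (e₁ ▸ h₁) (e₂ ▸ h₂) (e₃ ▸ h₃) (e₁ ▸ hnd l₁ d1 ha₁ hb1)
    (e₂ ▸ hnd l₂ d2 ha₂ hb2) (e₃ ▸ hnd l₃ d3 ha₃ hb3) hb₁ hb₂ hb₃ (e₂ ▸ hne l₁ l₂ _ d12 hb1 hx₁)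
    (e₃ ▸ hne l₁ l₃ _ d13 hb1 hx₁) (e₁ ▸ hne l₂ l₁ _ d12.symm hb2 hx₂)
    (e₃ ▸ hne l₂ l₃ _ d23 hb2 hx₂) (e₁ ▸ hne l₃ l₁ _ d13.symm hb3 hx₃)
    (e₂ ▸ hne l₃ l₂ _ d23.symm hb3 hx₃)

/-- A nonempty arc `l₁` forms a theta with the path through `c` using the chord `a c` and the path
through `d` using the chord `b d`. The arc `l₃` is not used. -/
theorem IsOuterplanar.not_crossing_aux [Finite V] (hG : G.IsOuterplanar) {a b c d : V}
    {l₁ l₂ l₃ l₄ : List V} (hn : (a :: (l₁ ++ b :: (l₂ ++ c :: (l₃ ++ d :: l₄)))).Nodup)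
    (h₁ : G.Linked a l₁ b) (h₂ : G.Linked b l₂ c) (h₄ : G.Linked d l₄ a)
    (hac : G.Adj a c) (hbd : G.Adj b d) : l₁ = [] := by
  by_contra hl₁
  refine hG.not_theta (a := a) (b := b) (l₁ := l₁) (l₂ := [] ++ c :: l₂.reverse)
    (l₃ := l₄.reverse ++ d :: []) hl₁ (by simp) (by simp) ?_ h₁ ((linked_nil.2 hac).trans h₂.symm)
    (h₄.symm.trans (linked_nil.2 hbd.symm))
  have hp : (a :: (l₁ ++ b :: (l₂ ++ c :: (l₃ ++ d :: l₄)))).Perm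
      ((a :: b :: (l₁ ++ ([] ++ c :: l₂) ++ (l₄ ++ d :: []))) ++ l₃) := by
    classical
    rw [List.perm_iff_count]
    intro x
    simp only [List.count_append, List.count_cons, List.count_nil]
    omega
  have hn' := (List.nodup_append'.1 (hp.nodup_iff.1 hn)).1
  refine List.Perm.nodup (List.Perm.cons _ (List.Perm.cons _ ?_)) hn'
  refine ((List.Perm.refl _).append ?_).append ?_
  · exact (List.reverse_perm l₂).symm.cons c
  · exact (List.reverse_perm l₄).symm.append_right _

theorem IsOuterplanar.not_crossing [Finite V] (hG : G.IsOuterplanar) {a b c d : V}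
    {l₁ l₂ l₃ l₄ : List V} (hn : (a :: (l₁ ++ b :: (l₂ ++ c :: (l₃ ++ d :: l₄)))).Nodup)
    (h₁ : G.Linked a l₁ b) (h₂ : G.Linked b l₂ c) (h₃ : G.Linked c l₃ d) (h₄ : G.Linked d l₄ a)
    (hac : G.Adj a c) (hbd : G.Adj b d) : False := by
  have rot : ∀ {a b c d : V} {l₁ l₂ l₃ l₄ : List V},
      (a :: (l₁ ++ b :: (l₂ ++ c :: (l₃ ++ d :: l₄)))).Nodup →
      (b :: (l₂ ++ c :: (l₃ ++ d :: (l₄ ++ a :: l₁)))).Nodup := by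
    intro a b c d l₁ l₂ l₃ l₄ h
    refine List.Perm.nodup ?_ h
    have := List.perm_append_comm (l₁ := a :: l₁) (l₂ := b :: (l₂ ++ c :: (l₃ ++ d :: l₄)))
    simpa using this
  -- By rotation all four arcs are empty, which leaves four pairwise adjacent vertices.
  have e₁ := hG.not_crossing_aux hn h₁ h₂ h₄ hac hbd
  have e₂ := hG.not_crossing_aux (rot hn) h₂ h₃ h₁ hbd hac.symm
  have e₃ := hG.not_crossing_aux (rot (rot hn)) h₃ h₄ h₂ hac.symm hbd.symm
  have e₄ := hG.not_crossing_aux (rot (rot (rot hn))) h₄ h₁ h₃ hbd.symm hac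
  subst e₁ e₂ e₃ e₄
  simp only [List.nil_append, List.nodup_cons, List.mem_cons, List.not_mem_nil, not_or,
    or_false] at hn
  rw [linked_nil] at h₁ h₂ h₃ h₄
  refine PlaneTopology.not_isOuterplanar_of_fourClique (a := a) (b := b) (c := c) (d := d) ?_
    hn.1.1 hn.1.2.1 hn.1.2.2 hn.2.1.1 hn.2.1.2 hn.2.2.1 hG
  rintro u v ⟨huv, hu, hv⟩
  simp only [Set.mem_insert_iff, Set.mem_singleton_iff] at hu hv
  rcases hu with rfl | rfl | rfl | rfl <;> rcases hv with rfl | rfl | rfl | rfl <;>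
    first
    | exact absurd rfl huv
    | assumption
    | (apply SimpleGraph.Adj.symm; assumption)

end Theta

end SimpleGraph

/-! ### A noncrossing order, by cut vertices and Hamiltonian cycles. -/

namespace SimpleGraph

section Ordering

variable {V : Type*} {G : SimpleGraph V}

/-- Edges between entries of the list do not cross if the list is placed around a circle. -/
def NoncrossingList (G : SimpleGraph V) (L : List V) : Prop :=
  ∀ a b c d, [a, b, c, d].Sublist L → G.Adj a c → ¬ G.Adj b d

/-- Interleaving of two chords is invariant under rotation, so any chosen vertex can be brought to
the front. -/
theorem NoncrossingList.append_singleton {x : V} {L : List V} (h : G.NoncrossingList (x :: L)) :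
    G.NoncrossingList (L ++ [x]) := by
  intro a b c d hs hac hbd
  rw [← List.reverse_sublist] at hs
  simp only [List.reverse_cons, List.reverse_nil, List.nil_append, List.cons_append,
    List.reverse_append] at hs
  rw [List.cons_sublist_cons'] at hs
  rcases hs with hs | ⟨rfl, hs⟩
  · rw [← List.reverse_sublist] at hs
    exact h a b c d (List.Sublist.cons _ (by simpa using hs)) hac hbd
  · rw [← List.reverse_sublist] at hs
    exact h d a b c (List.Sublist.cons_cons _ (by simpa using hs)) hbd.symm hac

theorem NoncrossingList.append_comm : ∀ {L L' : List V}, G.NoncrossingList (L ++ L') →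
    G.NoncrossingList (L' ++ L)
  | [], L', h => by simpa using h
  | x :: L, L', h => by
    have h' : G.NoncrossingList (L ++ (L' ++ [x])) := by
      simpa using NoncrossingList.append_singleton (x := x) (L := L ++ L') (by simpa using h)
    simpa using h'.append_comm

/-- Two crossing edges whose ends are spread over `L` and `L'` would include an edge between `L` and
`L'`. -/
theorem NoncrossingList.glue {x : V} {L L' : List V} (h : G.NoncrossingList (x :: L))
    (h' : G.NoncrossingList (x :: L')) (hno : ∀ u ∈ L, ∀ v ∈ L', ¬ G.Adj u v) :
    G.NoncrossingList (x :: (L ++ L')) := by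
  have mem : ∀ {l M : List V} {z : V}, l.Sublist M → z ∈ l → z ∈ M := fun h hz => h.subset hz
  intro a b c d hs hac hbd
  rw [List.cons_sublist_cons'] at hs
  rcases hs with hs | ⟨rfl, hs⟩
  · obtain ⟨s, s', e, hs, hs'⟩ := List.sublist_append_iff.1 hs
    rcases s with _ | ⟨s1, _ | ⟨s2, _ | ⟨s3, _ | ⟨s4, s⟩⟩⟩⟩ <;>
      simp only [List.nil_append, List.cons_append, List.cons.injEq] at e
    · subst e
      exact h' a b c d (hs'.cons _) hac hbd
    · obtain ⟨rfl, rfl⟩ := e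
      exact hno a (mem hs (by simp)) c (mem hs' (by simp)) hac
    · obtain ⟨rfl, rfl, rfl⟩ := e
      exact hno a (mem hs (by simp)) c (mem hs' (by simp)) hac
    · obtain ⟨rfl, rfl, rfl, rfl⟩ := e
      exact hno b (mem hs (by simp)) d (mem hs' (by simp)) hbd
    · obtain ⟨rfl, rfl, rfl, rfl, e⟩ := e
      obtain ⟨rfl, rfl⟩ := List.append_eq_nil_iff.1 e.symm
      exact h a b c d (hs.cons _) hac hbd
  · obtain ⟨s, s', e, hs, hs'⟩ := List.sublist_append_iff.1 hs
    rcases s with _ | ⟨s2, _ | ⟨s3, _ | ⟨s4, s⟩⟩⟩ <;>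
      simp only [List.nil_append, List.cons_append, List.cons.injEq] at e
    · subst e
      exact h' a b c d (hs'.cons_cons _) hac hbd
    · obtain ⟨rfl, rfl⟩ := e
      exact hno b (mem hs (by simp)) d (mem hs' (by simp)) hbd
    · obtain ⟨rfl, rfl, rfl⟩ := e
      exact hno b (mem hs (by simp)) d (mem hs' (by simp)) hbd
    · obtain ⟨rfl, rfl, rfl, e⟩ := e
      obtain ⟨rfl, rfl⟩ := List.append_eq_nil_iff.1 e.symm
      exact h a b c d (hs.cons_cons _) hac hbd

theorem chain_coe_cons_append_cons {a b : V} {l l' : List V} :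
    Cycle.Chain G.Adj ((a :: (l ++ b :: l') : List V) : Cycle V) ↔
      G.Linked a l b ∧ G.Linked b l' a := by
  rw [← linked_append, Cycle.chain_coe_cons]
  rfl

theorem exists_coe_eq_cons_append_cons {L : List V} {a b : V} (ha : a ∈ L) (hb : b ∈ L)
    (hab : a ≠ b) : ∃ l l', (a :: (l ++ b :: l')).IsRotated L := by
  obtain ⟨s, t, rfl⟩ := List.append_of_mem ha
  have hb' : b ∈ t ++ s := by
    simp only [List.mem_append, List.mem_cons, hab.symm, false_or] at hb ⊢
    exact hb.symm
  obtain ⟨l, l', e⟩ := List.append_of_mem hb'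
  refine ⟨l, l', ?_⟩
  rw [← e, ← List.cons_append]
  exact List.isRotated_append

theorem IsOuterplanar.noncrossingList_of_chain [Finite V] (hG : G.IsOuterplanar) {L : List V}
    (hn : L.Nodup) (hL : Cycle.Chain G.Adj (L : Cycle V)) : G.NoncrossingList L := by
  intro a b c d h₁ hac hbd
  obtain ⟨r₁, r, rfl, ha, h₂⟩ := List.cons_sublist_iff.1 h₁
  obtain ⟨r₂, r, rfl, hb, h₃⟩ := List.cons_sublist_iff.1 h₂
  obtain ⟨r₃, r, rfl, hc, h₄⟩ := List.cons_sublist_iff.1 h₃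
  obtain ⟨p₁, q₁, rfl⟩ := List.append_of_mem ha
  obtain ⟨p₂, q₂, rfl⟩ := List.append_of_mem hb
  obtain ⟨p₃, q₃, rfl⟩ := List.append_of_mem hc
  obtain ⟨p₄, q₄, rfl⟩ := List.append_of_mem (h₄.subset (List.mem_singleton_self d))
  have hrot : (a :: ((q₁ ++ p₂) ++ b :: ((q₂ ++ p₃) ++ c :: ((q₃ ++ p₄) ++ d :: (q₄ ++ p₁))))) ~r
      (p₁ ++ a :: q₁ ++ (p₂ ++ b :: q₂ ++ (p₃ ++ c :: q₃ ++ (p₄ ++ d :: q₄)))) := by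
    have := List.isRotated_append (l := a :: ((q₁ ++ p₂) ++ b :: ((q₂ ++ p₃) ++
      c :: ((q₃ ++ p₄) ++ d :: q₄)))) (l' := p₁)
    simpa using this
  rw [← Cycle.coe_eq_coe.2 hrot, chain_coe_cons_append_cons, linked_append, linked_append] at hL
  exact hG.not_crossing (hrot.nodup_iff.2 hn) hL.1 hL.2.1 hL.2.2.1 hL.2.2.2 hac hbd

theorem Walk.linked_of_adj {a b u v : V} (p : G.Walk u v) (ha : G.Adj a u) (hb : G.Adj v b) :
    G.Linked a p.support b := by
  have := ((p.concat hb).cons ha).isChain_adj_support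
  simpa [Linked, Walk.support_concat] using this

/-- If no vertex separates `S` and the list `L` of vertices of `S` misses a vertex of `S`, then some
path outside of `L` links two different entries of `L`. -/
theorem exists_ear {S : Finset V} {L : List V} (hL : ∀ v ∈ L, v ∈ S)
    (hlen : ∀ x ∈ L, ∃ y ∈ L, y ≠ x) {v : V} (hv : v ∈ S) (hvL : v ∉ L) (hne : L ≠ [])
    (hS : ∀ x ∈ S, ∀ A ⊆ S, A.Nonempty → x ∉ A → (∃ y ∈ S, y ≠ x ∧ y ∉ A) →
      ∃ u ∈ A, ∃ w ∈ S, w ≠ x ∧ w ∉ A ∧ G.Adj u w) :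
    ∃ a ∈ L, ∃ b ∈ L, a ≠ b ∧ ∃ q : List V, q ≠ [] ∧ q.Nodup ∧ (∀ z ∈ q, z ∈ S ∧ z ∉ L) ∧
      G.Linked a q b := by
  classical
  let C : Set V := {z | z ∈ S ∧ z ∉ L}
  let v' : C := ⟨v, hv, hvL⟩
  -- `K` is the component of `v` after removal of `L`. For every `x` in `L`, an edge leaves `K`
  -- without ending in `x`, and by the choice of `K` it ends in `L`; using this twice gives two
  -- different ends.
  let K : Finset V := S.filter fun z => ∃ hz : z ∈ C, (G.induce C).Reachable v' ⟨z, hz⟩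
  have hout : ∀ x ∈ L, ∃ w ∈ L, w ≠ x ∧ ∃ k : C, (G.induce C).Reachable v' k ∧ G.Adj k w := by
    intro x hx
    obtain ⟨y, hy, hyx⟩ := hlen x hx
    have hLK : ∀ z ∈ L, z ∉ K := fun z hz hzK => (Finset.mem_filter.1 hzK).2.1.2 hz
    obtain ⟨u, hu, w, hw, hwx, hwK, huw⟩ := hS x (hL x hx) K (Finset.filter_subset _ _)
      ⟨v, Finset.mem_filter.2 ⟨hv, v'.2, Reachable.refl _⟩⟩ (hLK x hx)
      ⟨y, hL y hy, hyx, hLK y hy⟩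
    obtain ⟨-, huC, hur⟩ := Finset.mem_filter.1 hu
    refine ⟨w, ?_, hwx, ⟨u, huC⟩, hur, huw⟩
    by_contra hwL
    refine hwK (Finset.mem_filter.2 ⟨hw, ⟨hw, hwL⟩, hur.trans ?_⟩)
    exact Adj.reachable (G := G.induce C) (u := ⟨u, huC⟩) (v := ⟨w, hw, hwL⟩) huw
  obtain ⟨x, hx⟩ := List.exists_mem_of_ne_nil L hne
  obtain ⟨a, ha, -, k, hk, hka⟩ := hout x hx
  obtain ⟨b, hb, hba, k', hk', hkb⟩ := hout a ha
  obtain ⟨p, hp⟩ := (hk.symm.trans hk').exists_isPath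
  refine ⟨a, ha, b, hb, hba.symm, p.support.map Subtype.val, ?_,
    hp.support_nodup.map Subtype.val_injective, ?_, ?_⟩
  · exact fun h => p.support_ne_nil (List.map_eq_nil_iff.1 h)
  · intro z hz
    obtain ⟨z', -, rfl⟩ := List.mem_map.1 hz
    exact z'.2
  · have := (p.map (Embedding.induce C).toHom).linked_of_adj (a := a) (b := b) hka.symm hkb
    rwa [Walk.support_map] at this

/-- A longest cycle is Hamiltonian. An ear over a missed vertex lengthens it if the ends of the ear
are consecutive on the cycle, and forms a theta with the two arcs otherwise. -/
theorem IsOuterplanar.exists_chain [Finite V] (hG : G.IsOuterplanar) {S : Finset V}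
    (hcard : 2 < S.card)
    (hS : ∀ x ∈ S, ∀ A ⊆ S, A.Nonempty → x ∉ A → (∃ y ∈ S, y ≠ x ∧ y ∉ A) →
      ∃ u ∈ A, ∃ w ∈ S, w ≠ x ∧ w ∉ A ∧ G.Adj u w) :
    ∃ L : List V, L.Nodup ∧ (∀ v, v ∈ L ↔ v ∈ S) ∧ Cycle.Chain G.Adj (L : Cycle V) := by
  classical
  -- Length 2 is admitted, so that a single edge, traversed back and forth, starts the search.
  let N : Set ℕ := {n | 2 ≤ n ∧ ∃ L : List V, L.Nodup ∧ (∀ v ∈ L, v ∈ S) ∧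
    Cycle.Chain G.Adj (L : Cycle V) ∧ L.length = n}
  have hbdd : BddAbove N := by
    refine ⟨S.card, ?_⟩
    rintro _ ⟨-, L, hn, hL, -, rfl⟩
    rw [← List.toFinset_card_of_nodup hn]
    exact Finset.card_le_card fun z hz => hL z (List.mem_toFinset.1 hz)
  have hne : N.Nonempty := by
    obtain ⟨x, y, z, hx, hy, hz, hxy, hxz, hyz⟩ := Finset.two_lt_card_iff.1 hcard
    obtain ⟨u, hu, w, hw, -, hwy, huw⟩ := hS x hx {y} (by simpa using hy) (by simp) (by simpa)
      ⟨z, hz, hxz.symm, by simpa using hyz.symm⟩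
    refine ⟨2, le_rfl, [u, w], by simpa using huw.ne, ?_, ?_, rfl⟩
    · rw [Finset.mem_singleton] at hu
      simp [hu, hy, hw]
    · simp [huw, huw.symm]
  obtain ⟨h2, L, hn, hLS, hch, hlen⟩ := Nat.sSup_mem hne hbdd
  have hmax : ∀ L' : List V, L'.Nodup → (∀ v ∈ L', v ∈ S) → Cycle.Chain G.Adj (L' : Cycle V) →
      L'.length ≤ L.length := by
    intro L' h1 h3 h4
    rcases Nat.lt_or_ge L'.length 2 with h | h
    · omega
    · rw [hlen]
      exact le_csSup hbdd ⟨h, L', h1, h3, h4, rfl⟩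
  refine ⟨L, hn, fun v => ⟨hLS v, fun hv => ?_⟩, hch⟩
  by_contra hvL
  have hother : ∀ x ∈ L, ∃ y ∈ L, y ≠ x := by
    intro x hx
    have : 1 < L.toFinset.card := by
      rw [List.toFinset_card_of_nodup hn]
      omega
    obtain ⟨y, hy, hyx⟩ := Finset.exists_mem_ne this x
    exact ⟨y, List.mem_toFinset.1 hy, hyx⟩
  obtain ⟨a, ha, b, hb, hab, q, hq, hqn, hqS, hlink⟩ := exists_ear hLS hother hv hvL
    (by rintro rfl; simp at hlen; omega) hS
  obtain ⟨l₁, l₂, hrot⟩ := exists_coe_eq_cons_append_cons ha hb hab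
  rw [← Cycle.coe_eq_coe.2 hrot, chain_coe_cons_append_cons] at hch
  have hn' := hrot.nodup_iff.2 hn
  have hmem : ∀ z, z ∈ a :: (l₁ ++ b :: l₂) ↔ z ∈ L := fun z => hrot.perm.mem_iff
  have hlen' := hrot.perm.length_eq
  have hq0 : 0 < q.length := List.length_pos_iff.2 hq
  have hall : (a :: (l₁ ++ b :: l₂) ++ q).Nodup := by
    rw [List.nodup_append']
    exact ⟨hn', hqn, fun z hz hzq => (hqS z hzq).2 ((hmem z).1 hz)⟩
  have hallS : ∀ z ∈ a :: (l₁ ++ b :: l₂) ++ q, z ∈ S := by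
    intro z hz
    rcases List.mem_append.1 hz with h | h
    · exact hLS z ((hmem z).1 h)
    · exact (hqS z h).1
  rcases eq_or_ne l₁ [] with rfl | h1
  · have hp : (a :: (q ++ b :: l₂)).Perm (a :: ([] ++ b :: l₂) ++ q) := by
      simpa using (List.perm_append_comm (l₁ := q) (l₂ := b :: l₂)).cons a
    have := hmax _ (hp.nodup_iff.2 hall) (fun z hz => hallS z (hp.mem_iff.1 hz))
      (chain_coe_cons_append_cons.2 ⟨hlink, hch.2⟩)
    simp only [List.length_cons, List.length_append, List.length_nil] at this hlen'
    omega
  rcases eq_or_ne l₂ [] with rfl | h2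
  · have hp : (a :: (l₁ ++ b :: q.reverse)).Perm (a :: (l₁ ++ b :: []) ++ q) := by
      simpa using ((List.reverse_perm q).cons b).append_left (a :: l₁)
    have := hmax _ (hp.nodup_iff.2 hall) (fun z hz => hallS z (hp.mem_iff.1 hz))
      (chain_coe_cons_append_cons.2 ⟨hch.1, hlink.symm⟩)
    simp only [List.length_cons, List.length_append, List.length_nil, List.length_reverse]
      at this hlen'
    omega
  · refine hG.not_theta h1 (by simpa using h2 : l₂.reverse ≠ []) hq ?_ hch.1 hch.2.symm hlink
    have hp : (a :: b :: (l₁ ++ l₂.reverse ++ q)).Perm (a :: (l₁ ++ b :: l₂) ++ q) := by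
      have e1 : (b :: (l₁ ++ l₂.reverse)).Perm (l₁ ++ b :: l₂) :=
        (((List.reverse_perm l₂).append_left l₁).cons b).trans List.perm_middle.symm
      simpa using (e1.append_right q).cons a
    exact hp.nodup_iff.2 hall

/-- If a vertex `x` separates `S`, the lists of the two sides are rotated to begin at `x` and
concatenated. Otherwise a Hamiltonian cycle does it, or there are at most two vertices. -/
theorem IsOuterplanar.exists_noncrossingList [Finite V] (hG : G.IsOuterplanar) (S : Finset V) :
    ∃ L : List V, L.Nodup ∧ (∀ v, v ∈ L ↔ v ∈ S) ∧ G.NoncrossingList L := by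
  classical
  induction S using Finset.strongInduction with
  | H S ih =>
  by_cases hS : ∀ x ∈ S, ∀ A ⊆ S, A.Nonempty → x ∉ A → (∃ y ∈ S, y ≠ x ∧ y ∉ A) →
      ∃ u ∈ A, ∃ w ∈ S, w ≠ x ∧ w ∉ A ∧ G.Adj u w
  · rcases Nat.lt_or_ge 2 S.card with hcard | hcard
    · obtain ⟨L, hn, hL, hch⟩ := hG.exists_chain hcard hS
      exact ⟨L, hn, hL, hG.noncrossingList_of_chain hn hch⟩
    · refine ⟨S.toList, S.nodup_toList, fun v => S.mem_toList, fun a b c d hs => ?_⟩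
      have := hs.length_le
      rw [Finset.length_toList] at this
      simp at this
      omega
  · push Not at hS
    obtain ⟨x, hx, A, hAS, ⟨z, hz⟩, hxA, ⟨y, hy, hyx, hyA⟩, hno⟩ := hS
    have hsub : insert x A ⊂ S := by
      refine Finset.ssubset_iff_subset_ne.2 ⟨Finset.insert_subset hx hAS, ?_⟩
      rintro h
      rw [← h] at hy
      exact (Finset.mem_insert.1 hy).elim hyx hyA
    have hsub' : S \ A ⊂ S :=
      Finset.ssubset_iff_subset_ne.2 ⟨Finset.sdiff_subset, fun h =>
        (Finset.mem_sdiff.1 (h.symm.subset (hAS hz))).2 hz⟩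
    have first : ∀ T : Finset V, T ⊂ S → x ∈ T →
        ∃ L : List V, (x :: L).Nodup ∧ (∀ v, v ∈ x :: L ↔ v ∈ T) ∧ G.NoncrossingList (x :: L) := by
      intro T hT hxT
      obtain ⟨L, hn, hL, hnc⟩ := ih T hT
      obtain ⟨s, t, rfl⟩ := List.append_of_mem ((hL x).2 hxT)
      refine ⟨t ++ s, ?_, ?_, ?_⟩
      · exact (List.perm_append_comm (l₁ := x :: t) (l₂ := s)).nodup_iff.2 hn
      · exact fun v => (List.perm_append_comm (l₁ := x :: t) (l₂ := s)).mem_iff.trans (hL v)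
      · exact hnc.append_comm
    obtain ⟨L, hn, hL, hnc⟩ := first _ hsub (Finset.mem_insert_self x A)
    obtain ⟨L', hn', hL', hnc'⟩ := first _ hsub' (Finset.mem_sdiff.2 ⟨hx, hxA⟩)
    have hLA : ∀ u ∈ L, u ∈ A := fun u hu =>
      (Finset.mem_insert.1 ((hL u).1 (List.mem_cons_of_mem _ hu))).resolve_left
        fun h => (List.nodup_cons.1 hn).1 (h ▸ hu)
    have hLA' : ∀ u ∈ L', u ∈ S ∧ u ∉ A ∧ u ≠ x := fun u hu => by
      have := Finset.mem_sdiff.1 ((hL' u).1 (List.mem_cons_of_mem _ hu))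
      exact ⟨this.1, this.2, fun h => (List.nodup_cons.1 hn').1 (h ▸ hu)⟩
    refine ⟨x :: (L ++ L'), ?_, fun v => ?_, hnc.glue hnc' fun u hu v hv =>
      hno u (hLA u hu) v (hLA' v hv).1 (hLA' v hv).2.2 (hLA' v hv).2.1⟩
    · rw [List.nodup_cons] at hn hn' ⊢
      refine ⟨fun h => (List.mem_append.1 h).elim hn.1 hn'.1, ?_⟩
      exact List.nodup_append'.2 ⟨hn.2, hn'.2, fun u hu hu' => (hLA' u hu').2.1 (hLA u hu)⟩
    · constructor
      · intro hv
        rcases List.mem_cons.1 hv with rfl | hv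
        · exact hx
        rcases List.mem_append.1 hv with hv | hv
        · exact hAS (hLA v hv)
        · exact (hLA' v hv).1
      · intro hv
        by_cases hvA : v ∈ A
        · have := (hL v).2 (Finset.mem_insert_of_mem hvA)
          simp only [List.mem_cons, List.mem_append] at this ⊢
          tauto
        · have := (hL' v).2 (Finset.mem_sdiff.2 ⟨hv, hvA⟩)
          simp only [List.mem_cons, List.mem_append] at this ⊢
          tauto

theorem IsOuterplanar.exists_isNoncrossing [Finite V] (hG : G.IsOuterplanar) :
    ∃ _ : LinearOrder V, G.IsNoncrossing := by
  classical
  have := Fintype.ofFinite V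
  obtain ⟨L, -, hL, hnc⟩ := hG.exists_noncrossingList Finset.univ
  have hmem : ∀ v, v ∈ L := fun v => (hL v).2 (Finset.mem_univ v)
  obtain ⟨f, hf⟩ : ∃ f : V → Fin L.length, ∀ v, L[(f v : ℕ)] = v :=
    ⟨fun v => ⟨L.idxOf v, List.idxOf_lt_length_iff.2 (hmem v)⟩, fun v => by simp⟩
  have hinj : Function.Injective f := fun u v h => by
    rw [← hf u, ← hf v]
    simp only [h]
  refine ⟨LinearOrder.lift' f hinj, fun a b c d hab hbc hcd hac => hnc a b c d ?_ hac⟩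
  have hab' : f a < f b := hab
  have hbc' : f b < f c := hbc
  have hcd' : f c < f d := hcd
  have := List.map_getElem_sublist (l := L) (is := [f a, f b, f c, f d]) (by
    simp only [List.pairwise_cons, List.mem_cons, List.not_mem_nil, or_false,
      forall_eq_or_imp, forall_eq, false_implies, implies_true, List.Pairwise.nil, and_true]
    omega)
  simpa [hf] using this

end Ordering

end SimpleGraph

/-! ### Graphs with at most two vertices, and the theorem. -/

namespace SimpleGraph

theorem Connected.dominationNumber_le_one {V : Type*} [Fintype V] {G : SimpleGraph V}
    (hG : G.Connected) (hV : Fintype.card V ≤ 2) : G.dominationNumber ≤ 1 := by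
  obtain ⟨x⟩ := hG.nonempty
  refine Nat.sInf_le ⟨{x}, fun v hv => ⟨x, Finset.mem_singleton_self x, ?_⟩,
    Finset.card_singleton x⟩
  have hvx : v ≠ x := fun h => hv (Finset.mem_singleton.2 h)
  have : Nontrivial V := ⟨v, x, hvx⟩
  obtain ⟨w, hw⟩ := hG.preconnected.exists_adj_of_nontrivial v
  by_contra hn
  have hwx : w ≠ x := fun h => hn (h ▸ hw)
  have := Finset.two_lt_card_iff.2 ⟨v, x, w, Finset.mem_univ v, Finset.mem_univ x,
    Finset.mem_univ w, hvx, hw.ne, hwx.symm⟩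
  rw [Finset.card_univ] at this
  omega

theorem one_le_packingNumber {V : Type*} [Fintype V] [Nonempty V] (G : SimpleGraph V) :
    1 ≤ G.packingNumber := by
  obtain ⟨x⟩ := ‹Nonempty V›
  refine le_csSup ⟨Fintype.card V, ?_⟩ ⟨{x}, ?_, Finset.card_singleton x⟩
  · rintro _ ⟨Y, -, rfl⟩
    exact Finset.card_le_univ Y
  · intro u hu v hv huv
    rw [Finset.mem_singleton] at hu hv
    exact absurd (hu.trans hv.symm) huv

end SimpleGraph

theorem mainTheorem3 {V : Type*} [Fintype V] (G : SimpleGraph V) [DecidableRel G.Adj]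
    (hconn : G.Connected) (hmax : G.IsMaximalOuterplanar) (t : ℕ)
    (ht : t = (Finset.univ.filter fun v : V => G.degree v ≤ 3).card) :
    (G.dominationNumber : ℝ) ≤
      min (3 * (G.packingNumber : ℝ)) (9 / 4 * (G.packingNumber : ℝ) + (t : ℝ) / 4) := by
  obtain ⟨_, hnc⟩ := hmax.1.exists_isNoncrossing
  have h := hnc.isPolygonTriangulation hmax
  rcases Nat.lt_or_ge 2 (Fintype.card V) with hV | hV
  · have : Nontrivial V := Fintype.one_lt_card_iff_nontrivial.1 (by omega)
    have h1 : (G.dominationNumber : ℝ) ≤ 3 * G.packingNumber := mod_cast h.dominationNumber_le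
    have h2 : (4 * G.dominationNumber : ℝ) ≤ 9 * G.packingNumber + t := by
      rw [ht]
      exact_mod_cast h.four_mul_dominationNumber_le_packingNumber hV
    exact le_min h1 (by linarith)
  -- The colouring and profile arguments need a triangle; here `γ ≤ 1 ≤ ρ` suffices for both bounds.
  · have := hconn.nonempty
    have h1 : (G.dominationNumber : ℝ) ≤ 1 := mod_cast hconn.dominationNumber_le_one hV
    have h2 : (1 : ℝ) ≤ G.packingNumber := mod_cast G.one_le_packingNumber
    have h3 : (0 : ℝ) ≤ t := t.cast_nonneg
    exact le_min (by linarith) (by linarith)
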